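/- Let $k\ge 0$ be an integer and let $\mathcal P\subseteq\mathbb Z_{\ge 0}$ contain $0$ and at least one integer $\ge 2$. For $i\ge 0$ put $\mathcal P-i=\{n-i : n\in\mathcal P,\ n\ge i\}$ and $e_{\mathcal P}(t)=\sum_{n\in\mathcal P} t^n/n!$. Let $\tau_{\mathcal P}$ be the unique real $\tau>0$ with $e_{\mathcal P}(\tau)-\tau e_{\mathcal P}'(\tau)=0$, let $\rho_{\mathcal P}=\tau_{\mathcal P}/e_{\mathcal P}(\tau_{\mathcal P})$, and let $\tau_k^{\mathcal P}=T^{\mathcal P}_{\le k-1}(\rho_{\mathcal P})$, where $T^{\mathcal P}_{\le k-1}(z)$ is the exponential generating function of the labeled rooted trees of height at most $k-1$ in which every node has a number of children in $\mathcal P$ (so $\tau_0^{\mathcal P}=0$). Call a function, or a partial function, $f$ from $[n]=\{1,\dots,n\}$ to $[n]$ *admissible* if $|f^{-1}(x)|\in\mathcal P$ for every $x\in[n]$. Consider the exponential generating functions $\sum_{n\ge 0} a_n z^n/n!$ in which $a_n$ is as follows: * $F^{\mathcal P}(z)$: the number of admissible functions on $[n]$; * $P^{\mathcal P}(z)$: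 the number of admissible partial functions on $[n]$; * $\Xi^{\mathrm{CYC},\mathcal P}(z)$: the total number of nodes lying on cycles, summed over all admissible functions on $[n]$; * $\Xi^{k,\mathcal P}(z)$: the total number of nodes not in $f^k([n])$, summed over all admissible functions $f$ on $[n]$; * $\Xi^{\mathrm{partial},k,\mathcal P}(z)$: the total number of nodes not in $f^k([n])$, summed over all admissible partial functions $f$ on $[n]$. (Equivalently, each $\Xi$ is the derivative in $u$ at $u=1$ of the bivariate generating function in which the nodes in question are marked by $u$.) Then these five power series converge for $|z|<\rho_{\mathcal P}$ and extend analytically to a neighborhood of $\rho_{\mathcal P}$ slit along the ray $[\rho_{\mathcal P},\infty)$. As $z\to\rho_{\mathcal P}$ off this ray (in particular, as $z$ is real and tends to $\rho_{\mathcal P}$ from below), $$F^{\mathcal P}(z)\sim\frac{1}{\sqrt{2\tau_{\mathcal P}\rho_{\mathcal P}e_{\mathcal P-2}(\tau_{\mathcal P})}}\Big(1-\frac z{\rho_{\mathcal P}}\Big)^{-1/2},$$ $$\Xi^{\mathrm{CYC},\mathcal P}(z)\sim\frac{1}{2\tau_{\mathcal P}\rho_{\mathcal P}e_{\mathcal P-2}(\tau_{\mathcal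 P})}\Big(1-\frac z{\rho_{\mathcal P}}\Big)^{-1},$$ $$\Xi^{k,\mathcal P}(z)\sim\frac{\tau_k^{\mathcal P}}{\tau_{\mathcal P}^2}\sqrt{\frac{e_{\mathcal P}(\tau_{\mathcal P})}{8e_{\mathcal P-2}(\tau_{\mathcal P})}}\Big(1-\frac z{\rho_{\mathcal P}}\Big)^{-3/2},$$ $$P^{\mathcal P}(z)\sim e^{\tau_{\mathcal P}}F^{\mathcal P}(z),\qquad \Xi^{\mathrm{partial},k,\mathcal P}(z)\sim e^{\tau_{\mathcal P}}\,\Xi^{k,\mathcal P}(z).$$ Here $f\sim g$ means $f-g=o(g)$, i.e. $f/g\to 1$ whenever $g$ has no zeros near $\rho_{\mathcal P}$; for $k=0$ both sides of the two relations containing $k$ vanish identically. Powers are principal. If, in addition, $\gcd(\mathcal P)=1$, then there is an $r>\rho_{\mathcal P}$ such that all five functions are analytic on the open disc $|z|<r$ slit along $[\rho_{\mathcal P},\infty)$; consequently $F^{\mathcal P}(\rho_{\mathcal P}z)$, $\Xi^{\mathrm{CYC},\mathcal P}(\rho_{\mathcal P}z)$, $\Xi^{k,\mathcal P}(\rho_{\mathcal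 P}z)$, $P^{\mathcal P}(\rho_{\mathcal P}z)$ and $\Xi^{\mathrm{partial},k,\mathcal P}(\rho_{\mathcal P}z)$ are $\Delta$-analytic, i.e. each is analytic on some domain $\{z: |z|<R,\ z\ne 1,\ |\arg(z-1)|>\phi\}$ with $R>1$ and $0<\phi<\pi/2$. -/

import Mathlib

open Set Filter Topology Asymptotics

namespace PreimageConstraint

noncomputable section

/-! ### Truncated exponentials and the constants `τ`, `ρ` -/

/-- `P - i`: subtract `i` from every element of `P` and keep the nonnegative results. -/
def shift (P : Set ℕ) (i : ℕ) : Set ℕ := {m | m + i ∈ P}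

/-- The truncated exponential `e_P(t) = ∑_{n ∈ P} t ^ n / n!`, for real `t`. -/
def truncExp (P : Set ℕ) (t : ℝ) : ℝ :=
  ∑' n : ℕ, P.indicator (fun n => t ^ n / (n.factorial : ℝ)) n

/-- `t` is a positive real with `e_P(t) - t e_P'(t) = 0`. -/
def IsTau (P : Set ℕ) (t : ℝ) : Prop :=
  0 < t ∧ truncExp P t - t * deriv (truncExp P) t = 0

/-- `τ_P`: the positive real with `e_P(τ) - τ e_P'(τ) = 0`; it exists and is unique when `0 ∈ P`
and `P - 2` is nonempty, see `existsUnique_isTau` and `isTau_tau` below. -/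
def tau (P : Set ℕ) : ℝ := Classical.epsilon (IsTau P)

/-- `ρ_P = τ_P / e_P(τ_P)`. -/
def rho (P : Set ℕ) : ℝ := tau P / truncExp P (tau P)

lemma summable_truncExp (P : Set ℕ) (t : ℝ) :
    Summable fun n : ℕ => P.indicator (fun n => t ^ n / (n.factorial : ℝ)) n :=
  (Real.summable_pow_div_factorial t).indicator P

lemma hasDerivAt_truncExp (P : Set ℕ) (t : ℝ) :
    HasDerivAt (truncExp P) (truncExp (shift P 1) t) t := by
  set R : ℝ := |t| + 1
  have hR : 0 < R := by positivity
  have key : HasDerivAt (truncExp P)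
      (∑' n : ℕ, P.indicator (fun n => (n : ℝ) * t ^ (n - 1) / (n.factorial : ℝ)) n) t := by
    have hsum : Summable fun n : ℕ => (n : ℝ) * R ^ (n - 1) / (n.factorial : ℝ) := by
      rw [← summable_nat_add_iff 1]
      refine (Real.summable_pow_div_factorial R).congr fun n => ?_
      rw [Nat.factorial_succ, Nat.add_sub_cancel]
      push_cast
      field_simp
    refine hasDerivAt_tsum_of_isPreconnected (t := Metric.ball (0 : ℝ) R)
      (g := fun (n : ℕ) (y : ℝ) => P.indicator (fun n => y ^ n / (n.factorial : ℝ)) n)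
      (g' := fun (n : ℕ) (y : ℝ) =>
        P.indicator (fun n => (n : ℝ) * y ^ (n - 1) / (n.factorial : ℝ)) n)
      hsum Metric.isOpen_ball (convex_ball _ _).isPreconnected ?_ ?_ (y₀ := 0) ?_ ?_ ?_
    · intro n y _
      by_cases hn : n ∈ P
      · simpa [hn] using (hasDerivAt_pow n y).div_const (n.factorial : ℝ)
      · simpa [hn] using hasDerivAt_const y (0 : ℝ)
    · intro n y hy
      have hy' : |y| ≤ R := by
        have := Metric.mem_ball.1 hy
        rw [dist_zero_right, Real.norm_eq_abs] at this
        exact this.le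
      by_cases hn : n ∈ P
      · simp only [Set.indicator_of_mem hn, norm_div, norm_mul, norm_pow, Real.norm_eq_abs,
          Nat.abs_cast]
        gcongr
      · simp only [Set.indicator_of_notMem hn, norm_zero]
        positivity
    · simpa using hR
    · exact summable_truncExp P 0
    · simp [R]
  convert key using 1
  rw [Summable.tsum_eq_zero_add (f := fun n : ℕ =>
    P.indicator (fun n => (n : ℝ) * t ^ (n - 1) / (n.factorial : ℝ)) n)]
  · have h0 : P.indicator (fun n : ℕ => (n : ℝ) * t ^ (n - 1) / (n.factorial : ℝ)) 0 = 0 := by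
      by_cases h : 0 ∈ P <;> simp [h]
    rw [h0, zero_add]
    refine tsum_congr fun n => ?_
    by_cases hn : n + 1 ∈ P
    · rw [Set.indicator_of_mem hn, Set.indicator_of_mem (show n ∈ shift P 1 from hn),
        Nat.factorial_succ, Nat.add_sub_cancel]
      push_cast
      field_simp
    · rw [Set.indicator_of_notMem hn, Set.indicator_of_notMem (show n ∉ shift P 1 from hn)]
  · rw [← summable_nat_add_iff 1]
    refine (summable_truncExp (shift P 1) t).congr fun n => ?_
    by_cases hn : n + 1 ∈ P
    · rw [Set.indicator_of_mem hn, Set.indicator_of_mem (show n ∈ shift P 1 from hn),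
        Nat.factorial_succ, Nat.add_sub_cancel]
      push_cast
      field_simp
    · rw [Set.indicator_of_notMem hn, Set.indicator_of_notMem (show n ∉ shift P 1 from hn)]

lemma truncExp_pos {P : Set ℕ} (hP : P.Nonempty) {t : ℝ} (ht : 0 < t) : 0 < truncExp P t := by
  obtain ⟨n, hn⟩ := hP
  refine (summable_truncExp P t).tsum_pos (fun m => ?_) n ?_
  · exact Set.indicator_nonneg (fun m _ => by positivity) m
  · rw [Set.indicator_of_mem hn]; positivity

lemma truncExp_mono (P : Set ℕ) {s t : ℝ} (hs : 0 ≤ s) (hst : s ≤ t) :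
    truncExp P s ≤ truncExp P t :=
  (summable_truncExp P s).tsum_le_tsum
    (fun _ => Set.indicator_le_indicator (by gcongr)) (summable_truncExp P t)

lemma shift_shift_one (P : Set ℕ) : shift (shift P 1) 1 = shift P 2 := by
  ext m; simp [shift, add_assoc]

lemma truncExp_zero {P : Set ℕ} (h0 : 0 ∈ P) : truncExp P 0 = 1 := by
  unfold truncExp
  rw [tsum_eq_single 0]
  · simp [h0]
  · intro n hn
    by_cases h : n ∈ P <;> simp [h, hn]

/-- `τ_P` is well defined. -/
theorem existsUnique_isTau {P : Set ℕ} (h0 : 0 ∈ P) (h2 : (shift P 2).Nonempty) :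
    ∃! t : ℝ, IsTau P t := by
  set φ : ℝ → ℝ := fun t => truncExp P t - t * deriv (truncExp P) t with hφ
  have hd : deriv (truncExp P) = truncExp (shift P 1) :=
    funext fun t => (hasDerivAt_truncExp P t).deriv
  have hφ' : ∀ t, HasDerivAt φ (-(t * truncExp (shift P 2) t)) t := by
    intro t
    have h1 := hasDerivAt_truncExp P t
    have h3 := hasDerivAt_truncExp (shift P 1) t
    rw [shift_shift_one] at h3
    rw [hφ, hd]
    refine (h1.sub ((hasDerivAt_id t).mul h3)).congr_deriv ?_
    simp
  have hcont : Continuous φ := continuous_iff_continuousAt.2 fun t => (hφ' t).continuousAt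
  have hanti : StrictAntiOn φ (Ici 0) := by
    refine strictAntiOn_of_deriv_neg (convex_Ici 0) hcont.continuousOn fun t ht => ?_
    rw [interior_Ici, mem_Ioi] at ht
    rw [(hφ' t).deriv]
    have := mul_pos ht (truncExp_pos h2 ht)
    linarith
  have hφ0 : φ 0 = 1 := by simp [hφ, truncExp_zero h0]
  set c := truncExp (shift P 2) 1
  have hc : 0 < c := truncExp_pos h2 one_pos
  have hφ1 : φ 1 ≤ 1 := by
    have h := hanti.antitoneOn (mem_Ici.2 (le_refl (0 : ℝ))) (mem_Ici.2 zero_le_one) zero_le_one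
    exact h.trans_eq hφ0
  have hlin : AntitoneOn (fun t => φ t + c * t) (Ici 1) := by
    have hD : ∀ t, HasDerivAt (fun t => φ t + c * t) (-(t * truncExp (shift P 2) t) + c) t := by
      intro t
      refine ((hφ' t).add ((hasDerivAt_id t).const_mul c)).congr_deriv ?_
      simp
    refine antitoneOn_of_deriv_nonpos (convex_Ici 1)
      (fun t _ => (hD t).continuousAt.continuousWithinAt)
      (fun t _ => (hD t).differentiableAt.differentiableWithinAt) fun t ht => ?_
    rw [interior_Ici, mem_Ioi] at ht
    rw [(hD t).deriv]
    have h1 : c ≤ truncExp (shift P 2) t := truncExp_mono _ zero_le_one ht.le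
    nlinarith
  set M : ℝ := 1 + 1 / c with hM
  have hM1 : (1 : ℝ) ≤ M := by
    have : 0 < 1 / c := by positivity
    linarith
  have hφM : φ M ≤ 0 := by
    have h := hlin (mem_Ici.2 le_rfl) (mem_Ici.2 hM1) hM1
    simp only at h
    have hcM : c * M = c + 1 := by rw [hM]; field_simp
    linarith
  obtain ⟨t, ht, htz⟩ := intermediate_value_Icc' (zero_le_one.trans hM1) hcont.continuousOn
    (show (0 : ℝ) ∈ Icc (φ M) (φ 0) from ⟨hφM, by rw [hφ0]; exact zero_le_one⟩)
  refine ⟨t, ⟨lt_of_le_of_ne ht.1 ?_, htz⟩, fun s hs => ?_⟩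
  · rintro rfl
    rw [hφ0] at htz
    exact one_ne_zero htz
  · exact hanti.injOn (mem_Ici.2 hs.1.le) (mem_Ici.2 ht.1)
      ((show φ s = 0 from hs.2).trans htz.symm)

theorem isTau_tau {P : Set ℕ} (h0 : 0 ∈ P) (h2 : (shift P 2).Nonempty) : IsTau P (tau P) :=
  Classical.epsilon_spec (existsUnique_isTau h0 h2).exists

/-! ### The combinatorial classes

Functions and partial functions of an `n`-element set to itself; a partial function is a map to
`Option`, with value `none` where it is undefined. -/

/-- All preimage sizes `|f⁻¹(x)|` of the function `f` lie in `P`. -/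
def FunConstraint (P : Set ℕ) {n : ℕ} (f : Fin n → Fin n) : Prop :=
  ∀ x, {y | f y = x}.ncard ∈ P

/-- All preimage sizes `|f⁻¹(x)|` of the partial function `f` lie in `P`. -/
def PartialConstraint (P : Set ℕ) {n : ℕ} (f : Fin n → Option (Fin n)) : Prop :=
  ∀ x, {y | f y = some x}.ncard ∈ P

/-- The `k`-th iterate of a partial function. -/
def partialIter {n : ℕ} (f : Fin n → Option (Fin n)) (k : ℕ) (x : Fin n) : Option (Fin n) :=
  (fun o : Option (Fin n) => o.bind f)^[k] (some x)

/-- Number of nodes not in the `k`-th image of the function `f`. -/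
def funMissed (k : ℕ) {n : ℕ} (f : Fin n → Fin n) : ℕ :=
  {x | x ∉ Set.range f^[k]}.ncard

/-- Number of nodes of the function `f` which lie on a cycle. -/
def funCyclic {n : ℕ} (f : Fin n → Fin n) : ℕ :=
  (Function.periodicPts f).ncard

/-- Number of nodes not in the `k`-th image of the partial function `f`. -/
def partialMissed (k : ℕ) {n : ℕ} (f : Fin n → Option (Fin n)) : ℕ :=
  {x | ∀ y, partialIter f k y ≠ some x}.ncard

/-- A labeled rooted tree on `Fin n`, given by its parent map: the edges point towards the root,
exactly one node (the root) has no parent, and every node is led to the root. -/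
def IsRootedTree {n : ℕ} (f : Fin n → Option (Fin n)) : Prop :=
  ∃ r, (∀ x, f x = none ↔ x = r) ∧ ∀ x, ∃ d, partialIter f d x = some r

/-- The rooted tree `f` has height less than `k`: every node has distance less than `k` from
the root. -/
def HeightLT {n : ℕ} (f : Fin n → Option (Fin n)) (k : ℕ) : Prop :=
  ∀ x r, f r = none → ∃ d < k, partialIter f d x = some r

/-! ### Generating functions -/

/-- The exponential generating function `∑ u ^ χ(a) z ^ |a| / |a|!` of the class whose objects of
size `n` are the `a : A n` with `S n a`, and of the parameter `χ`: a power series in `z` with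
coefficients polynomials in `u`. -/
def bivariateGF (A : ℕ → Type) [∀ n, Finite (A n)] (S : ∀ n, A n → Prop) (χ : ∀ n, A n → ℕ) :
    PowerSeries (Polynomial ℂ) :=
  PowerSeries.mk fun n =>
    Polynomial.C ((n.factorial : ℂ)⁻¹) * ∑ᶠ a : {a : A n // S n a}, Polynomial.X ^ χ n a

/-- Substitution `u = 1`. -/
def atOne (G : PowerSeries (Polynomial ℂ)) : PowerSeries ℂ :=
  PowerSeries.mk fun n => (PowerSeries.coeff n G).eval 1

/-- The partial derivative `∂G/∂u` at `u = 1`. -/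
def uDerivAtOne (G : PowerSeries (Polynomial ℂ)) : PowerSeries ℂ :=
  PowerSeries.mk fun n => (Polynomial.derivative (PowerSeries.coeff n G)).eval 1

/-- `F^{k,P}(u,z)`: functions with constraint `P`; nodes not in the `k`-th image marked by `u`. -/
def funGF (k : ℕ) (P : Set ℕ) : PowerSeries (Polynomial ℂ) :=
  bivariateGF (fun n => Fin n → Fin n) (fun _ f => FunConstraint P f) (fun _ f => funMissed k f)

/-- `F^{CYC,P}(u,z)`: functions with constraint `P`; nodes on cycles marked by `u`. -/
def funCycGF (P : Set ℕ) : PowerSeries (Polynomial ℂ) :=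
  bivariateGF (fun n => Fin n → Fin n) (fun _ f => FunConstraint P f) (fun _ f => funCyclic f)

/-- `P^{k,P}(u,z)`: partial functions with constraint `P`; nodes not in the `k`-th image marked
by `u`. -/
def partialGF (k : ℕ) (P : Set ℕ) : PowerSeries (Polynomial ℂ) :=
  bivariateGF (fun n => Fin n → Option (Fin n)) (fun _ f => PartialConstraint P f)
    (fun _ f => partialMissed k f)

/-- `F^P(z)`, the generating function of functions with constraint `P`. -/
def F (P : Set ℕ) : PowerSeries ℂ := atOne (funGF 0 P)

/-- `P^P(z)`, the generating function of partial functions with constraint `P`. -/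
def Par (P : Set ℕ) : PowerSeries ℂ := atOne (partialGF 0 P)

/-- `Ξ^{CYC,P}(z)`. -/
def XiCyc (P : Set ℕ) : PowerSeries ℂ := uDerivAtOne (funCycGF P)

/-- `Ξ^{k,P}(z)`. -/
def Xi (k : ℕ) (P : Set ℕ) : PowerSeries ℂ := uDerivAtOne (funGF k P)

/-- `Ξ^{partial,k,P}(z)`. -/
def XiPartial (k : ℕ) (P : Set ℕ) : PowerSeries ℂ := uDerivAtOne (partialGF k P)

/-- `T_{≤ k-1}^P(z)`, the generating function of labeled rooted trees of height at most `k - 1`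
in which every node has a number of children in `P`; it is `0` for `k = 0`. -/
def treeGF (k : ℕ) (P : Set ℕ) : PowerSeries ℝ :=
  PowerSeries.mk fun n =>
    (Nat.card {f : Fin n → Option (Fin n) //
      IsRootedTree f ∧ HeightLT f k ∧ PartialConstraint P f} : ℝ) / (n.factorial : ℝ)

/-- `τ_k^P = T_{≤ k-1}^P(ρ_P)`. -/
def tauK (k : ℕ) (P : Set ℕ) : ℝ :=
  ∑' n : ℕ, PowerSeries.coeff n (treeGF k P) * rho P ^ n

/-! ### Analytic continuation and domains -/

/-- The complex plane slit along the ray `[s, ∞)`. -/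
def slit (s : ℝ) : Set ℂ := {z | ¬ (z.im = 0 ∧ s ≤ z.re)}

/-- The open disc of radius `r` around `0`, slit along the ray `[s, ∞)`. -/
def slitDisc (s r : ℝ) : Set ℂ := Metric.ball 0 r ∩ slit s

/-- `G` extends the power series `f` from the disc `|z| < s`, where `f` converges, to a function
analytic also on a neighborhood of `s` slit along `[s, ∞)`. -/
def ExtendsPast (f : PowerSeries ℂ) (s : ℝ) (G : ℂ → ℂ) : Prop :=
  (∀ z : ℂ, ‖z‖ < s → HasSum (fun n => PowerSeries.coeff n f * z ^ n) (G z)) ∧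
  ∃ δ > 0, AnalyticOnNhd ℂ G (Metric.ball 0 s ∪ (Metric.ball (s : ℂ) δ ∩ slit s))

/-- The domain `Δ(φ, R)`. -/
def deltaDomain (φ R : ℝ) : Set ℂ :=
  {z | ‖z‖ < R ∧ z ≠ 1 ∧ φ < |Complex.arg (z - 1)|}

/-- `G` is `Δ`-analytic. -/
def DeltaAnalytic (G : ℂ → ℂ) : Prop :=
  ∃ φ R : ℝ, 1 < R ∧ 0 < φ ∧ φ < Real.pi / 2 ∧ AnalyticOnNhd ℂ G (deltaDomain φ R)

end

end PreimageConstraint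

/-! ### Entire power series: norms, evaluation, division by a linear factor. -/

namespace PreimageConstraint

noncomputable section

/-! Maps with prescribed fiber sizes are counted by products of exponential series
(`fiberCount_eq`): there are n! [tⁿ] e_P(t)ⁿ admissible functions, and n! [tⁿ] eᵗ e_P(t)ⁿ admissible
partial functions, because the set of points without image is unconstrained. If T = z e_P(T) and D =
1 - z e_P'(T), Lagrange inversion (`hasSum_lagrange`) gives ∑ zⁿ [tⁿ] q(t) e_P(t)ⁿ = q(T) / D. So
the two plain generating functions are 1 / D and e^T / D.

The other statistics reduce to the same kind of count. A cyclic node determines a cycle with a base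
point; removing the arrows of the cycle lowers the allowed fiber sizes on it by one, and summing
over its length is a geometric series in z e_P'(T), with total z e_P'(T) / D² (`card_cyclic`,
`hasSum_coeff_XiCyc`). A node is outside the k-th image exactly when its descendants form a tree of
height less than k rooted there. Detaching this tree leaves a partial map whose domain has one extra
point, the former root (`card_missed`). The generating function is therefore T_{≤k-1}(z) times the
z-derivative of e_R(T) / (e_P(T) D), with e_R = 1 for functions and e_R = exp for partial functions
(`hasSum_missedCoeff`). The factor T_{≤k-1} is entire (`summable_treeCount`).

The analysis thus concerns T alone (`exists_tree_continuation`). For |z| < ρ it is the fixed point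
of a contraction of the disc |t| ≤ τ. The inverse map t ↦ t / e_P(t) has a nondegenerate critical
point at τ with value ρ, so near ρ the function T is analytic in √(1 - z/ρ), and D ~ √(2 τ ρ
e_{P-2}(τ)) √(1 - z/ρ) (`exists_branch_rho`). The powers D⁻¹, D⁻², D⁻³ yield the exponents -1/2, -1,
-3/2. At the other points of the circle gcd(P) = 1 forces |T| < τ, hence D ≠ 0 and T continues
analytically; compactness of the closed disc then gives the larger radius. -/

open PowerSeries in
/-- The sum of the absolute values of the terms of a power series at radius `r`. -/
def seriesNorm (r : ℝ) (q : PowerSeries ℂ) : ℝ := ∑' n, ‖coeff n q‖ * r ^ n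

/-- The value of a power series at `t`. -/
def seriesEval (q : PowerSeries ℂ) (t : ℂ) : ℂ := ∑' n, PowerSeries.coeff n q * t ^ n

/-- The power series converges absolutely everywhere. -/
def EntireSeries (q : PowerSeries ℂ) : Prop :=
  ∀ r : ℝ, 0 ≤ r → Summable fun n => ‖PowerSeries.coeff n q‖ * r ^ n

namespace EntireSeries

open PowerSeries

variable {p q : PowerSeries ℂ}

lemma summable_norm (hq : EntireSeries q) (t : ℂ) : Summable fun n => ‖coeff n q * t ^ n‖ := by
  simpa using hq ‖t‖ (norm_nonneg t)

lemma hasSum (hq : EntireSeries q) (t : ℂ) :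
    HasSum (fun n => coeff n q * t ^ n) (seriesEval q t) :=
  (hq.summable_norm t).of_norm.hasSum

lemma of_norm_le {g : ℕ → ℝ} (hg : ∀ r : ℝ, 0 ≤ r → Summable fun n => g n * r ^ n)
    (h : ∀ n, ‖coeff n q‖ ≤ g n) : EntireSeries q := fun r hr =>
  (hg r hr).of_nonneg_of_le (fun _ => by positivity) fun n => by gcongr; exact h n

lemma add (hp : EntireSeries p) (hq : EntireSeries q) : EntireSeries (p + q) :=
  of_norm_le (g := fun n => ‖coeff n p‖ + ‖coeff n q‖)
    (fun r hr => by simpa only [add_mul] using (hp r hr).add (hq r hr))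
    fun n => by rw [map_add]; exact norm_add_le _ _

lemma const_mul (a : ℂ) (hq : EntireSeries q) : EntireSeries (C a * q) := fun r hr => by
  simpa [mul_assoc] using (hq r hr).mul_left ‖a‖

lemma X_mul (hq : EntireSeries q) : EntireSeries (X * q) := fun r hr => by
  rw [← summable_nat_add_iff 1]
  simpa [coeff_succ_X_mul, pow_succ, mul_assoc] using (hq r hr).mul_right r

lemma one : EntireSeries 1 := fun r _ => by
  refine summable_of_ne_finset_zero (s := {0}) fun n hn => ?_
  simp [coeff_one, Finset.mem_singleton.not.1 hn]

lemma mul (hp : EntireSeries p) (hq : EntireSeries q) : EntireSeries (p * q) := fun r hr => by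
  have hp' : Summable fun n => ‖(‖coeff n p‖ * r ^ n)‖ := (hp r hr).norm
  have hq' : Summable fun n => ‖(‖coeff n q‖ * r ^ n)‖ := (hq r hr).norm
  refine (summable_norm_sum_mul_antidiagonal_of_summable_norm hp' hq').of_nonneg_of_le
    (fun n => by positivity) fun n => ?_
  rw [coeff_mul, Real.norm_of_nonneg (Finset.sum_nonneg fun x _ => by positivity)]
  refine (mul_le_mul_of_nonneg_right (norm_sum_le _ _) (by positivity)).trans_eq ?_
  rw [Finset.sum_mul]
  refine Finset.sum_congr rfl fun x hx => ?_
  rw [← Finset.HasAntidiagonal.mem_antidiagonal.1 hx, norm_mul, pow_add]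
  ring

lemma pow (hq : EntireSeries q) (m : ℕ) : EntireSeries (q ^ m) := by
  induction m with
  | zero => simpa using one
  | succ m ih => rw [pow_succ]; exact ih.mul hq

lemma derivative (hq : EntireSeries q) : EntireSeries (d⁄dX ℂ q) := fun r hr => by
  -- Differentiation costs a factor n + 1 ≤ 2 ^ (n + 1), and r ^ n ≤ (r + 1) ^ (n + 1); convergence
  -- at radius 2 (r + 1) pays for both.
  have h := (summable_nat_add_iff 1).2 (hq (2 * (r + 1)) (by positivity))
  refine h.of_nonneg_of_le (fun n => by positivity) fun n => ?_
  rw [coeff_derivative, norm_mul, mul_assoc]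
  gcongr
  have h1 : ‖(n : ℂ) + 1‖ = n + 1 := by
    rw [← Nat.cast_succ, Complex.norm_natCast, Nat.cast_succ]
  rw [h1, mul_pow]
  have h2 : (n : ℝ) + 1 ≤ 2 ^ (n + 1) := by
    exact_mod_cast (Nat.lt_two_pow_self (n := n + 1)).le
  have h3 : r ^ n ≤ (r + 1) ^ (n + 1) :=
    (pow_le_pow_left₀ hr (by linarith) n).trans (pow_le_pow_right₀ (by linarith) n.le_succ)
  gcongr

lemma hasDerivAt (hq : EntireSeries q) (t : ℂ) :
    HasDerivAt (seriesEval q) (seriesEval (d⁄dX ℂ q) t) t := by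
  set R : ℝ := ‖t‖ + 1
  have hR : 0 < R := by positivity
  have key : HasDerivAt (seriesEval q) (∑' n : ℕ, coeff n q * ((n : ℂ) * t ^ (n - 1))) t := by
    have hsum : Summable fun n : ℕ => ‖coeff n q‖ * (n * R ^ (n - 1)) := by
      rw [← summable_nat_add_iff 1]
      refine (hq.derivative R hR.le).congr fun n => ?_
      rw [coeff_derivative, norm_mul, ← Nat.cast_succ, Complex.norm_natCast, Nat.add_sub_cancel]
      ring
    refine hasDerivAt_tsum_of_isPreconnected (t := Metric.ball (0 : ℂ) R)
      (g := fun (n : ℕ) (y : ℂ) => coeff n q * y ^ n)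
      (g' := fun (n : ℕ) (y : ℂ) => coeff n q * ((n : ℂ) * y ^ (n - 1)))
      hsum Metric.isOpen_ball (convex_ball _ _).isPreconnected ?_ ?_ (y₀ := 0) ?_ ?_ ?_
    · intro n y _
      exact (hasDerivAt_pow n y).const_mul _
    · intro n y hy
      have hy' : ‖y‖ ≤ R := (mem_ball_zero_iff.1 hy).le
      rw [norm_mul, norm_mul, norm_pow, Complex.norm_natCast]
      gcongr
    · simpa using hR
    · exact (hq.summable_norm 0).of_norm
    · simp [R]
  convert key using 1
  have hs : Summable fun n : ℕ => coeff (n + 1) q * (((n + 1 : ℕ) : ℂ) * t ^ n) := by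
    refine (hq.derivative.summable_norm t).of_norm.congr fun n => ?_
    rw [coeff_derivative]; push_cast; ring
  rw [Summable.tsum_eq_zero_add ((summable_nat_add_iff 1).1 (by simpa using hs))]
  simp only [Nat.cast_zero, zero_mul, mul_zero, zero_add, Nat.add_sub_cancel]
  refine tsum_congr fun n => ?_
  rw [coeff_derivative]; push_cast; ring

lemma differentiable (hq : EntireSeries q) : Differentiable ℂ (seriesEval q) := fun t =>
  (hq.hasDerivAt t).differentiableAt

lemma analyticAt (hq : EntireSeries q) (t : ℂ) : AnalyticAt ℂ (seriesEval q) t :=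
  hq.differentiable.analyticAt t

lemma eval_mul (hp : EntireSeries p) (hq : EntireSeries q) (t : ℂ) :
    seriesEval (p * q) t = seriesEval p t * seriesEval q t := by
  unfold seriesEval
  rw [tsum_mul_tsum_eq_tsum_sum_antidiagonal_of_summable_norm (hp.summable_norm t)
    (hq.summable_norm t)]
  refine tsum_congr fun n => ?_
  rw [coeff_mul, Finset.sum_mul]
  refine Finset.sum_congr rfl fun x hx => ?_
  rw [← Finset.HasAntidiagonal.mem_antidiagonal.1 hx, pow_add]
  ring

lemma norm_eval_le (hq : EntireSeries q) {t : ℂ} {r : ℝ} (ht : ‖t‖ ≤ r) :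
    ‖seriesEval q t‖ ≤ seriesNorm r q := by
  have hr : 0 ≤ r := (norm_nonneg t).trans ht
  refine (norm_tsum_le_tsum_norm (hq.summable_norm t)).trans ?_
  refine (hq.summable_norm t).tsum_le_tsum (fun n => ?_) (hq r hr)
  rw [norm_mul, norm_pow]
  gcongr

lemma seriesNorm_mul_le (hp : EntireSeries p) (hq : EntireSeries q) {r : ℝ} (hr : 0 ≤ r) :
    seriesNorm r (p * q) ≤ seriesNorm r p * seriesNorm r q := by
  have hp' : Summable fun n => ‖(‖coeff n p‖ * r ^ n)‖ := (hp r hr).norm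
  have hq' : Summable fun n => ‖(‖coeff n q‖ * r ^ n)‖ := (hq r hr).norm
  unfold seriesNorm
  rw [tsum_mul_tsum_eq_tsum_sum_antidiagonal_of_summable_norm hp' hq']
  refine (hp.mul hq r hr).tsum_le_tsum (fun n => ?_)
    (summable_norm_sum_mul_antidiagonal_of_summable_norm hp' hq').of_norm
  rw [coeff_mul]
  refine (mul_le_mul_of_nonneg_right (norm_sum_le _ _) (by positivity)).trans_eq ?_
  rw [Finset.sum_mul]
  refine Finset.sum_congr rfl fun x hx => ?_
  rw [← Finset.HasAntidiagonal.mem_antidiagonal.1 hx, norm_mul, pow_add]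
  ring

end EntireSeries

open PowerSeries

lemma seriesNorm_nonneg {r : ℝ} (hr : 0 ≤ r) (q : PowerSeries ℂ) : 0 ≤ seriesNorm r q :=
  tsum_nonneg fun _ => by positivity

lemma EntireSeries.norm_coeff_mul_pow_le {q : PowerSeries ℂ} (hq : EntireSeries q) {r : ℝ}
    (hr : 0 ≤ r) (n : ℕ) : ‖coeff n q‖ * r ^ n ≤ seriesNorm r q :=
  (hq r hr).le_tsum n fun _ _ => by positivity

lemma seriesNorm_one (r : ℝ) : seriesNorm r 1 = 1 := by
  unfold seriesNorm
  rw [tsum_eq_single 0 fun n hn => by simp [coeff_one, hn]]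
  simp

lemma seriesEval_one (t : ℂ) : seriesEval 1 t = 1 := by
  unfold seriesEval
  rw [tsum_eq_single 0 fun n hn => by simp [coeff_one, hn]]
  simp

lemma EntireSeries.seriesNorm_pow_le {q : PowerSeries ℂ} (hq : EntireSeries q) {r : ℝ}
    (hr : 0 ≤ r) (m : ℕ) : seriesNorm r (q ^ m) ≤ seriesNorm r q ^ m := by
  induction m with
  | zero => simp [seriesNorm_one]
  | succ m ih =>
    rw [pow_succ, pow_succ]
    refine ((hq.pow m).seriesNorm_mul_le hq hr).trans ?_
    gcongr
    exact seriesNorm_nonneg hr q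

lemma EntireSeries.eval_pow {q : PowerSeries ℂ} (hq : EntireSeries q) (m : ℕ) (t : ℂ) :
    seriesEval (q ^ m) t = seriesEval q t ^ m := by
  induction m with
  | zero => simp [seriesEval_one]
  | succ m ih => rw [pow_succ, pow_succ, (hq.pow m).eval_mul hq, ih]

/-- Division of an entire series by the linear factor `X - t`. -/
theorem EntireSeries.exists_eq_eval_add_mul {q : PowerSeries ℂ} (hq : EntireSeries q) (t : ℂ) :
    ∃ p, EntireSeries p ∧ q = C (seriesEval q t) + (X * p - C t * p) ∧
      ∀ r, ‖t‖ ≤ r → seriesNorm r p ≤ seriesNorm r (d⁄dX ℂ q) := by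
  -- The quotient (q(X) - q(t)) / (X - t), read off from Xⁿ⁺¹ - tⁿ⁺¹ = (X - t) ∑_{i+j=n} Xⁱ tʲ.
  set p : PowerSeries ℂ := mk fun i => ∑' j, coeff (i + 1 + j) q * t ^ j with hp
  -- The n + 1 pairs with i + j = n carry equal terms, so this double series sums to the norm of q'.
  -- It dominates `p` as soon as ‖t‖ ≤ r.
  have hdouble : ∀ r : ℝ, 0 ≤ r →
      HasSum (fun x : ℕ × ℕ => ‖coeff (x.1 + x.2 + 1) q‖ * r ^ (x.1 + x.2))
        (seriesNorm r (d⁄dX ℂ q)) := by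
    intro r hr
    rw [← Finset.HasAntidiagonal.sigmaAntidiagonalEquivProd.hasSum_iff]
    have hs := (hq.derivative r hr).hasSum
    have hterm : ∀ n, HasSum (fun c : Finset.HasAntidiagonal.antidiagonal n =>
        ‖coeff (c.1.1 + c.1.2 + 1) q‖ * r ^ (c.1.1 + c.1.2)) (‖coeff n (d⁄dX ℂ q)‖ * r ^ n) := by
      intro n
      have := hasSum_fintype fun c : Finset.HasAntidiagonal.antidiagonal n =>
        ‖coeff (c.1.1 + c.1.2 + 1) q‖ * r ^ (c.1.1 + c.1.2)
      convert this using 1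
      rw [Finset.sum_coe_sort (Finset.HasAntidiagonal.antidiagonal n)
        (fun c => ‖coeff (c.1 + c.2 + 1) q‖ * r ^ (c.1 + c.2)),
        Finset.sum_congr rfl (g := fun _ => ‖coeff (n + 1) q‖ * r ^ n)
          (fun c hc => by rw [Finset.HasAntidiagonal.mem_antidiagonal.1 hc])]
      rw [Finset.sum_const, Finset.Nat.card_antidiagonal, coeff_derivative, norm_mul,
        ← Nat.cast_succ, Complex.norm_natCast, nsmul_eq_mul]
      ring
    refine hs.sigma_of_hasSum (fun n => hterm n) ?_
    exact (summable_sigma_of_nonneg fun _ => mul_nonneg (norm_nonneg _) (pow_nonneg hr _)).2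
      ⟨fun n => (hterm n).summable, hs.summable.congr fun n => (hterm n).tsum_eq.symm⟩
  have hinner : ∀ r : ℝ, ‖t‖ ≤ r → ∀ i, Summable (fun j => ‖coeff (i + 1 + j) q * t ^ j‖) ∧
      ‖coeff i p‖ * r ^ i ≤ ∑' j, ‖coeff (i + j + 1) q‖ * r ^ (i + j) := by
    intro r hr i
    have hr0 : 0 ≤ r := (norm_nonneg t).trans hr
    have h1 := (hdouble r hr0).summable.prod_factor i
    have h2 : ∀ j, ‖coeff (i + 1 + j) q * t ^ j‖ * r ^ i ≤
        ‖coeff (i + j + 1) q‖ * r ^ (i + j) := fun j => by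
      rw [norm_mul, norm_pow, add_right_comm, pow_add, mul_assoc, mul_comm (r ^ i)]
      gcongr
    have h4 : Summable (fun j => ‖coeff (i + 1 + j) q * t ^ j‖) := by
      have := (summable_nat_add_iff (i + 1)).2 (hq (r + 1) (by positivity))
      refine this.of_nonneg_of_le (fun _ => norm_nonneg _) fun j => ?_
      rw [norm_mul, norm_pow, add_comm j]
      gcongr
      calc ‖t‖ ^ j ≤ (r + 1) ^ j := by gcongr; linarith
        _ ≤ (r + 1) ^ (i + 1 + j) := pow_le_pow_right₀ (by linarith) (by omega)
    refine ⟨h4, ?_⟩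
    rw [hp, coeff_mk]
    refine (mul_le_mul_of_nonneg_right (norm_tsum_le_tsum_norm h4) (by positivity)).trans ?_
    rw [← tsum_mul_right]
    exact (h4.mul_right _).tsum_le_tsum h2 h1
  have hpsum : ∀ r : ℝ, ‖t‖ ≤ r → Summable (fun i => ‖coeff i p‖ * r ^ i) ∧
      seriesNorm r p ≤ seriesNorm r (d⁄dX ℂ q) := by
    intro r hr
    have hr0 : 0 ≤ r := (norm_nonneg t).trans hr
    have hd := hdouble r hr0
    have h1 := hd.summable.prod
    have h3 : Summable (fun i => ‖coeff i p‖ * r ^ i) :=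
      h1.of_nonneg_of_le (fun _ => by positivity) fun i => (hinner r hr i).2
    refine ⟨h3, ?_⟩
    rw [← hd.tsum_eq, hd.summable.tsum_prod]
    exact h3.tsum_le_tsum (fun i => (hinner r hr i).2) h1
  refine ⟨p, fun r hr => ?_, ?_, fun r hr => (hpsum r hr).2⟩
  · have h := (hpsum (r + ‖t‖) (by linarith)).1
    refine h.of_nonneg_of_le (fun _ => by positivity) fun n => ?_
    gcongr
    linarith [norm_nonneg t]
  -- Horner's recursion: the tail at i = 0 is q(t), the tail at i = n + 1 is coefficient n of `p`.
  · have hsplit : ∀ i, ∑' j, coeff (i + j) q * t ^ j = coeff i q + t * coeff i p := by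
      intro i
      have hs : Summable fun j => coeff (i + j) q * t ^ j := by
        rw [← summable_nat_add_iff 1]
        refine ((hinner _ le_rfl i).1.of_norm.mul_left t).congr fun j => ?_
        rw [pow_succ, add_comm j, ← add_assoc]; ring
      rw [hs.tsum_eq_zero_add, hp, coeff_mk, ← tsum_mul_left]
      simp only [add_zero, pow_zero, mul_one]
      congr 1
      refine tsum_congr fun j => ?_
      rw [pow_succ, add_comm j, ← add_assoc]; ring
    ext n
    cases n with
    | zero =>
      have h0 := hsplit 0
      simp only [zero_add] at h0
      simp [seriesEval, h0]
    | succ n =>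
      have h1 := hsplit (n + 1)
      simp only [map_add, map_sub, coeff_succ_X_mul, coeff_C_mul, coeff_succ_C]
      rw [hp, coeff_mk, h1, hp]
      ring

end

end PreimageConstraint

/-! ### Lagrange inversion. -/

namespace PreimageConstraint

noncomputable section

open PowerSeries

/-- The generating function `∑ₙ zⁿ [tⁿ] q(t) φ(t)ⁿ`. -/
def lagrangeSum (φ q : PowerSeries ℂ) (z : ℂ) : ℂ := ∑' n, coeff n (q * φ ^ n) * z ^ n

section Lagrange

variable {φ q : PowerSeries ℂ} {τ : ℝ} {z T : ℂ}

/-- A Cauchy estimate in the submultiplicative norm at radius τ. It makes the Lagrange sum geometric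
with ratio ‖z‖ ‖φ‖ / τ. -/
lemma norm_coeff_mul_pow_le (hφ : EntireSeries φ) (hq : EntireSeries q) (hτ : 0 < τ) (n m : ℕ) :
    ‖coeff n (q * φ ^ m)‖ ≤ seriesNorm τ q * seriesNorm τ φ ^ m / τ ^ n := by
  rw [le_div_iff₀ (by positivity)]
  refine ((hq.mul (hφ.pow m)).norm_coeff_mul_pow_le hτ.le n).trans ?_
  refine (hq.seriesNorm_mul_le (hφ.pow m) hτ.le).trans ?_
  gcongr
  · exact seriesNorm_nonneg hτ.le q
  · exact hφ.seriesNorm_pow_le hτ.le m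

lemma norm_lagrangeSum_term_le (hφ : EntireSeries φ) (hq : EntireSeries q) (hτ : 0 < τ) (n : ℕ) :
    ‖coeff n (q * φ ^ n) * z ^ n‖ ≤ seriesNorm τ q * (‖z‖ * seriesNorm τ φ / τ) ^ n := by
  rw [norm_mul, norm_pow]
  refine (mul_le_mul_of_nonneg_right (norm_coeff_mul_pow_le hφ hq hτ n n)
    (by positivity)).trans_eq ?_
  rw [div_pow, mul_pow]
  ring

lemma lagrangeSum_ratio (hτ : 0 < τ) (hz : ‖z‖ * seriesNorm τ φ < τ) :
    0 ≤ ‖z‖ * seriesNorm τ φ / τ ∧ ‖z‖ * seriesNorm τ φ / τ < 1 :=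
  ⟨div_nonneg (mul_nonneg (norm_nonneg z) (seriesNorm_nonneg hτ.le φ)) hτ.le,
    (div_lt_one hτ).2 hz⟩

lemma summable_norm_lagrangeSum (hφ : EntireSeries φ) (hq : EntireSeries q) (hτ : 0 < τ)
    (hz : ‖z‖ * seriesNorm τ φ < τ) : Summable fun n => ‖coeff n (q * φ ^ n) * z ^ n‖ := by
  obtain ⟨h0, h1⟩ := lagrangeSum_ratio hτ hz
  exact ((summable_geometric_of_lt_one h0 h1).mul_left _).of_nonneg_of_le
    (fun _ => norm_nonneg _) (norm_lagrangeSum_term_le hφ hq hτ)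

lemma norm_lagrangeSum_le (hφ : EntireSeries φ) (hq : EntireSeries q) (hτ : 0 < τ)
    (hz : ‖z‖ * seriesNorm τ φ < τ) :
    ‖lagrangeSum φ q z‖ ≤ seriesNorm τ q * (1 - ‖z‖ * seriesNorm τ φ / τ)⁻¹ := by
  obtain ⟨h0, h1⟩ := lagrangeSum_ratio hτ hz
  refine tsum_of_norm_bounded ((hasSum_geometric_of_lt_one h0 h1).mul_left _)
    (norm_lagrangeSum_term_le hφ hq hτ)

lemma lagrangeSum_add {p : PowerSeries ℂ} (hφ : EntireSeries φ) (hp : EntireSeries p)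
    (hq : EntireSeries q) (hτ : 0 < τ) (hz : ‖z‖ * seriesNorm τ φ < τ) :
    lagrangeSum φ (p + q) z = lagrangeSum φ p z + lagrangeSum φ q z := by
  unfold lagrangeSum
  rw [← (summable_norm_lagrangeSum hφ hp hτ hz).of_norm.tsum_add
    (summable_norm_lagrangeSum hφ hq hτ hz).of_norm]
  refine tsum_congr fun n => ?_
  rw [add_mul, map_add, add_mul]

lemma lagrangeSum_C_mul (a : ℂ) : lagrangeSum φ (C a * q) z = a * lagrangeSum φ q z := by
  unfold lagrangeSum
  rw [← tsum_mul_left]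
  refine tsum_congr fun n => ?_
  rw [mul_assoc, coeff_C_mul, mul_assoc]

/-- Term 0 vanishes, and shifting the index trades X for z φ: the functional satisfies its own form
of T = z φ(T). -/
lemma lagrangeSum_X_mul (hφ : EntireSeries φ) (hq : EntireSeries q) (hτ : 0 < τ)
    (hz : ‖z‖ * seriesNorm τ φ < τ) :
    lagrangeSum φ (X * q) z = z * lagrangeSum φ (φ * q) z := by
  unfold lagrangeSum
  rw [(summable_norm_lagrangeSum hφ hq.X_mul hτ hz).of_norm.tsum_eq_zero_add, ← tsum_mul_left]
  simp only [mul_assoc, coeff_zero_X_mul, zero_mul, zero_add, coeff_succ_X_mul]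
  refine tsum_congr fun n => ?_
  rw [pow_succ φ, pow_succ z]
  rw [show q * (φ ^ n * φ) = φ * (q * φ ^ n) by ring]
  ring

/-- If `T = z φ(T)`, the functional `q ↦ ∑ₙ zⁿ [tⁿ] q φⁿ` does not distinguish `t` and `T`. -/
lemma lagrangeSum_X_mul_eq (hφ : EntireSeries φ) (hτ : 0 < τ)
    (hz : ‖z‖ * seriesNorm τ φ < τ) (hz' : ‖z‖ * seriesNorm τ (d⁄dX ℂ φ) < 1) (hT : ‖T‖ ≤ τ)
    (hfix : T = z * seriesEval φ T) (hq : EntireSeries q) :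
    lagrangeSum φ (X * q) z = T * lagrangeSum φ q z := by
  -- Since φ = φ(T) + (X - T) ψ and T = z φ(T), the defect E satisfies E(q) = z E(ψ q). Iteration
  -- gives ‖E(q)‖ ≤ K ‖q‖ cⁿ with c = ‖z‖ ‖ψ‖ ≤ ‖z‖ ‖φ'‖ < 1, so E(q) = 0.
  obtain ⟨ψ, hψ, hφψ, hψN⟩ := hφ.exists_eq_eval_add_mul T
  set E : PowerSeries ℂ → ℂ := fun q => lagrangeSum φ (X * q) z - T * lagrangeSum φ q z with hE
  have hrec : ∀ q, EntireSeries q → E q = z * E (ψ * q) := by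
    intro q hq
    have h1 : φ * q = C (seriesEval φ T) * q + (X * (ψ * q) + C (-T) * (ψ * q)) := by
      conv_lhs => rw [hφψ]
      rw [map_neg]; ring
    have h2 : lagrangeSum φ (φ * q) z = seriesEval φ T * lagrangeSum φ q z + E (ψ * q) := by
      rw [h1, lagrangeSum_add hφ (hq.const_mul _)
        ((hψ.mul hq).X_mul.add ((hψ.mul hq).const_mul _)) hτ hz,
        lagrangeSum_add hφ (hψ.mul hq).X_mul ((hψ.mul hq).const_mul _) hτ hz,
        lagrangeSum_C_mul, lagrangeSum_C_mul, hE]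
      ring
    have h3 : E q = z * lagrangeSum φ (φ * q) z - T * lagrangeSum φ q z := by
      rw [hE]; simp only [lagrangeSum_X_mul hφ hq hτ hz]
    rw [h3, h2]
    nth_rw 2 [hfix]
    ring
  set S := (1 - ‖z‖ * seriesNorm τ φ / τ)⁻¹ with hS
  have hS0 : 0 ≤ S := inv_nonneg.2 (sub_nonneg.2 (lagrangeSum_ratio hτ hz).2.le)
  have hbound : ∀ q, EntireSeries q →
      ‖E q‖ ≤ (‖z‖ * seriesNorm τ φ * S + τ * S) * seriesNorm τ q := by
    intro q hq
    have h1 := norm_lagrangeSum_le hφ hq hτ hz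
    have h2 := norm_lagrangeSum_le hφ (hφ.mul hq) hτ hz
    have h3 := hφ.seriesNorm_mul_le hq hτ.le
    rw [hE]
    simp only [lagrangeSum_X_mul hφ hq hτ hz]
    refine (norm_sub_le _ _).trans ?_
    rw [norm_mul, norm_mul]
    calc ‖z‖ * ‖lagrangeSum φ (φ * q) z‖ + ‖T‖ * ‖lagrangeSum φ q z‖
        ≤ ‖z‖ * (seriesNorm τ φ * seriesNorm τ q * S) + τ * (seriesNorm τ q * S) := by
          gcongr
          exact h2.trans (by gcongr)
      _ = _ := by ring
  set K := ‖z‖ * seriesNorm τ φ * S + τ * S with hK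
  have hK0 : 0 ≤ K := by
    have := seriesNorm_nonneg hτ.le φ
    positivity
  have hψ0 := seriesNorm_nonneg hτ.le ψ
  set c := ‖z‖ * seriesNorm τ ψ with hc
  have hc0 : 0 ≤ c := by positivity
  have hc1 : c < 1 := lt_of_le_of_lt (mul_le_mul_of_nonneg_left (hψN τ hT) (norm_nonneg z)) hz'
  have hiter : ∀ n : ℕ, ∀ q, EntireSeries q → ‖E q‖ ≤ K * seriesNorm τ q * c ^ n := by
    intro n
    induction n with
    | zero => intro q hq; simpa using hbound q hq
    | succ n ih =>
      intro q hq
      rw [hrec q hq, norm_mul]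
      calc ‖z‖ * ‖E (ψ * q)‖ ≤ ‖z‖ * (K * seriesNorm τ (ψ * q) * c ^ n) := by
            gcongr; exact ih _ (hψ.mul hq)
        _ ≤ ‖z‖ * (K * (seriesNorm τ ψ * seriesNorm τ q) * c ^ n) := by
            gcongr; exact hψ.seriesNorm_mul_le hq hτ.le
        _ = _ := by rw [hc]; ring
  have hlim : Tendsto (fun n : ℕ => K * seriesNorm τ q * c ^ n) atTop (𝓝 0) := by
    simpa using (tendsto_pow_atTop_nhds_zero_of_lt_one hc0 hc1).const_mul (K * seriesNorm τ q)
  have := ge_of_tendsto' hlim fun n => hiter n q hq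
  exact sub_eq_zero.1 (norm_le_zero_iff.1 this)

/-- The series q - q(T) is a multiple of X - T, and the functional kills such multiples. -/
lemma lagrangeSum_eq_eval_mul (hφ : EntireSeries φ) (hτ : 0 < τ)
    (hz : ‖z‖ * seriesNorm τ φ < τ) (hz' : ‖z‖ * seriesNorm τ (d⁄dX ℂ φ) < 1) (hT : ‖T‖ ≤ τ)
    (hfix : T = z * seriesEval φ T) (hq : EntireSeries q) :
    lagrangeSum φ q z = seriesEval q T * lagrangeSum φ 1 z := by
  obtain ⟨p, hp, hqp, -⟩ := hq.exists_eq_eval_add_mul T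
  have h1 : q = C (seriesEval q T) * 1 + (X * p + C (-T) * p) := by
    conv_lhs => rw [hqp]
    rw [map_neg]; ring
  conv_lhs => rw [h1]
  rw [lagrangeSum_add hφ (EntireSeries.one.const_mul _) (hp.X_mul.add (hp.const_mul _)) hτ hz,
    lagrangeSum_add hφ hp.X_mul (hp.const_mul _) hτ hz, lagrangeSum_C_mul, lagrangeSum_C_mul,
    lagrangeSum_X_mul_eq hφ hτ hz hz' hT hfix hp]
  ring

/-- Comparing coefficients in (φⁿ⁺¹)' = (n + 1) φ' φⁿ gives [tⁿ⁺¹] φⁿ⁺¹ = [tⁿ] φ' φⁿ. Together with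
`lagrangeSum_eq_eval_mul` this is a linear equation for the value at 1. -/
lemma lagrangeSum_one_eq (hφ : EntireSeries φ) (hτ : 0 < τ) (hz : ‖z‖ * seriesNorm τ φ < τ) :
    lagrangeSum φ 1 z = 1 + z * lagrangeSum φ (d⁄dX ℂ φ) z := by
  have hterm : ∀ n, coeff (n + 1) (1 * φ ^ (n + 1)) = coeff n (d⁄dX ℂ φ * φ ^ n) := by
    intro n
    have h : coeff n (d⁄dX ℂ (φ ^ (n + 1))) = coeff n (d⁄dX ℂ φ * φ ^ n) * ((n : ℂ) + 1) := by
      rw [derivative_pow, Nat.add_sub_cancel, mul_assoc, ← map_natCast (C (R := ℂ)), coeff_C_mul,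
        mul_comm (φ ^ n)]
      push_cast; ring
    rw [coeff_derivative] at h
    rw [one_mul]
    exact mul_right_cancel₀ (Nat.cast_add_one_ne_zero n) h
  unfold lagrangeSum
  rw [(summable_norm_lagrangeSum hφ EntireSeries.one hτ hz).of_norm.tsum_eq_zero_add,
    ← tsum_mul_left]
  simp only [hterm, pow_zero, mul_one, coeff_zero_one]
  congr 1
  refine tsum_congr fun n => ?_
  rw [pow_succ]; ring

lemma lagrangeSum_one_mul (hφ : EntireSeries φ) (hτ : 0 < τ)
    (hz : ‖z‖ * seriesNorm τ φ < τ) (hz' : ‖z‖ * seriesNorm τ (d⁄dX ℂ φ) < 1) (hT : ‖T‖ ≤ τ)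
    (hfix : T = z * seriesEval φ T) :
    lagrangeSum φ 1 z * (1 - z * seriesEval (d⁄dX ℂ φ) T) = 1 := by
  have h := lagrangeSum_one_eq hφ hτ hz
  rw [lagrangeSum_eq_eval_mul hφ hτ hz hz' hT hfix hφ.derivative] at h
  linear_combination h

/-- **Lagrange inversion**: `∑ₙ zⁿ [tⁿ] q(t) φ(t)ⁿ = q(T) / (1 - z φ'(T))` for `T = z φ(T)`. -/
theorem hasSum_lagrange (hφ : EntireSeries φ) (hτ : 0 < τ)
    (hz : ‖z‖ * seriesNorm τ φ < τ) (hz' : ‖z‖ * seriesNorm τ (d⁄dX ℂ φ) < 1) (hT : ‖T‖ ≤ τ)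
    (hfix : T = z * seriesEval φ T) (hq : EntireSeries q) :
    HasSum (fun n => coeff n (q * φ ^ n) * z ^ n)
      (seriesEval q T / (1 - z * seriesEval (d⁄dX ℂ φ) T)) := by
  have h := (summable_norm_lagrangeSum hφ hq hτ hz).of_norm.hasSum
  have h1 := lagrangeSum_one_mul hφ hτ hz hz' hT hfix
  convert! h using 1
  rw [div_eq_iff (right_ne_zero_of_mul_eq_one h1), ← lagrangeSum,
    lagrangeSum_eq_eval_mul hφ hτ hz hz' hT hfix hq, mul_assoc, h1, mul_one]

lemma EntireSeries.exists_eq_C_add_X_mul (hq : EntireSeries q) :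
    ∃ p, EntireSeries p ∧ q = C (coeff 0 q) + X * p ∧
      ∀ t, seriesEval q t = coeff 0 q + t * seriesEval p t := by
  obtain ⟨p, hp, h, -⟩ := hq.exists_eq_eval_add_mul 0
  have h0 : seriesEval q 0 = coeff 0 q := by
    unfold seriesEval
    rw [tsum_eq_single 0 fun n hn => by simp [hn]]
    simp
  rw [h0, map_zero, zero_mul, sub_zero] at h
  refine ⟨p, hp, h, fun t => ?_⟩
  have h1 : ∀ n, coeff (n + 1) q = coeff n p := fun n => by
    conv_lhs => rw [h]
    rw [map_add, coeff_succ_C, zero_add, coeff_succ_X_mul]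
  have h2 := (hq.hasSum t).summable.tsum_eq_zero_add
  rw [← seriesEval] at h2
  simp only [h1, pow_zero, mul_one] at h2
  rw [h2, seriesEval, ← tsum_mul_left]
  congr 1
  refine tsum_congr fun n => ?_
  rw [pow_succ]; ring

/-- The variant of Lagrange inversion for the coefficients `[tⁿ⁺¹] q(t) φ(t)ⁿ`. -/
theorem hasSum_lagrange_succ (hφ : EntireSeries φ) (hτ : 0 < τ)
    (hz : ‖z‖ * seriesNorm τ φ < τ) (hz' : ‖z‖ * seriesNorm τ (d⁄dX ℂ φ) < 1) (hT : ‖T‖ ≤ τ)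
    (hfix : T = z * seriesEval φ T) (hφ0 : coeff 0 φ = 1) (hq : EntireSeries q) :
    HasSum (fun n => coeff (n + 1) (q * φ ^ n) * z ^ (n + 1))
      (seriesEval q T / (seriesEval φ T * (1 - z * seriesEval (d⁄dX ℂ φ) T)) - coeff 0 q) := by
  -- Formally this is Lagrange inversion for q / φ, which need not be entire. With φ = 1 + X φ₁ and
  -- q = q(0) + X q₁, the part X q₁ falls under `hasSum_lagrange`, and so does the constant part
  -- through φⁿ = φⁿ⁺¹ - X φ₁ φⁿ.
  obtain ⟨φ₁, hφ₁, hφe, hφev⟩ := hφ.exists_eq_C_add_X_mul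
  obtain ⟨q₁, hq₁, hqe, hqev⟩ := hq.exists_eq_C_add_X_mul
  rw [hφ0] at hφe hφev
  have hD := right_ne_zero_of_mul_eq_one (lagrangeSum_one_mul hφ hτ hz hz' hT hfix)
  set D := 1 - z * seriesEval (d⁄dX ℂ φ) T with hDdef
  have hprod : seriesEval φ T * (1 - z * seriesEval φ₁ T) = 1 := by
    have h := hφev T
    linear_combination h + seriesEval φ₁ T * hfix
  have hφT := left_ne_zero_of_mul_eq_one hprod
  have hX : ∀ p, EntireSeries p →
      HasSum (fun n => coeff (n + 1) (X * p * φ ^ n) * z ^ (n + 1)) (z * (seriesEval p T / D)) := by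
    intro p hp
    refine ((hasSum_lagrange hφ hτ hz hz' hT hfix hp).mul_left z).congr_fun fun n => ?_
    rw [mul_assoc X, coeff_succ_X_mul, pow_succ]; ring
  have hone : HasSum (fun n => coeff (n + 1) (φ ^ n) * z ^ (n + 1))
      (1 / (seriesEval φ T * D) - 1) := by
    have h1 := (hasSum_nat_add_iff' 1).2
      (hasSum_lagrange hφ hτ hz hz' hT hfix EntireSeries.one)
    have h2 := h1.sub (hX φ₁ hφ₁)
    convert! h2 using 1
    · funext n
      rw [one_mul, pow_succ φ, ← sub_mul, ← map_sub]
      congr 2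
      conv_rhs => rw [show φ ^ n * φ = (C 1 + X * φ₁) * φ ^ n by rw [← hφe]; ring]
      rw [map_one]; ring
    · simp only [Finset.sum_range_one, pow_zero, mul_one, coeff_zero_one, seriesEval_one,
        ← hDdef]
      field_simp
      linear_combination -hprod
  have := (hone.mul_left (coeff 0 q)).add (hX q₁ hq₁)
  convert! this using 1
  · funext n
    conv_lhs => rw [hqe]
    rw [add_mul, map_add, coeff_C_mul]
    ring
  · rw [hqev T]
    field_simp
    linear_combination seriesEval q₁ T * hfix

end Lagrange

end

end PreimageConstraint

/-! ### The functions e_P and the tree function on the disc |z| < ρ. -/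

namespace PreimageConstraint

noncomputable section

open PowerSeries

/-- The exponential generating series `∑_{n ∈ P} tⁿ / n!`. -/
def expSeries (P : Set ℕ) : PowerSeries ℂ := mk (P.indicator fun n => ((n.factorial : ℂ))⁻¹)

/-- The entire function `∑_{n ∈ P} tⁿ / n!`. -/
def cexpP (P : Set ℕ) : ℂ → ℂ := seriesEval (expSeries P)

lemma norm_coeff_expSeries (P : Set ℕ) (n : ℕ) (r : ℝ) :
    ‖coeff n (expSeries P)‖ * r ^ n = P.indicator (fun n => r ^ n / (n.factorial : ℝ)) n := by
  by_cases hn : n ∈ P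
  · simp [expSeries, hn, div_eq_inv_mul]
  · simp [expSeries, hn]

lemma entireSeries_expSeries (P : Set ℕ) : EntireSeries (expSeries P) := fun r _ => by
  simpa only [norm_coeff_expSeries] using summable_truncExp P r

lemma seriesNorm_expSeries (P : Set ℕ) (r : ℝ) : seriesNorm r (expSeries P) = truncExp P r :=
  tsum_congr fun n => norm_coeff_expSeries P n r

lemma cexpP_ofReal (P : Set ℕ) (r : ℝ) : cexpP P r = truncExp P r := by
  unfold cexpP seriesEval truncExp
  rw [Complex.ofReal_tsum]
  refine tsum_congr fun n => ?_
  by_cases hn : n ∈ P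
  · simp [expSeries, hn, div_eq_inv_mul]
  · simp [expSeries, hn]

lemma norm_cexpP_le (P : Set ℕ) {t : ℂ} {r : ℝ} (ht : ‖t‖ ≤ r) : ‖cexpP P t‖ ≤ truncExp P r :=
  ((entireSeries_expSeries P).norm_eval_le ht).trans_eq (seriesNorm_expSeries P r)

lemma derivative_expSeries (P : Set ℕ) : d⁄dX ℂ (expSeries P) = expSeries (shift P 1) := by
  ext n
  rw [coeff_derivative]
  by_cases hn : n + 1 ∈ P
  · have h1 : n ∈ shift P 1 := hn
    have h2 : (n : ℂ) + 1 ≠ 0 := Nat.cast_add_one_ne_zero n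
    simp only [expSeries, coeff_mk, Set.indicator_of_mem hn, Set.indicator_of_mem h1,
      Nat.factorial_succ]
    push_cast
    field_simp
  · have h1 : n ∉ shift P 1 := hn
    simp [expSeries, hn, h1]

lemma hasDerivAt_cexpP (P : Set ℕ) (t : ℂ) : HasDerivAt (cexpP P) (cexpP (shift P 1) t) t := by
  have h := (entireSeries_expSeries P).hasDerivAt t
  rwa [derivative_expSeries] at h

lemma analyticAt_cexpP (P : Set ℕ) (t : ℂ) : AnalyticAt ℂ (cexpP P) t :=
  (entireSeries_expSeries P).analyticAt t

lemma coeff_zero_expSeries {P : Set ℕ} (h0 : 0 ∈ P) : coeff 0 (expSeries P) = 1 := by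
  simp [expSeries, h0]

lemma cexpP_zero {P : Set ℕ} (h0 : 0 ∈ P) : cexpP P 0 = 1 := by
  have h := cexpP_ofReal P 0
  rwa [truncExp_zero h0, Complex.ofReal_zero, Complex.ofReal_one] at h

lemma expSeries_singleton_zero : expSeries {0} = 1 := by
  ext n
  rcases eq_or_ne n 0 with rfl | hn
  · simp [expSeries]
  · simp [expSeries, hn, coeff_one]

lemma cexpP_univ (t : ℂ) : cexpP univ t = Complex.exp t := by
  rw [Complex.exp_eq_exp_ℂ, NormedSpace.exp_eq_tsum_div]
  refine tsum_congr fun n => ?_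
  simp [expSeries, div_eq_inv_mul]

lemma truncExp_lt {Q : Set ℕ} {m : ℕ} (hm : m + 1 ∈ Q) {s t : ℝ} (hs : 0 ≤ s) (hst : s < t) :
    truncExp Q s < truncExp Q t := by
  refine (summable_truncExp Q s).tsum_lt_tsum (i := m + 1) (fun n => ?_) ?_
    (summable_truncExp Q t)
  · exact Set.indicator_le_indicator (by gcongr)
  · rw [Set.indicator_of_mem hm, Set.indicator_of_mem hm]
    gcongr

section Constants

variable {P : Set ℕ} (h0 : 0 ∈ P) (h2 : (shift P 2).Nonempty)
include h0 h2

lemma tau_pos : 0 < tau P := (isTau_tau h0 h2).1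

lemma truncExp_tau : truncExp P (tau P) = tau P * truncExp (shift P 1) (tau P) := by
  have h := (isTau_tau h0 h2).2
  rw [(hasDerivAt_truncExp P (tau P)).deriv] at h
  linarith

lemma truncExp_tau_pos : 0 < truncExp P (tau P) := truncExp_pos ⟨0, h0⟩ (tau_pos h0 h2)

lemma rho_pos : 0 < rho P := div_pos (tau_pos h0 h2) (truncExp_tau_pos h0 h2)

lemma rho_mul_truncExp : rho P * truncExp P (tau P) = tau P :=
  div_mul_cancel₀ _ (truncExp_tau_pos h0 h2).ne'

lemma rho_mul_truncExp_shift : rho P * truncExp (shift P 1) (tau P) = 1 := by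
  have h := rho_mul_truncExp h0 h2
  rw [truncExp_tau h0 h2] at h
  refine mul_left_cancel₀ (tau_pos h0 h2).ne' ?_
  linarith

lemma truncExp_shift_pos : 0 < truncExp (shift P 1) (tau P) :=
  pos_of_mul_pos_right (by rw [rho_mul_truncExp_shift h0 h2]; exact one_pos) (rho_pos h0 h2).le

lemma truncExp_shift_two_pos : 0 < truncExp (shift P 2) (tau P) :=
  truncExp_pos h2 (tau_pos h0 h2)

end Constants

/-- `T` is a solution of `T = z e_P(T)`. -/
def IsTreeValue (P : Set ℕ) (z T : ℂ) : Prop := T = z * cexpP P T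

lemma IsTreeValue.cexpP_ne_zero {P : Set ℕ} (h0 : 0 ∈ P) {z T : ℂ} (h : IsTreeValue P z T) :
    cexpP P T ≠ 0 := fun h1 => by
  have h2 : T = 0 := by rw [IsTreeValue, h1, mul_zero] at h; exact h
  rw [h2, cexpP_zero h0] at h1
  exact one_ne_zero h1

lemma norm_cexpP_sub_le (P : Set ℕ) {r : ℝ} {a b : ℂ} (ha : ‖a‖ ≤ r) (hb : ‖b‖ ≤ r) :
    ‖cexpP P a - cexpP P b‖ ≤ truncExp (shift P 1) r * ‖a - b‖ :=
  (convex_closedBall (0 : ℂ) r).norm_image_sub_le_of_norm_hasDerivWithin_le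
    (fun x _ => (hasDerivAt_cexpP P x).hasDerivWithinAt)
    (fun _ hx => norm_cexpP_le _ (mem_closedBall_zero_iff.1 hx))
    (mem_closedBall_zero_iff.2 hb) (mem_closedBall_zero_iff.2 ha)

section Disc

variable {P : Set ℕ} (h0 : 0 ∈ P) (h2 : (shift P 2).Nonempty) {z : ℂ}
include h0 h2

lemma norm_mul_truncExp_shift_lt (hz : ‖z‖ < rho P) :
    ‖z‖ * truncExp (shift P 1) (tau P) < 1 := by
  rw [← rho_mul_truncExp_shift h0 h2]
  exact mul_lt_mul_of_pos_right hz (truncExp_shift_pos h0 h2)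

lemma norm_mul_truncExp_lt (hz : ‖z‖ < rho P) : ‖z‖ * truncExp P (tau P) < tau P := by
  conv_rhs => rw [← rho_mul_truncExp h0 h2]
  exact mul_lt_mul_of_pos_right hz (truncExp_tau_pos h0 h2)

/-- Banach's fixed point theorem for t ↦ z e_P(t) on the disc |t| ≤ τ: it is preserved because ρ
e_P(τ) = τ, and contracted because ρ e_P'(τ) = 1. -/
lemma exists_isTreeValue (hz : ‖z‖ < rho P) : ∃ T, ‖T‖ ≤ tau P ∧ IsTreeValue P z T := by
  have hmaps : MapsTo (fun t => z * cexpP P t) (Metric.closedBall 0 (tau P))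
      (Metric.closedBall 0 (tau P)) := fun t ht => by
    rw [mem_closedBall_zero_iff] at ht ⊢
    rw [norm_mul]
    exact (mul_le_mul_of_nonneg_left (norm_cexpP_le P ht) (norm_nonneg z)).trans
      (norm_mul_truncExp_lt h0 h2 hz).le
  have hlt := norm_mul_truncExp_shift_lt h0 h2 hz
  have hnn : 0 ≤ ‖z‖ * truncExp (shift P 1) (tau P) :=
    mul_nonneg (norm_nonneg z) (truncExp_shift_pos h0 h2).le
  have hcontr : ContractingWith (Real.toNNReal (‖z‖ * truncExp (shift P 1) (tau P)))
      (hmaps.restrict _ _ _) := by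
    refine ⟨Real.toNNReal_lt_one.2 hlt, LipschitzWith.of_dist_le_mul fun a b => ?_⟩
    rw [Subtype.dist_eq, Subtype.dist_eq, dist_eq_norm, dist_eq_norm, Real.coe_toNNReal _ hnn]
    simp only [MapsTo.val_restrict_apply, ← mul_sub, norm_mul]
    rw [mul_assoc]
    exact mul_le_mul_of_nonneg_left (norm_cexpP_sub_le P (mem_closedBall_zero_iff.1 a.2)
      (mem_closedBall_zero_iff.1 b.2)) (norm_nonneg z)
  have hmem : (0 : ℂ) ∈ Metric.closedBall (0 : ℂ) (tau P) :=
    Metric.mem_closedBall_self (tau_pos h0 h2).le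
  obtain ⟨y, hy, hfix, -⟩ := hcontr.exists_fixedPoint' Metric.isClosed_closedBall.isComplete
    hmaps hmem (edist_ne_top _ _)
  exact ⟨y, mem_closedBall_zero_iff.1 hy, hfix.symm⟩

lemma isTreeValue_unique (hz : ‖z‖ < rho P) {a b : ℂ} (ha : ‖a‖ ≤ tau P) (hb : ‖b‖ ≤ tau P)
    (ha' : IsTreeValue P z a) (hb' : IsTreeValue P z b) : a = b := by
  have h1 : ‖a - b‖ ≤ ‖z‖ * truncExp (shift P 1) (tau P) * ‖a - b‖ := by
    conv_lhs => rw [ha', hb', ← mul_sub, norm_mul]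
    rw [mul_assoc]
    exact mul_le_mul_of_nonneg_left (norm_cexpP_sub_le P ha hb) (norm_nonneg z)
  have h3 := norm_mul_truncExp_shift_lt h0 h2 hz
  by_contra hne
  have h4 : 0 < ‖a - b‖ := norm_pos_iff.2 (sub_ne_zero.2 hne)
  nlinarith

end Disc

/-- The solution of `T = z e_P(T)` in the closed disc of radius `τ`: the sum of the generating
function of trees. -/
def treeFun (P : Set ℕ) (z : ℂ) : ℂ := Classical.epsilon fun T => ‖T‖ ≤ tau P ∧ IsTreeValue P z T

lemma treeFun_spec {P : Set ℕ} (h0 : 0 ∈ P) (h2 : (shift P 2).Nonempty) {z : ℂ}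
    (hz : ‖z‖ < rho P) : ‖treeFun P z‖ ≤ tau P ∧ IsTreeValue P z (treeFun P z) :=
  Classical.epsilon_spec (exists_isTreeValue h0 h2 hz)

/-- Local inverse of an analytic function. -/
lemma exists_local_inverse {f : ℂ → ℂ} {a f' : ℂ} (hf : AnalyticAt ℂ f a) (hf' : HasDerivAt f f' a)
    (hne : f' ≠ 0) : ∃ g : ℂ → ℂ, AnalyticAt ℂ g (f a) ∧ g (f a) = a ∧
      (∀ᶠ w in 𝓝 (f a), f (g w) = w) ∧ HasDerivAt g f'⁻¹ (f a) := by
  have hs : HasStrictDerivAt f f' a := by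
    have := hf.hasStrictDerivAt
    rwa [hf'.deriv] at this
  obtain rfl := hf'.deriv
  exact ⟨_, hf.analyticAt_localInverse hne, HasStrictFDerivAt.localInverse_apply_image _,
    HasStrictFDerivAt.eventually_right_inverse _, (hs.to_localInverse hne).hasDerivAt⟩

/-- Solving for z gives z = t / e_P(t), whose derivative at t₀ is D / e_P(t₀) with D the quantity in
`hD`. The inverse function theorem applies as long as D ≠ 0. -/
lemma exists_local_solution {P : Set ℕ} (h0 : 0 ∈ P) {z₀ t₀ : ℂ} (hfix : IsTreeValue P z₀ t₀)
    (hD : 1 - z₀ * cexpP (shift P 1) t₀ ≠ 0) :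
    ∃ g : ℂ → ℂ, AnalyticAt ℂ g z₀ ∧ g z₀ = t₀ ∧ ∀ᶠ z in 𝓝 z₀, IsTreeValue P z (g z) := by
  have hφ := hfix.cexpP_ne_zero h0
  have hval : t₀ / cexpP P t₀ = z₀ := by
    rw [div_eq_iff hφ]; exact hfix
  have hd := (hasDerivAt_id t₀).div (hasDerivAt_cexpP P t₀) hφ
  have hne : (1 * cexpP P t₀ - id t₀ * cexpP (shift P 1) t₀) / cexpP P t₀ ^ 2 ≠ 0 := by
    refine div_ne_zero ?_ (pow_ne_zero 2 hφ)
    rw [id, one_mul]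
    nth_rw 2 [hfix]
    rw [show cexpP P t₀ - z₀ * cexpP P t₀ * cexpP (shift P 1) t₀ =
      cexpP P t₀ * (1 - z₀ * cexpP (shift P 1) t₀) by ring]
    exact mul_ne_zero hφ hD
  obtain ⟨g, hg, hgv, hinv, -⟩ :=
    exists_local_inverse (f := fun t => t / cexpP P t)
      (analyticAt_id.div (analyticAt_cexpP P t₀) hφ) hd hne
  rw [hval] at hg hgv hinv
  refine ⟨g, hg, hgv, ?_⟩
  have hcont : ContinuousAt (fun z => cexpP P (g z)) z₀ :=
    ContinuousAt.comp (analyticAt_cexpP P _).continuousAt hg.continuousAt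
  have hne' : ∀ᶠ z in 𝓝 z₀, cexpP P (g z) ≠ 0 := hcont.eventually_ne (by rwa [hgv])
  filter_upwards [hinv, hne'] with z hz1 hz2
  exact (div_eq_iff hz2).1 hz1

/-- The value at z₀ has modulus strictly less than τ, so the local analytic solution stays in the
disc where solutions are unique. -/
lemma analyticAt_treeFun {P : Set ℕ} (h0 : 0 ∈ P) (h2 : (shift P 2).Nonempty) {z₀ : ℂ}
    (hz : ‖z₀‖ < rho P) : AnalyticAt ℂ (treeFun P) z₀ := by
  obtain ⟨hle, hfix⟩ := treeFun_spec h0 h2 hz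
  have hlt : ‖treeFun P z₀‖ < tau P := by
    rw [hfix, norm_mul]
    exact (mul_le_mul_of_nonneg_left (norm_cexpP_le P hle) (norm_nonneg _)).trans_lt
      (norm_mul_truncExp_lt h0 h2 hz)
  have hD : 1 - z₀ * cexpP (shift P 1) (treeFun P z₀) ≠ 0 := by
    intro h
    have h3 : ‖z₀ * cexpP (shift P 1) (treeFun P z₀)‖ = 1 := by
      rw [← sub_eq_zero.1 h, norm_one]
    rw [norm_mul] at h3
    have h4 := mul_le_mul_of_nonneg_left (norm_cexpP_le (shift P 1) hle) (norm_nonneg z₀)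
    have h5 := norm_mul_truncExp_shift_lt h0 h2 hz
    linarith
  obtain ⟨g, hg, hgv, hge⟩ := exists_local_solution h0 hfix hD
  refine hg.congr ?_
  have h1 : ∀ᶠ z in 𝓝 z₀, ‖g z‖ < tau P :=
    hg.continuousAt.norm.eventually_lt_const (by simpa only [hgv] using hlt)
  have h3 : ∀ᶠ z in 𝓝 z₀, ‖z‖ < rho P := continuous_norm.continuousAt.eventually_lt_const hz
  filter_upwards [h1, h3, hge] with z hz1 hz2 hz3
  exact isTreeValue_unique h0 h2 hz2 hz1.le (treeFun_spec h0 h2 hz2).1 hz3 (treeFun_spec h0 h2 hz2).2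

end

end PreimageConstraint

/-! ### The slit plane, the square root, and uniformization of a double zero. -/

namespace PreimageConstraint

noncomputable section

lemma isOpen_slit (s : ℝ) : IsOpen (slit s) := by
  have : IsClosed {z : ℂ | z.im = 0 ∧ s ≤ z.re} :=
    (isClosed_eq Complex.continuous_im continuous_const).inter
      (isClosed_le continuous_const Complex.continuous_re)
  exact this.isOpen_compl

lemma one_sub_div_mem_slitPlane {s : ℝ} (hs : 0 < s) {z : ℂ} (hz : z ∈ slit s) :
    1 - z / s ∈ Complex.slitPlane := by
  rw [Complex.mem_slitPlane_iff]
  have hre : (1 - z / s).re = 1 - z.re / s := by simp [Complex.div_ofReal_re]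
  have him : (1 - z / s).im = -(z.im / s) := by simp [Complex.div_ofReal_im]
  rw [hre, him]
  by_cases h : z.im = 0
  · left
    have h1 : z.re < s := not_le.1 fun h' => hz ⟨h, h'⟩
    rw [sub_pos, div_lt_one hs]
    exact h1
  · right
    exact neg_ne_zero.2 (div_ne_zero h hs.ne')

/-- The principal branch of `√(1 - z / s)`. -/
def sqrtAt (s : ℝ) (z : ℂ) : ℂ := (1 - z / s) ^ (1 / 2 : ℂ)

lemma sqrtAt_sq (s : ℝ) (z : ℂ) : sqrtAt s z ^ 2 = 1 - z / s := by
  rw [sqrtAt, ← Complex.cpow_nat_mul]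
  norm_num

lemma analyticAt_sqrtAt {s : ℝ} (hs : 0 < s) {z : ℂ} (hz : z ∈ slit s) :
    AnalyticAt ℂ (sqrtAt s) z :=
  (analyticAt_const.sub (analyticAt_id.div_const)).cpow analyticAt_const
    (one_sub_div_mem_slitPlane hs hz)

lemma sqrtAt_ne_zero {s : ℝ} (hs : 0 < s) {z : ℂ} (hz : z ∈ slit s) : sqrtAt s z ≠ 0 := by
  intro h
  have h1 := sqrtAt_sq s z
  rw [h, zero_pow two_ne_zero] at h1
  exact Complex.slitPlane_ne_zero (one_sub_div_mem_slitPlane hs hz) h1.symm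

lemma tendsto_sqrtAt {s : ℝ} (hs : 0 < s) : Tendsto (sqrtAt s) (𝓝 (s : ℂ)) (𝓝 0) := by
  rw [tendsto_zero_iff_norm_tendsto_zero]
  have h1 : ∀ z, ‖sqrtAt s z‖ = √‖1 - z / s‖ := fun z => by
    rw [← sqrtAt_sq, norm_pow, Real.sqrt_sq (norm_nonneg _)]
  simp only [h1]
  have h2 : Continuous fun z : ℂ => √‖1 - z / s‖ := by fun_prop
  have h3 := h2.tendsto (s : ℂ)
  have hs' : (s : ℂ) ≠ 0 := Complex.ofReal_ne_zero.2 hs.ne'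
  simpa [div_self hs'] using h3

/-- As 1 - z/s has positive real part, its root lies in the sector |Im| ≤ Re. This sector condition
later keeps the branch at ρ inside |t| ≤ τ. -/
lemma norm_sqrtAt_le {s : ℝ} (hs : 0 < s) {z : ℂ} (hz : ‖z‖ < s) :
    ‖sqrtAt s z‖ ≤ 2 * (sqrtAt s z).re := by
  have hre : 0 < (1 - z / s).re := by
    have : (1 - z / s).re = 1 - z.re / s := by simp [Complex.div_ofReal_re]
    rw [this, sub_pos, div_lt_one hs]
    exact (Complex.re_le_norm z).trans_lt hz
  have h1 : (sqrtAt s z ^ 2).re = (sqrtAt s z).re ^ 2 - (sqrtAt s z).im ^ 2 := by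
    rw [sq, Complex.mul_re]; ring
  rw [sqrtAt_sq] at h1
  have h2 : ‖sqrtAt s z‖ ^ 2 = (sqrtAt s z).re ^ 2 + (sqrtAt s z).im ^ 2 := by
    rw [Complex.sq_norm, Complex.normSq_apply]; ring
  have h3 : 0 ≤ (sqrtAt s z).re := by
    have : sqrtAt s z = (1 - z / s) ^ (1 / 2 : ℂ) := rfl
    have hne : 1 - z / (s : ℂ) ≠ 0 := fun h => by rw [h] at hre; simp at hre
    rw [this, Complex.cpow_def_of_ne_zero hne, Complex.exp_re]
    refine mul_nonneg (Real.exp_pos _).le (Real.cos_nonneg_of_mem_Icc ?_)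
    have h4 : (Complex.log (1 - z / s) * (1 / 2)).im = Complex.arg (1 - z / s) / 2 := by
      rw [Complex.mul_im]; simp [Complex.log_im]; ring
    rw [h4]
    have h5 := Complex.neg_pi_lt_arg (1 - z / s)
    have h6 := Complex.arg_le_pi (1 - z / s)
    constructor <;> linarith
  refine le_of_sq_le_sq ?_ (by positivity)
  rw [h2]
  nlinarith [sq_nonneg (sqrtAt s z).re]

/-- A double zero of an analytic function can be uniformized by a square root. -/
lemma exists_uniformizer {W V : ℂ → ℂ} {a V' : ℂ} (hW : AnalyticAt ℂ W a)
    (hW' : ∀ᶠ t in 𝓝 a, HasDerivAt W (V t) t) (h0 : W a = 0) (hV : V a = 0)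
    (hV' : HasDerivAt V V' a) (hslit : V' / 2 ∈ Complex.slitPlane) :
    ∃ Θ : ℂ → ℂ, AnalyticAt ℂ Θ 0 ∧ Θ 0 = a ∧ (∀ᶠ s in 𝓝 0, W (Θ s) = s ^ 2) ∧
      HasDerivAt Θ (-((V' / 2) ^ (1 / 2 : ℂ))⁻¹) 0 := by
  -- Dividing twice by t - a writes W as (t - a)² κ(t) with κ analytic; `hκa` finds κ(a) = V'/2 by
  -- differentiating this twice.
  obtain ⟨p, hp⟩ := hW
  have hκan : AnalyticAt ℂ (dslope (dslope W a) a) a :=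
    ⟨_, hp.has_fpower_series_dslope_fslope.has_fpower_series_dslope_fslope⟩
  set κ := dslope (dslope W a) a with hκ
  have hWd : deriv W a = 0 := by rw [hW'.self_of_nhds.deriv, hV]
  have hWκ : ∀ t, W t = (t - a) ^ 2 * κ t := fun t => by
    have h1 := sub_smul_dslope W a t
    have h3 := sub_smul_dslope (dslope W a) a t
    rw [dslope_same, hWd, sub_zero] at h3
    rw [h0, sub_zero, ← h3, smul_eq_mul, smul_eq_mul] at h1
    rw [← h1]; ring
  have hκa : κ a = V' / 2 := by
    have hev : V =ᶠ[𝓝 a] fun t => 2 * (t - a) * κ t + (t - a) ^ 2 * deriv κ t := by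
      filter_upwards [hW', hκan.eventually_analyticAt] with t ht hκt
      have h1 : HasDerivAt W (2 * (t - a) * κ t + (t - a) ^ 2 * deriv κ t) t := by
        have h3 := (((hasDerivAt_id t).sub_const a).pow 2).mul hκt.differentiableAt.hasDerivAt
        have h4 : ((fun t => id t - a) ^ 2 * κ : ℂ → ℂ) = W := by
          funext t; simp [hWκ]
        rw [h4] at h3
        convert! h3 using 1
        simp
      exact ht.unique h1
    have h1 : HasDerivAt (fun t => 2 * (t - a) * κ t + (t - a) ^ 2 * deriv κ t) (2 * κ a) a := by
      have h3 := (((hasDerivAt_id a).sub_const a).const_mul 2).mul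
        hκan.differentiableAt.hasDerivAt
      have h4 := (((hasDerivAt_id a).sub_const a).pow 2).mul
        hκan.deriv.differentiableAt.hasDerivAt
      convert! h3.add h4 using 1
      simp
    rw [hV'.unique (h1.congr_of_eventuallyEq hev)]
    ring
  have hκs : κ a ∈ Complex.slitPlane := by rwa [hκa]
  have hroot : AnalyticAt ℂ (fun t => κ t ^ (1 / 2 : ℂ)) a := hκan.cpow analyticAt_const hκs
  -- W is the square of this local coordinate, and Θ is its inverse. The sign of a - t selects the
  -- branch with Θ'(0) = -κ(a)^(-1/2), the one on which the tree function lives.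
  have hσ : AnalyticAt ℂ (fun t => (a - t) * κ t ^ (1 / 2 : ℂ)) a :=
    (analyticAt_const.sub analyticAt_id).mul hroot
  have hσ' : HasDerivAt (fun t => (a - t) * κ t ^ (1 / 2 : ℂ)) (-(V' / 2) ^ (1 / 2 : ℂ)) a := by
    have h3 := ((hasDerivAt_id a).const_sub a).mul hroot.differentiableAt.hasDerivAt
    convert! h3 using 1
    simp [hκa]
  have hne : -(V' / 2) ^ (1 / 2 : ℂ) ≠ 0 := by
    rw [neg_ne_zero, Complex.cpow_ne_zero_iff]
    exact Or.inl (Complex.slitPlane_ne_zero hslit)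
  obtain ⟨Θ, hΘ, hΘ0, hinv, hΘ'⟩ := exists_local_inverse hσ hσ' hne
  simp only [sub_self, zero_mul] at hΘ hΘ0 hinv hΘ'
  refine ⟨Θ, hΘ, hΘ0, ?_, by rwa [← inv_neg]⟩
  filter_upwards [hinv] with s hs
  have h5 : (κ (Θ s) ^ (1 / 2 : ℂ)) ^ 2 = κ (Θ s) := by
    rw [← Complex.cpow_nat_mul]; norm_num
  calc W (Θ s) = (Θ s - a) ^ 2 * (κ (Θ s) ^ (1 / 2 : ℂ)) ^ 2 := by rw [h5, hWκ]
    _ = ((a - Θ s) * κ (Θ s) ^ (1 / 2 : ℂ)) ^ 2 := by ring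
    _ = s ^ 2 := by rw [hs]

end

end PreimageConstraint

/-! ### The branch of the tree function at ρ. -/

namespace PreimageConstraint

noncomputable section

section Branch

variable {P : Set ℕ} (h0 : 0 ∈ P) (h2 : (shift P 2).Nonempty)
include h0 h2

/-- The inverse of `t / e_P(t)` at its critical point `τ`, in the coordinate `√(1 - z / ρ)`. -/
lemma exists_tau_uniformizer :
    ∃ Θ : ℂ → ℂ, AnalyticAt ℂ Θ 0 ∧ Θ 0 = tau P ∧
      (∀ᶠ s in 𝓝 0, IsTreeValue P (rho P * (1 - s ^ 2)) (Θ s)) ∧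
      HasDerivAt Θ (-(√(truncExp (shift P 2) (tau P) / truncExp P (tau P) / 2))⁻¹ : ℝ) 0 := by
  have hτ := tau_pos h0 h2
  have hρ := rho_pos h0 h2
  have he := truncExp_tau_pos h0 h2
  have he2 := truncExp_shift_two_pos h0 h2
  set e := truncExp P (tau P) with he_def
  set e₂ := truncExp (shift P 2) (tau P) with he2_def
  have hρc : (rho P : ℂ) ≠ 0 := Complex.ofReal_ne_zero.2 hρ.ne'
  have hec : (e : ℂ) ≠ 0 := Complex.ofReal_ne_zero.2 he.ne'
  have hφτ : cexpP P (tau P) = e := cexpP_ofReal P _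
  have hφτne : cexpP P (tau P) ≠ 0 := by rwa [hφτ]
  have hφ1 : (rho P : ℂ) * cexpP (shift P 1) (tau P) = 1 := by
    rw [cexpP_ofReal]; exact_mod_cast rho_mul_truncExp_shift h0 h2
  have hρe : (rho P : ℂ) * e = tau P := by exact_mod_cast rho_mul_truncExp h0 h2
  -- W is 1 - z/ρ along the curve z = t / e_P(t). At τ both W and its derivative V vanish, by the
  -- definitions of ρ and τ, while V'(τ) = e₂ / e > 0.
  set W : ℂ → ℂ := fun t => 1 - t / cexpP P t / rho P with hWdef
  set V : ℂ → ℂ := fun t =>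
    -(cexpP P t - t * cexpP (shift P 1) t) / cexpP P t ^ 2 / rho P with hVdef
  have hWd : ∀ t, cexpP P t ≠ 0 → HasDerivAt W (V t) t := fun t ht => by
    have h3 := ((((hasDerivAt_id t).div (hasDerivAt_cexpP P t) ht).div_const
      (rho P : ℂ)).const_sub 1)
    convert! h3 using 1
    simp only [hVdef, id]
    ring
  have hW : AnalyticAt ℂ W (tau P) :=
    analyticAt_const.sub ((analyticAt_id.div (analyticAt_cexpP P _) hφτne).div_const)
  have hne : ∀ᶠ t in 𝓝 (tau P : ℂ), cexpP P t ≠ 0 :=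
    (analyticAt_cexpP P _).continuousAt.eventually_ne hφτne
  have hW0 : W (tau P) = 0 := by
    simp only [hWdef, hφτ]
    rw [← hρe]
    field_simp
    simp
  have hnum : cexpP P (tau P) - tau P * cexpP (shift P 1) (tau P) = 0 := by
    rw [hφτ]
    linear_combination (-(e : ℂ)) * hφ1 + cexpP (shift P 1) (tau P) * hρe
  have hV0 : V (tau P) = 0 := by simp only [hVdef, hnum, neg_zero, zero_div]
  have hVd : HasDerivAt V ((e₂ / e : ℝ) : ℂ) (tau P) := by
    have h3 := (((hasDerivAt_cexpP P (tau P)).sub ((hasDerivAt_id (tau P : ℂ)).mul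
      (hasDerivAt_cexpP (shift P 1) (tau P)))).neg.div
        ((hasDerivAt_cexpP P (tau P)).pow 2) (pow_ne_zero 2 hφτne)).div_const (rho P : ℂ)
    rw [shift_shift_one] at h3
    convert! h3 using 1
    have h4 : cexpP (shift P 2) (tau P) = e₂ := cexpP_ofReal _ _
    have h5 : cexpP P (tau P) - id (tau P : ℂ) * cexpP (shift P 1) (tau P) = 0 := hnum
    simp only [Pi.neg_apply, Pi.sub_apply, Pi.mul_apply, Pi.pow_apply, h4, hφτ]
    rw [hφτ] at h5
    rw [h5]
    push_cast
    simp only [id, one_mul]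
    field_simp
    linear_combination (e₂ : ℂ) * e * hρe
  have hslit : ((e₂ / e : ℝ) : ℂ) / 2 ∈ Complex.slitPlane := by
    rw [show ((e₂ / e : ℝ) : ℂ) / 2 = ((e₂ / e / 2 : ℝ) : ℂ) by push_cast; ring]
    exact Complex.ofReal_mem_slitPlane.2 (by positivity)
  obtain ⟨Θ, hΘ, hΘ0, hΘW, hΘd⟩ :=
    exists_uniformizer hW (hne.mono hWd) hW0 hV0 hVd hslit
  refine ⟨Θ, hΘ, hΘ0, ?_, ?_⟩
  · have hne' : ∀ᶠ s in 𝓝 0, cexpP P (Θ s) ≠ 0 := by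
      have : Tendsto Θ (𝓝 0) (𝓝 (tau P : ℂ)) := by
        have := hΘ.continuousAt.tendsto
        rwa [hΘ0] at this
      exact this.eventually hne
    filter_upwards [hΘW, hne'] with s hs hs'
    simp only [hWdef] at hs
    have h6 : Θ s / cexpP P (Θ s) = rho P * (1 - s ^ 2) := by
      rw [← hs]; field_simp; ring
    exact (div_eq_iff hs').1 h6
  · convert hΘd using 1
    rw [show ((e₂ / e : ℝ) : ℂ) / 2 = ((e₂ / e / 2 : ℝ) : ℂ) by push_cast; ring, Real.sqrt_eq_rpow,
      show (1 / 2 : ℂ) = ((1 / 2 : ℝ) : ℂ) by push_cast; ring,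
      ← Complex.ofReal_cpow (by positivity)]
    push_cast
    rfl

/-- Continuation of the tree function to a slit neighborhood of `ρ`. -/
lemma exists_branch_rho :
    ∃ g : ℂ → ℂ, ∃ δ > 0, AnalyticOnNhd ℂ g (Metric.ball (rho P : ℂ) δ ∩ slit (rho P)) ∧
      (∀ z ∈ Metric.ball (rho P : ℂ) δ ∩ slit (rho P), IsTreeValue P z (g z)) ∧
      (∀ z ∈ Metric.ball (rho P : ℂ) δ, ‖z‖ < rho P → g z = treeFun P z) ∧
      Tendsto g (𝓝[slit (rho P)] (rho P : ℂ)) (𝓝 (tau P : ℂ)) ∧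
      Tendsto (fun z => (1 - z * cexpP (shift P 1) (g z)) / sqrtAt (rho P) z)
        (𝓝[slit (rho P)] (rho P : ℂ))
        (𝓝 (√(2 * tau P * rho P * truncExp (shift P 2) (tau P)) : ℝ)) := by
  obtain ⟨Θ, hΘ, hΘ0, hΘfix, hΘd⟩ := exists_tau_uniformizer h0 h2
  have hτ := tau_pos h0 h2
  have hρ := rho_pos h0 h2
  have he := truncExp_tau_pos h0 h2
  have he2 := truncExp_shift_two_pos h0 h2
  have hρe := rho_mul_truncExp h0 h2
  set e := truncExp P (tau P) with he_def
  set e₂ := truncExp (shift P 2) (tau P) with he2_def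
  set b := √(e₂ / e / 2) with hb_def
  have hb : 0 < b := Real.sqrt_pos.2 (by positivity)
  have hρc : (rho P : ℂ) ≠ 0 := Complex.ofReal_ne_zero.2 hρ.ne'
  have hs := tendsto_sqrtAt hρ
  have hsz : ∀ z : ℂ, (rho P : ℂ) * (1 - sqrtAt (rho P) z ^ 2) = z := fun z => by
    rw [sqrtAt_sq]; field_simp; ring
  -- Put w = ‖s‖ / b. In the sector, |τ - s/b|² ≤ τ² - τ w + w², which is at most (τ - w/4)² for w <
  -- τ/2. The first-order error, taken with constant 1/(4b), is at most the missing w/4. Uniqueness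
  -- in the disc then identifies the branch with the tree function.
  have hnorm : ∀ᶠ s in 𝓝 (0 : ℂ), ‖s‖ ≤ 2 * s.re → ‖Θ s‖ ≤ tau P := by
    have h3 := (hasDerivAt_iff_isLittleO_nhds_zero.1 hΘd).def (c := 1 / (4 * b)) (by positivity)
    have h4 : ∀ᶠ s in 𝓝 (0 : ℂ), ‖s‖ < tau P * b / 2 :=
      continuous_norm.continuousAt.eventually_lt_const (by simp only [norm_zero]; positivity)
    filter_upwards [h3, h4] with s hs1 hs2 hre
    simp only [zero_add, hΘ0] at hs1
    have h5 : ‖Θ s‖ ≤ ‖(tau P : ℂ) - s / b‖ + 1 / (4 * b) * ‖s‖ := by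
      have h6 : Θ s = ((tau P : ℂ) - s / b) +
          (Θ s - tau P - s • ((-b⁻¹ : ℝ) : ℂ)) := by
        rw [smul_eq_mul]; push_cast; ring
      calc ‖Θ s‖ = ‖((tau P : ℂ) - s / b) + (Θ s - tau P - s • ((-b⁻¹ : ℝ) : ℂ))‖ := by
            rw [← h6]
        _ ≤ _ := (norm_add_le _ _).trans (by gcongr)
    set w := ‖s‖ / b with hw
    have hw0 : 0 ≤ w := by positivity
    have hwlt : w < tau P / 2 := by
      rw [hw, div_lt_iff₀ hb]; linarith
    have h7 : ‖(tau P : ℂ) - s / b‖ ≤ tau P - w / 4 := by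
      refine le_of_sq_le_sq ?_ (by linarith)
      have h8 : ‖(tau P : ℂ) - s / b‖ ^ 2 = tau P ^ 2 - 2 * tau P * (s.re / b) + w ^ 2 := by
        have h9 : ‖s‖ ^ 2 = s.re * s.re + s.im * s.im := by
          rw [Complex.sq_norm, Complex.normSq_apply]
        rw [Complex.sq_norm, Complex.normSq_apply, hw, div_pow, h9]
        simp only [Complex.sub_re, Complex.sub_im, Complex.ofReal_re, Complex.ofReal_im,
          Complex.div_ofReal_re, Complex.div_ofReal_im]
        field_simp
        ring
      have h10 : w ≤ 2 * (s.re / b) := by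
        rw [hw, ← mul_div_assoc]; gcongr
      rw [h8]
      nlinarith
    have h11 : 1 / (4 * b) * ‖s‖ = w / 4 := by rw [hw]; field_simp
    linarith
  obtain ⟨η, hη, hball⟩ := Metric.eventually_nhds_iff_ball.1
    ((hΘ.eventually_analyticAt.and hΘfix).and hnorm)
  obtain ⟨δ, hδ, hδs⟩ := Metric.eventually_nhds_iff_ball.1 (hs (Metric.ball_mem_nhds 0 hη))
  have hfix : ∀ z ∈ Metric.ball (rho P : ℂ) δ, IsTreeValue P z (Θ (sqrtAt (rho P) z)) :=
    fun z hz => by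
      have h3 := (hball _ (hδs z hz)).1.2
      rwa [hsz] at h3
  have hslitne : ∀ᶠ z in 𝓝[slit (rho P)] (rho P : ℂ), sqrtAt (rho P) z ∈ ({0}ᶜ : Set ℂ) := by
    filter_upwards [self_mem_nhdsWithin] with z hz using sqrtAt_ne_zero hρ hz
  have hs' : Tendsto (sqrtAt (rho P)) (𝓝[slit (rho P)] (rho P : ℂ)) (𝓝[≠] 0) :=
    tendsto_nhdsWithin_iff.2 ⟨hs.mono_left nhdsWithin_le_nhds, hslitne⟩
  refine ⟨fun z => Θ (sqrtAt (rho P) z), δ, hδ, fun z hz => ?_, fun z hz => hfix z hz.1,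
    fun z hz hzρ => ?_, ?_, ?_⟩
  · exact (hball _ (hδs z hz.1)).1.1.comp (analyticAt_sqrtAt hρ hz.2)
  · exact isTreeValue_unique h0 h2 hzρ ((hball _ (hδs z hz)).2 (norm_sqrtAt_le hρ hzρ))
      (treeFun_spec h0 h2 hzρ).1 (hfix z hz) (treeFun_spec h0 h2 hzρ).2
  · have h3 := hΘ.continuousAt.tendsto
    rw [hΘ0] at h3
    exact h3.comp (hs.mono_left nhdsWithin_le_nhds)
  -- This is D in the coordinate s. It vanishes at 0 with derivative ρ e₂ / b, which is √(2 τ ρ e₂)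
  -- because b² = e₂ / (2 e) and ρ e = τ; the desired ratio is its difference quotient.
  · set Dfun : ℂ → ℂ := fun s => 1 - rho P * (1 - s ^ 2) * cexpP (shift P 1) (Θ s) with hDf
    have h3 : HasDerivAt Dfun ((rho P * e₂ / b : ℝ) : ℂ) 0 := by
      have h4 := hasDerivAt_cexpP (shift P 1) (Θ 0)
      have h5 := h4.comp 0 hΘd
      have h6 := (((((hasDerivAt_id (0 : ℂ)).pow 2).const_sub 1).const_mul (rho P : ℂ)).mul
        h5).const_sub 1
      convert! h6 using 1
      rw [hΘ0, shift_shift_one, cexpP_ofReal]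
      simp
      ring
    have h7 : Dfun 0 = 0 := by
      simp only [hDf, hΘ0, cexpP_ofReal]
      have := rho_mul_truncExp_shift h0 h2
      rw [zero_pow two_ne_zero, sub_zero, mul_one, ← Complex.ofReal_mul, this, Complex.ofReal_one,
        sub_self]
    have h8 := h3.tendsto_slope_zero.comp hs'
    have h9 : √(2 * tau P * rho P * e₂) = rho P * e₂ / b := by
      rw [Real.sqrt_eq_iff_mul_self_eq (by positivity) (by positivity)]
      have hbb : b * b = e₂ / e / 2 := Real.mul_self_sqrt (by positivity)
      rw [show rho P * e₂ / b * (rho P * e₂ / b) = (rho P * e₂) * (rho P * e₂) / (b * b) by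
        field_simp, hbb, ← hρe]
      field_simp
    rw [h9]
    refine h8.congr fun z => ?_
    rw [Function.comp_apply, h7, zero_add, sub_zero, smul_eq_mul]
    simp only [hDf]
    rw [hsz, div_eq_inv_mul]

end Branch

end

end PreimageConstraint

/-! ### Continuation of the tree function across the circle |z| = ρ. -/

namespace PreimageConstraint

noncomputable section

/-- Equality in the triangle inequality for `e_P` on the circle `|t| = r`. -/
lemma pow_eq_of_norm_cexpP_eq {P : Set ℕ} (h0 : 0 ∈ P) {t : ℂ}
    (h : ‖cexpP P t‖ = truncExp P ‖t‖) (hne : cexpP P t ≠ 0) {n : ℕ} (hn : n ∈ P) :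
    t ^ n = (‖t‖ : ℂ) ^ n := by
  -- The unimodular u rotates the sum onto e_P(‖t‖). The real part of each term is at most its
  -- modulus and the totals agree, so Re(u tⁿ) = ‖t‖ⁿ for all n ∈ P; n = 0 forces u = 1.
  set u : ℂ := truncExp P ‖t‖ / cexpP P t with hu
  have hun : ‖u‖ = 1 := by
    rw [hu, norm_div, Complex.norm_real, Real.norm_eq_abs, ← h, abs_norm,
      div_self (norm_ne_zero_iff.2 hne)]
  have hus : HasSum (fun n => u * (PowerSeries.coeff n (expSeries P) * t ^ n))
      ((truncExp P ‖t‖ : ℝ) : ℂ) := by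
    have := ((entireSeries_expSeries P).hasSum t).mul_left u
    rwa [← cexpP, hu, div_mul_cancel₀ _ hne] at this
  have hre := Complex.hasSum_re hus
  rw [Complex.ofReal_re] at hre
  have hdiff := (summable_truncExp P ‖t‖).hasSum.sub hre
  rw [← truncExp, sub_self] at hdiff
  have hterm : ∀ n ∈ P, (u * (PowerSeries.coeff n (expSeries P) * t ^ n)).re =
      (u * t ^ n).re / n.factorial := fun n hn => by
    have : u * (PowerSeries.coeff n (expSeries P) * t ^ n) =
        (u * t ^ n) / ((n.factorial : ℝ) : ℂ) := by
      simp [expSeries, hn]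
      ring
    rw [this, Complex.div_ofReal_re]
  have hle : ∀ n, (u * t ^ n).re ≤ ‖t‖ ^ n := fun n => by
    refine (Complex.re_le_norm _).trans_eq ?_
    rw [norm_mul, hun, one_mul, norm_pow]
  have hnn : ∀ n, 0 ≤ P.indicator (fun n => ‖t‖ ^ n / (n.factorial : ℝ)) n -
      (u * (PowerSeries.coeff n (expSeries P) * t ^ n)).re := fun n => by
    by_cases hn : n ∈ P
    · rw [Set.indicator_of_mem hn, hterm n hn, ← sub_div]
      exact div_nonneg (sub_nonneg.2 (hle n)) (Nat.cast_nonneg _)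
    · simp [expSeries, hn]
  have hzero := (hasSum_zero_iff_of_nonneg hnn).1 hdiff
  have heq : ∀ n ∈ P, (u * t ^ n).re = ‖t‖ ^ n := fun n hn => by
    have h1 := congrFun hzero n
    simp only [Set.indicator_of_mem hn, hterm n hn, Pi.zero_apply, ← sub_div] at h1
    rcases div_eq_zero_iff.1 h1 with h1 | h1
    · linarith
    · exact absurd (Nat.cast_eq_zero.1 h1) (Nat.factorial_ne_zero n)
  have key : ∀ w : ℂ, w.re = ‖w‖ → w = (‖w‖ : ℂ) := fun w hw => by
    have h1 := (Complex.re_eq_norm.1 hw)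
    rw [Complex.nonneg_iff] at h1
    apply Complex.ext
    · rw [hw, Complex.ofReal_re]
    · rw [Complex.ofReal_im, ← h1.2]
  have hu1 : u = 1 := by
    have h1 := heq 0 h0
    rw [pow_zero, pow_zero, mul_one] at h1
    have := key u (by rw [h1, hun])
    rwa [hun, Complex.ofReal_one] at this
  have h3 := heq n hn
  rw [hu1, one_mul] at h3
  have h4 := key (t ^ n) (by rw [h3, norm_pow])
  rw [h4, norm_pow, Complex.ofReal_pow]

/-- The order of t / ‖t‖ divides every element of P, hence their gcd. -/
lemma eq_norm_of_pow_eq {P : Set ℕ} (hgcd : Nat.setGcd P = 1) {t : ℂ} (ht : t ≠ 0)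
    (h : ∀ n ∈ P, t ^ n = (‖t‖ : ℂ) ^ n) : t = ‖t‖ := by
  have htn : (‖t‖ : ℂ) ≠ 0 := Complex.ofReal_ne_zero.2 (norm_ne_zero_iff.2 ht)
  have h1 : orderOf (t / ‖t‖) ∣ Nat.setGcd P := Nat.dvd_setGcd_iff.2 fun n hn => by
    refine orderOf_dvd_of_pow_eq_one ?_
    rw [div_pow, h n hn, div_self (pow_ne_zero n htn)]
  rw [hgcd, Nat.dvd_one, orderOf_eq_one_iff] at h1
  exact (div_eq_one_iff_eq htn).1 h1

/-- `g` continues the tree function to a neighborhood of `ζ`, slit along `[ρ, ∞)`. -/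
structure IsBranch (P : Set ℕ) (ζ : ℂ) (g : ℂ → ℂ) (δ : ℝ) : Prop where
  pos : 0 < δ
  subset : ζ ≠ rho P → Metric.ball ζ δ ⊆ slit (rho P)
  analytic : AnalyticOnNhd ℂ g (Metric.ball ζ δ ∩ slit (rho P))
  isTreeValue : ∀ z ∈ Metric.ball ζ δ ∩ slit (rho P), IsTreeValue P z (g z)
  eq_treeFun : ∀ z ∈ Metric.ball ζ δ, ‖z‖ < rho P → g z = treeFun P z
  tendsto : ζ = rho P → Tendsto g (𝓝[slit (rho P)] (rho P : ℂ)) (𝓝 (tau P : ℂ)) ∧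
    Tendsto (fun z => (1 - z * cexpP (shift P 1) (g z)) / sqrtAt (rho P) z)
      (𝓝[slit (rho P)] (rho P : ℂ))
      (𝓝 (√(2 * tau P * rho P * truncExp (shift P 2) (tau P)) : ℝ))

section Continuation

variable {P : Set ℕ} (h0 : 0 ∈ P) (h2 : (shift P 2).Nonempty)
include h0 h2

/-- A limit point of the tree function along the radius towards ζ, by compactness of |t| ≤ τ; the
equation passes to the limit. -/
lemma exists_isTreeValue_of_norm_eq {ζ : ℂ} (hζ : ‖ζ‖ = rho P) :
    ∃ t, ‖t‖ ≤ tau P ∧ IsTreeValue P ζ t := by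
  set a : ℕ → ℂ := fun n => (1 - 1 / ((n : ℝ) + 1) : ℝ) * ζ with ha
  have ha1 : ∀ n, ‖a n‖ < rho P := fun n => by
    have h1 : 0 < 1 / ((n : ℝ) + 1) := by positivity
    have h3 : 1 / ((n : ℝ) + 1) ≤ 1 := by
      rw [div_le_one (by positivity)]; linarith [n.cast_nonneg (α := ℝ)]
    rw [ha, norm_mul, hζ, Complex.norm_real, Real.norm_of_nonneg (by linarith)]
    nlinarith [rho_pos h0 h2]
  have ha2 : Tendsto a atTop (𝓝 ζ) := by
    have h1 : Tendsto (fun n : ℕ => 1 - 1 / ((n : ℝ) + 1)) atTop (𝓝 (1 - 0)) :=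
      tendsto_const_nhds.sub tendsto_one_div_add_atTop_nhds_zero_nat
    have h3 := ((Complex.continuous_ofReal.tendsto _).comp h1).mul_const ζ
    simpa [ha] using h3
  obtain ⟨t, ht, φ, hφ, hlim⟩ := (isCompact_closedBall (0 : ℂ) (tau P)).tendsto_subseq
    (x := fun n => treeFun P (a n))
    fun n => mem_closedBall_zero_iff.2 (treeFun_spec h0 h2 (ha1 n)).1
  refine ⟨t, mem_closedBall_zero_iff.1 ht, ?_⟩
  have h3 : Tendsto (fun n => a (φ n) * cexpP P (treeFun P (a (φ n)))) atTop
      (𝓝 (ζ * cexpP P t)) :=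
    (ha2.comp hφ.tendsto_atTop).mul ((analyticAt_cexpP P t).continuousAt.tendsto.comp hlim)
  refine tendsto_nhds_unique hlim (h3.congr fun n => ?_)
  exact (treeFun_spec h0 h2 (ha1 (φ n))).2.symm

/-- If |t| = τ, then ρ |e_P(t)| = τ = ρ e_P(τ) is equality in the triangle inequality. Aperiodicity
yields t = τ, and then ζ = ρ. -/
lemma norm_lt_tau_of_norm_eq (hgcd : Nat.setGcd P = 1) {ζ t : ℂ} (hζ : ‖ζ‖ = rho P)
    (hne : ζ ≠ rho P) (ht : ‖t‖ ≤ tau P) (hfix : IsTreeValue P ζ t) : ‖t‖ < tau P := by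
  refine lt_of_le_of_ne ht fun hτ => hne ?_
  have hφ := hfix.cexpP_ne_zero h0
  have h1 : ‖cexpP P t‖ = truncExp P ‖t‖ := by
    have h3 : ‖t‖ = ‖ζ‖ * ‖cexpP P t‖ := by rw [← norm_mul, ← hfix]
    rw [hτ, hζ] at h3
    rw [hτ]
    exact mul_left_cancel₀ (rho_pos h0 h2).ne' (h3.symm.trans (rho_mul_truncExp h0 h2).symm)
  have ht0 : t ≠ 0 := norm_pos_iff.1 (hτ ▸ tau_pos h0 h2)
  have h3 := eq_norm_of_pow_eq hgcd ht0 fun n hn => pow_eq_of_norm_cexpP_eq h0 h1 hφ hn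
  rw [hτ] at h3
  rw [IsTreeValue, h3, cexpP_ofReal] at hfix
  have h4 : (truncExp P (tau P) : ℂ) ≠ 0 :=
    Complex.ofReal_ne_zero.2 (truncExp_tau_pos h0 h2).ne'
  refine mul_right_cancel₀ h4 (hfix.symm.trans ?_)
  exact_mod_cast (rho_mul_truncExp h0 h2).symm

/-- As e_P' increases strictly (P has an element ≥ 2) and |t| < τ, |ζ e_P'(t)| < ρ e_P'(τ) = 1. So D
≠ 0 and the solution continues analytically. -/
lemma exists_isBranch_of_ne (hgcd : Nat.setGcd P = 1) {ζ : ℂ} (hζ : ‖ζ‖ = rho P)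
    (hne : ζ ≠ rho P) : ∃ g δ, IsBranch P ζ g δ := by
  obtain ⟨t, ht, hfix⟩ := exists_isTreeValue_of_norm_eq h0 h2 hζ
  have hlt := norm_lt_tau_of_norm_eq h0 h2 hgcd hζ hne ht hfix
  have hD : 1 - ζ * cexpP (shift P 1) t ≠ 0 := by
    intro h
    have h3 : ‖ζ‖ * ‖cexpP (shift P 1) t‖ = 1 := by
      rw [← norm_mul, ← sub_eq_zero.1 h, norm_one]
    obtain ⟨m, hm⟩ := h2
    have hm' : m + 1 ∈ shift P 1 := hm
    have h4 := truncExp_lt hm' (norm_nonneg t) hlt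
    have h5 := norm_cexpP_le (shift P 1) (le_refl ‖t‖)
    have h6 := rho_mul_truncExp_shift h0 ⟨m, hm⟩
    have h7 := mul_lt_mul_of_pos_left (h5.trans_lt h4) (rho_pos h0 ⟨m, hm⟩)
    rw [hζ] at h3
    linarith
  obtain ⟨g, hg, hgv, hge⟩ := exists_local_solution h0 hfix hD
  have h1 : ∀ᶠ z in 𝓝 ζ, ‖g z‖ < tau P :=
    hg.continuousAt.norm.eventually_lt_const (by simpa only [hgv] using hlt)
  have hslit : ζ ∈ slit (rho P) := fun h => hne <| by
    have h3 : ζ.re = rho P := le_antisymm (hζ ▸ Complex.re_le_norm ζ) h.2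
    apply Complex.ext
    · rw [h3, Complex.ofReal_re]
    · rw [h.1, Complex.ofReal_im]
  obtain ⟨δ, hδ, hball⟩ := Metric.eventually_nhds_iff_ball.1
    (((hg.eventually_analyticAt.and hge).and h1).and ((isOpen_slit (rho P)).mem_nhds hslit))
  refine ⟨g, δ, hδ, fun _ z hz => (hball z hz).2, fun z hz => (hball z hz.1).1.1.1,
    fun z hz => (hball z hz.1).1.1.2, fun z hz hzρ => ?_, fun h => absurd h hne⟩
  exact isTreeValue_unique h0 h2 hzρ (hball z hz).1.2.le (treeFun_spec h0 h2 hzρ).1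
    (hball z hz).1.1.2 (treeFun_spec h0 h2 hzρ).2

lemma exists_isBranch_rho : ∃ g δ, IsBranch P (rho P) g δ := by
  obtain ⟨g, δ, hδ, h3, h4, h5, h6, h7⟩ := exists_branch_rho h0 h2
  exact ⟨g, δ, hδ, fun h => absurd rfl h, h3, h4, h5, fun _ => ⟨h6, h7⟩⟩

omit h0 h2 in
/-- Two continuations to neighborhoods of points of the circle of convergence agree. -/
lemma IsBranch.eq_of_mem {ζ₁ ζ₂ : ℂ} {g₁ g₂ : ℂ → ℂ} {δ₁ δ₂ : ℝ} (hζ₁ : ‖ζ₁‖ = rho P)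
    (hζ₂ : ‖ζ₂‖ = rho P) (hne : ζ₁ ≠ ζ₂) (h₁ : IsBranch P ζ₁ g₁ δ₁) (h₂ : IsBranch P ζ₂ g₂ δ₂)
    {z : ℂ} (hz₁ : z ∈ Metric.ball ζ₁ δ₁) (hz₂ : z ∈ Metric.ball ζ₂ δ₂) : g₁ z = g₂ z := by
  have hsub : Metric.ball ζ₁ δ₁ ∩ Metric.ball ζ₂ δ₂ ⊆ slit (rho P) := by
    by_cases h : ζ₁ = rho P
    · exact inter_subset_right.trans (h₂.subset fun h' => hne (h.trans h'.symm))
    · exact inter_subset_left.trans (h₁.subset h)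
  have hp₁ := h₁.pos
  have hp₂ := h₂.pos
  have hd : dist ζ₁ ζ₂ < δ₁ + δ₂ := by
    rw [Metric.mem_ball] at hz₁ hz₂
    exact (dist_triangle_left ζ₁ ζ₂ z).trans_lt (add_lt_add hz₁ hz₂)
  rw [dist_eq_norm] at hd
  -- This point divides the chord in the ratio δ₁ : δ₂, so it is in both balls and, by strict
  -- convexity, inside the disc. Near it both branches equal the tree function; the identity theorem
  -- on the convex intersection finishes.
  set p : ℂ := (δ₂ / (δ₁ + δ₂)) • ζ₁ + (δ₁ / (δ₁ + δ₂)) • ζ₂ with hp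
  have hsum : δ₂ / (δ₁ + δ₂) + δ₁ / (δ₁ + δ₂) = 1 := by field_simp; ring
  have hpn : ‖p‖ < rho P :=
    norm_combo_lt_of_ne hζ₁.le hζ₂.le hne (by positivity) (by positivity) hsum
  have hsumc : ((δ₂ / (δ₁ + δ₂) : ℝ) : ℂ) + ((δ₁ / (δ₁ + δ₂) : ℝ) : ℂ) = 1 := by
    exact_mod_cast hsum
  have hpb₁ : p ∈ Metric.ball ζ₁ δ₁ := by
    have h3 : p - ζ₁ = (δ₁ / (δ₁ + δ₂) : ℝ) • -(ζ₁ - ζ₂) := by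
      simp only [hp, Complex.real_smul]
      linear_combination ζ₁ * hsumc
    rw [mem_ball_iff_norm, h3, norm_smul, norm_neg, Real.norm_of_nonneg (by positivity),
      div_mul_eq_mul_div, div_lt_iff₀ (by positivity)]
    gcongr
  have hpb₂ : p ∈ Metric.ball ζ₂ δ₂ := by
    have h3 : p - ζ₂ = (δ₂ / (δ₁ + δ₂) : ℝ) • (ζ₁ - ζ₂) := by
      simp only [hp, Complex.real_smul]
      linear_combination ζ₂ * hsumc
    rw [mem_ball_iff_norm, h3, norm_smul, Real.norm_of_nonneg (by positivity),
      div_mul_eq_mul_div, div_lt_iff₀ (by positivity)]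
    gcongr
  have hev : g₁ =ᶠ[𝓝 p] g₂ := by
    filter_upwards [Metric.isOpen_ball.mem_nhds hpb₁, Metric.isOpen_ball.mem_nhds hpb₂,
      continuous_norm.continuousAt.eventually_lt_const hpn] with w hw₁ hw₂ hw
    rw [h₁.eq_treeFun w hw₁ hw, h₂.eq_treeFun w hw₂ hw]
  exact (h₁.analytic.mono fun w hw => ⟨hw.1, hsub hw⟩).eqOn_of_preconnected_of_eventuallyEq
    (h₂.analytic.mono fun w hw => ⟨hw.2, hsub hw⟩)
    ((convex_ball ζ₁ δ₁).inter (convex_ball ζ₂ δ₂)).isPreconnected ⟨hpb₁, hpb₂⟩ hev ⟨hz₁, hz₂⟩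

/-- Analytic continuation of the tree function, with its behavior at the dominant singularity. -/
theorem exists_tree_continuation :
    ∃ (T : ℂ → ℂ) (V : Set ℂ), IsOpen V ∧ AnalyticOnNhd ℂ T V ∧
      (∀ z ∈ V, IsTreeValue P z (T z)) ∧ Metric.ball 0 (rho P) ⊆ V ∧
      (∀ z, ‖z‖ < rho P → ‖T z‖ ≤ tau P) ∧
      (∃ δ > 0, Metric.ball (rho P : ℂ) δ ∩ slit (rho P) ⊆ V) ∧
      Tendsto T (𝓝[slit (rho P)] (rho P : ℂ)) (𝓝 (tau P : ℂ)) ∧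
      Tendsto (fun z => (1 - z * cexpP (shift P 1) (T z)) / sqrtAt (rho P) z)
        (𝓝[slit (rho P)] (rho P : ℂ))
        (𝓝 (√(2 * tau P * rho P * truncExp (shift P 2) (tau P)) : ℝ)) ∧
      (Nat.setGcd P = 1 → ∃ r > rho P, slitDisc (rho P) r ⊆ V) := by
  have hρ := rho_pos h0 h2
  have hρn : ‖(rho P : ℂ)‖ = rho P := by rw [Complex.norm_real, Real.norm_of_nonneg hρ.le]
  -- Z always contains ρ, and it is the whole circle if gcd(P) = 1. T is glued from the tree
  -- function and the chosen branches, consistently by `IsBranch.eq_of_mem`.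
  set Z : Set ℂ := {ζ | ‖ζ‖ = rho P ∧ ∃ g δ, IsBranch P ζ g δ} with hZ
  have hex : ∀ ζ, ∃ (g : ℂ → ℂ) (δ : ℝ), ζ ∈ Z → IsBranch P ζ g δ := fun ζ => by
    by_cases h : ζ ∈ Z
    · obtain ⟨g, δ, hb⟩ := h.2
      exact ⟨g, δ, fun _ => hb⟩
    · exact ⟨id, 0, fun h' => absurd h' h⟩
  choose g δ hb using hex
  set A : ℂ → Set ℂ := fun ζ => Metric.ball ζ (δ ζ) ∩ slit (rho P) with hA
  set V : Set ℂ := Metric.ball 0 (rho P) ∪ ⋃ ζ ∈ Z, A ζ with hV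
  have hAopen : ∀ ζ, IsOpen (A ζ) := fun ζ => Metric.isOpen_ball.inter (isOpen_slit _)
  have hAV : ∀ ζ ∈ Z, A ζ ⊆ V := fun ζ hζ =>
    (subset_biUnion_of_mem (u := A) hζ).trans subset_union_right
  classical
  set T : ℂ → ℂ := fun z => if ‖z‖ < rho P then treeFun P z else
    if h : ∃ ζ ∈ Z, z ∈ A ζ then g h.choose z else 0 with hT
  have hTU : ∀ z, ‖z‖ < rho P → T z = treeFun P z := fun z hz => if_pos hz
  have hTA : ∀ ζ ∈ Z, ∀ z ∈ A ζ, T z = g ζ z := by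
    intro ζ hζ z hz
    by_cases hzρ : ‖z‖ < rho P
    · rw [hTU z hzρ, (hb ζ hζ).eq_treeFun z hz.1 hzρ]
    · have hex : ∃ ζ ∈ Z, z ∈ A ζ := ⟨ζ, hζ, hz⟩
      have h3 : T z = g hex.choose z := by
        simp only [hT, if_neg hzρ, dif_pos hex]
      have h4 := hex.choose_spec
      rw [h3]
      by_cases heq : hex.choose = ζ
      · rw [heq]
      · exact (hb _ h4.1).eq_of_mem h4.1.1 hζ.1 heq (hb ζ hζ) h4.2.1 hz.1
  have hρZ : (rho P : ℂ) ∈ Z := ⟨hρn, exists_isBranch_rho h0 h2⟩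
  have hTρ : T =ᶠ[𝓝[slit (rho P)] (rho P : ℂ)] g (rho P) := by
    filter_upwards [mem_nhdsWithin_of_mem_nhds (Metric.ball_mem_nhds _ (hb _ hρZ).pos),
      self_mem_nhdsWithin] with z hz1 hz2 using hTA _ hρZ z ⟨hz1, hz2⟩
  refine ⟨T, V, ?_, ?_, ?_, subset_union_left, ?_, ⟨δ (rho P), (hb _ hρZ).pos, hAV _ hρZ⟩,
    ?_, ?_, ?_⟩
  · exact Metric.isOpen_ball.union (isOpen_biUnion fun ζ _ => hAopen ζ)
  · rintro z (hz | hz)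
    · rw [mem_ball_zero_iff] at hz
      refine (analyticAt_treeFun h0 h2 hz).congr ?_
      filter_upwards [continuous_norm.continuousAt.eventually_lt_const hz] with w hw
        using (hTU w hw).symm
    · obtain ⟨ζ, hζ, hzA⟩ := mem_iUnion₂.1 hz
      refine ((hb ζ hζ).analytic z hzA).congr ?_
      filter_upwards [(hAopen ζ).mem_nhds hzA] with w hw using (hTA ζ hζ w hw).symm
  · rintro z (hz | hz)
    · rw [mem_ball_zero_iff] at hz
      rw [hTU z hz]
      exact (treeFun_spec h0 h2 hz).2
    · obtain ⟨ζ, hζ, hzA⟩ := mem_iUnion₂.1 hz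
      rw [hTA ζ hζ z hzA]
      exact (hb ζ hζ).isTreeValue z hzA
  · intro z hz
    rw [hTU z hz]
    exact (treeFun_spec h0 h2 hz).1
  · exact ((hb _ hρZ).tendsto rfl).1.congr' hTρ.symm
  · refine ((hb _ hρZ).tendsto rfl).2.congr' ?_
    filter_upwards [hTρ] with z hz
    rw [hz]
  · intro hgcd
    have hZall : ∀ ζ, ‖ζ‖ = rho P → ζ ∈ Z := fun ζ hζ => by
      by_cases h : ζ = rho P
      · rw [h]; exact hρZ
      · exact ⟨hζ, exists_isBranch_of_ne h0 h2 hgcd hζ h⟩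
    -- With the slit filled in, the open set contains the compact disc |z| ≤ ρ and hence an
    -- ε-neighborhood of it. The slit is cut out again afterwards.
    set V' : Set ℂ := Metric.ball 0 (rho P) ∪ ⋃ ζ ∈ Z, Metric.ball ζ (δ ζ) with hV'
    have hV'open : IsOpen V' :=
      Metric.isOpen_ball.union (isOpen_biUnion fun ζ _ => Metric.isOpen_ball)
    have hsub : Metric.closedBall 0 (rho P) ⊆ V' := fun z hz => by
      rw [mem_closedBall_zero_iff] at hz
      rcases hz.lt_or_eq with hz | hz
      · exact Or.inl (mem_ball_zero_iff.2 hz)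
      · exact Or.inr (mem_iUnion₂.2 ⟨z, hZall z hz,
          Metric.mem_ball_self (hb z (hZall z hz)).pos⟩)
    obtain ⟨ε, hε, hthick⟩ :=
      (isCompact_closedBall (0 : ℂ) (rho P)).exists_thickening_subset_open hV'open hsub
    rw [thickening_closedBall hε hρ.le] at hthick
    refine ⟨ε + rho P, by linarith, fun z hz => ?_⟩
    rcases hthick hz.1 with h | h
    · exact Or.inl h
    · obtain ⟨ζ, hζ, hzb⟩ := mem_iUnion₂.1 h
      exact hAV ζ hζ ⟨hzb, hz.2⟩

end Continuation

end

end PreimageConstraint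

/-! ### Counting maps with prescribed fiber sizes. -/

namespace PreimageConstraint

noncomputable section

open PowerSeries

/-- The number of maps `A → C` whose fiber over `c` has a size in `Q c`. -/
def fiberCount (A C : Type) (Q : C → Set ℕ) : ℕ :=
  Nat.card {g : A → C // ∀ c, {a | g a = c}.ncard ∈ Q c}

lemma coeff_zero_prod_expSeries {C : Type} [Fintype C] (Q : C → Set ℕ) [Decidable (∀ c, 0 ∈ Q c)] :
    coeff 0 (∏ c, expSeries (Q c)) = if ∀ c, 0 ∈ Q c then (1 : ℂ) else 0 := by
  classical
  rw [coeff_zero_eq_constantCoeff_apply, map_prod]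
  have h : ∀ c, constantCoeff (expSeries (Q c)) = if 0 ∈ Q c then (1 : ℂ) else 0 := fun c => by
    rw [← coeff_zero_eq_constantCoeff_apply]
    by_cases hc : 0 ∈ Q c <;> simp [expSeries, hc]
  simp only [h, Finset.prod_ite_zero, Finset.prod_const_one, Finset.mem_univ, true_implies]

lemma derivative_prod_expSeries {C : Type} [Fintype C] [DecidableEq C] (Q : C → Set ℕ) :
    d⁄dX ℂ (∏ c, expSeries (Q c)) =
      ∑ c, ∏ x, expSeries (Function.update Q c (shift (Q c) 1) x) := by
  have h : ∀ s : Finset C, d⁄dX ℂ (∏ c ∈ s, expSeries (Q c)) =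
      ∑ c ∈ s, ∏ x ∈ s, expSeries (Function.update Q c (shift (Q c) 1) x) := by
    intro s
    induction s using Finset.induction_on with
    | empty => simp
    | insert a s ha ih =>
      rw [Finset.prod_insert ha, Derivation.leibniz, ih, Finset.sum_insert ha,
        Finset.prod_insert ha, Function.update_self, derivative_expSeries, smul_eq_mul,
        smul_eq_mul, add_comm, Finset.mul_sum]
      congr 1
      · rw [mul_comm]
        congr 1
        refine Finset.prod_congr rfl fun x hx => ?_
        rw [Function.update_of_ne (ne_of_mem_of_not_mem hx ha)]
      · refine Finset.sum_congr rfl fun c hc => ?_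
        rw [Finset.prod_insert ha, Function.update_of_ne (ne_of_mem_of_not_mem hc ha).symm]
  exact h Finset.univ

lemma ncard_fiber_cons {n : ℕ} {C : Type} [DecidableEq C] (c : C) (g : Fin n → C) (x : C) :
    {a | (Fin.cons c g : Fin (n + 1) → C) a = x}.ncard =
      {a | g a = x}.ncard + if x = c then 1 else 0 := by
  classical
  rw [Set.ncard_eq_toFinset_card', Set.ncard_eq_toFinset_card', Set.toFinset_ofPred,
    Set.toFinset_ofPred, Finset.card_filter, Finset.card_filter, Fin.sum_univ_succ, add_comm]
  simp [eq_comm]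

/-- If the first point is sent to c, the sizes allowed for the rest of the fiber over c drop by one.
This is the recursion that the Leibniz rule `derivative_prod_expSeries` gives for coefficients. -/
lemma fiberCount_fin_succ (n : ℕ) {C : Type} [Fintype C] [DecidableEq C] (Q : C → Set ℕ) :
    fiberCount (Fin (n + 1)) C Q =
      ∑ c, fiberCount (Fin n) C (Function.update Q c (shift (Q c) 1)) := by
  unfold fiberCount
  rw [← Nat.card_sigma]
  refine Nat.card_congr (((Fin.consEquiv fun _ => C).subtypeEquiv fun p => ?_).symm.trans
    (Equiv.subtypeProdEquivSigmaSubtype fun (c : C) (g : Fin n → C) =>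
      ∀ x, {a | g a = x}.ncard ∈ Function.update Q c (shift (Q c) 1) x))
  refine forall_congr' fun x => ?_
  change _ ↔ {a | (Fin.cons p.1 p.2 : Fin (n + 1) → C) a = x}.ncard ∈ Q x
  rw [ncard_fiber_cons]
  by_cases hx : x = p.1
  · subst hx; simp [shift]
  · simp [hx]

lemma fiberCount_fin (n : ℕ) {C : Type} [Fintype C] (Q : C → Set ℕ) :
    (fiberCount (Fin n) C Q : ℂ) = n.factorial * coeff n (∏ c, expSeries (Q c)) := by
  classical
  induction n generalizing Q with
  | zero =>
    rw [coeff_zero_prod_expSeries, fiberCount]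
    have h : ∀ (g : Fin 0 → C) c, {a | g a = c}.ncard = 0 := fun g c => by
      rw [Set.eq_empty_of_isEmpty {a | g a = c}, Set.ncard_empty]
    simp only [h]
    by_cases h0 : ∀ c, 0 ∈ Q c
    · simp [h0]
    · simp [h0]
  | succ n ih =>
    rw [fiberCount_fin_succ, Nat.cast_sum]
    simp only [ih]
    rw [← Finset.mul_sum, ← map_sum, ← derivative_prod_expSeries, coeff_derivative,
      Nat.factorial_succ]
    push_cast
    ring

lemma fiberCount_congr {A B C : Type} (e : A ≃ B)
    (Q : C → Set ℕ) : fiberCount A C Q = fiberCount B C Q := by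
  refine Nat.card_congr ((e.arrowCongr (Equiv.refl C)).subtypeEquiv fun g => ?_)
  refine forall_congr' fun c => ?_
  have : {b | (e.arrowCongr (Equiv.refl C)) g b = c} = e '' {a | g a = c} := by
    ext b
    simp [Equiv.arrowCongr]
  rw [this, Set.ncard_image_of_injective _ e.injective]

/-- The number of maps with prescribed fiber sizes is given by a product of exponential series. -/
theorem fiberCount_eq (A : Type) {C : Type} [Fintype A] [Fintype C] (Q : C → Set ℕ) :
    (fiberCount A C Q : ℂ) =
      (Fintype.card A).factorial * coeff (Fintype.card A) (∏ c, expSeries (Q c)) := by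
  rw [fiberCount_congr (Fintype.equivFin A), fiberCount_fin]

/-- The fiber constraint of partial maps: the fibers over points are constrained by `P`, the set
of points without image is constrained by `R`. -/
def optionConstraint (R P : Set ℕ) {α : Type} (o : Option α) : Set ℕ := o.elim R fun _ => P

lemma fiberCount_option (A : Type) {C : Type} [Fintype A] [Fintype C] (R P : Set ℕ) :
    (fiberCount A (Option C) (optionConstraint R P) : ℂ) =
      (Fintype.card A).factorial *
        coeff (Fintype.card A) (expSeries R * expSeries P ^ Fintype.card C) := by
  rw [fiberCount_eq, Fintype.prod_option]
  simp [optionConstraint]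

end

end PreimageConstraint

/-! ### Partial maps, rooted trees and grafting. -/

namespace PreimageConstraint

noncomputable section

/-- The `k`-th iterate of a partial self-map. -/
def iter {α : Type} (f : α → Option α) (k : ℕ) (x : α) : Option α :=
  (fun o : Option α => o.bind f)^[k] (some x)

section Iter

variable {α β : Type} {f : α → Option α}

lemma iterate_bind (k : ℕ) (o : Option α) :
    (fun o : Option α => o.bind f)^[k] o = o.bind (iter f k) := by
  cases o with
  | none => exact Function.iterate_fixed rfl k
  | some x => rfl

@[simp] lemma iter_zero (x : α) : iter f 0 x = some x := rfl

lemma iter_add (a b : ℕ) (x : α) : iter f (a + b) x = (iter f b x).bind (iter f a) := by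
  rw [← iterate_bind, iter, Function.iterate_add_apply, iter]

lemma iter_one (x : α) : iter f 1 x = f x := rfl

lemma iter_succ (d : ℕ) (x : α) : iter f (d + 1) x = (f x).bind (iter f d) := by
  rw [iter_add, iter_one]

lemma iter_conj (e : α ≃ β) (f : α → Option α) (d : ℕ) (x : α) :
    iter (fun b => (f (e.symm b)).map e) d (e x) = (iter f d x).map e := by
  induction d generalizing x with
  | zero => rfl
  | succ d ih =>
    rw [iter_succ, iter_succ, Equiv.symm_apply_apply]
    cases h : f x with
    | none => rfl
    | some c => simp [ih]

end Iter

/-- `t` is the parent map of a rooted tree of height less than `k` with root `r`. -/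
def IsTreeAt {α : Type} (k : ℕ) (t : α → Option α) (r : α) : Prop :=
  (∀ x, t x = none ↔ x = r) ∧ ∀ x, ∃ d < k, iter t d x = some r

/-- The number of rooted trees on `α` of height less than `k` in which every node has a number of
children in `P`. -/
def treeCount (k : ℕ) (P : Set ℕ) (α : Type) : ℕ :=
  Nat.card {p : (α → Option α) × α // IsTreeAt k p.1 p.2 ∧ ∀ x, {y | p.1 y = some x}.ncard ∈ P}

lemma treeCount_congr (k : ℕ) (P : Set ℕ) {α β : Type} (e : α ≃ β) :
    treeCount k P α = treeCount k P β := by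
  refine Nat.card_congr (((e.arrowCongr (Equiv.optionCongr e)).prodCongr e).subtypeEquiv
    fun p => ?_)
  have hmap : ((e.arrowCongr (Equiv.optionCongr e)).prodCongr e) p =
      ((fun b => (p.1 (e.symm b)).map e), e p.2) := rfl
  rw [hmap]
  refine and_congr (and_congr ?_ ?_) ?_
  · rw [← e.forall_congr_right]
    simp
  · rw [← e.forall_congr_right (q := fun x => ∃ d < k,
      iter (fun b => (p.1 (e.symm b)).map e) d x = some (e p.2))]
    simp only [iter_conj]
    refine forall_congr' fun x => exists_congr fun d => and_congr_right fun _ => ?_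
    rw [← Option.map_some (f := e), (Option.map_injective e.injective).eq_iff]
  · rw [← e.forall_congr_right]
    refine forall_congr' fun x => ?_
    have : {y | (p.1 (e.symm y)).map e = some (e x)} = e '' {y | p.1 y = some x} := by
      ext y
      rw [← Option.map_some, Set.mem_ofPred_eq, (Option.map_injective e.injective).eq_iff]
      constructor
      · intro h; exact ⟨e.symm y, h, e.apply_symm_apply y⟩
      · rintro ⟨w, hw, rfl⟩; simpa using hw
    rw [this, Set.ncard_image_of_injective _ e.injective]

lemma treeCount_fin (k : ℕ) (P : Set ℕ) (n : ℕ) :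
    treeCount k P (Fin n) = Nat.card {f : Fin n → Option (Fin n) //
      IsRootedTree f ∧ HeightLT f k ∧ PartialConstraint P f} := by
  refine Nat.card_congr (Equiv.ofBijective (fun p => ⟨p.1.1, ⟨p.1.2, p.2.1.1, fun x => ?_⟩,
    fun x r hr => ?_, p.2.2⟩) ⟨fun p q hpq => ?_, fun f => ?_⟩)
  · obtain ⟨d, -, hd⟩ := p.2.1.2 x
    exact ⟨d, hd⟩
  · rw [(p.2.1.1 r).1 hr]
    exact p.2.1.2 x
  · have h1 : p.1.1 = q.1.1 := congrArg Subtype.val hpq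
    refine Subtype.ext (Prod.ext h1 ?_)
    have h2 := (p.2.1.1 p.1.2).2 rfl
    rw [h1] at h2
    exact (q.2.1.1 _).1 h2
  · obtain ⟨f, ⟨r, hr, hr'⟩, hh, hP⟩ := f
    exact ⟨⟨(f, r), ⟨hr, fun x => hh x r ((hr r).2 rfl)⟩, hP⟩, rfl⟩

/-- The nodes which are led to `x`. -/
def descendants {α : Type} (f : α → Option α) (x : α) : Set α := {y | ∃ d, iter f d y = some x}

section Graft

variable {α : Type} {S : Set α}

open Classical in
/-- The partial map made of a partial map `t` on `S` and a partial map `g` on the complement of `S`,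
where `g none` is the image of the points of `S` at which `t` is undefined. -/
def graft (t : S → Option S) (g : Option ↥Sᶜ → Option ↥Sᶜ) (y : α) : Option α :=
  if h : y ∈ S then (t ⟨y, h⟩).elim ((g none).map (↑)) fun s => some s
  else (g (some ⟨y, h⟩)).map (↑)

variable {t : S → Option S} {g : Option ↥Sᶜ → Option ↥Sᶜ} {r : S}

lemma graft_of_some {s c : S} (h : t s = some c) : graft t g s = some (c : α) := by
  simp [graft, h]

lemma graft_of_none {s : S} (h : t s = none) : graft t g s = (g none).map (↑) := by
  simp [graft, h]

lemma graft_of_notMem (y : ↥Sᶜ) : graft t g y = (g (some y)).map (↑) := by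
  have hy : (y : α) ∉ S := y.2
  simp [graft, hy]

lemma iter_graft_of_iter {d : ℕ} {y s : S} (h : iter t d y = some s) :
    iter (graft t g) d y = some (s : α) := by
  induction d generalizing y with
  | zero => simp only [iter_zero, Option.some.injEq] at h ⊢; rw [h]
  | succ d ih =>
    rw [iter_succ] at h ⊢
    cases hy : t y with
    | none => rw [hy] at h; cases h
    | some c =>
      rw [hy] at h
      rw [graft_of_some hy]
      exact ih h

lemma notMem_of_iter_graft {y : α} (hy : y ∉ S) {d : ℕ} {c : α}
    (h : iter (graft t g) d y = some c) : c ∉ S := by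
  induction d generalizing y with
  | zero => simp only [iter_zero, Option.some.injEq] at h; rwa [← h]
  | succ d ih =>
    rw [iter_succ, graft_of_notMem ⟨y, hy⟩] at h
    cases hg : g (some ⟨y, hy⟩) with
    | none => rw [hg] at h; cases h
    | some w => rw [hg] at h; exact ih w.2 h

lemma notMem_of_iter_graft_root (hr : t r = none) {d : ℕ} {c : α}
    (h : iter (graft t g) (d + 1) r = some c) : c ∉ S := by
  rw [iter_succ, graft_of_none hr] at h
  cases hg : g none with
  | none => rw [hg] at h; cases h
  | some w => rw [hg] at h; exact notMem_of_iter_graft w.2 h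

lemma descendants_graft {k : ℕ} (ht : IsTreeAt k t r) : descendants (graft t g) r = S := by
  ext y
  constructor
  · rintro ⟨d, hd⟩
    by_contra hy
    exact notMem_of_iter_graft hy hd r.2
  · intro hy
    obtain ⟨d, -, hd⟩ := ht.2 ⟨y, hy⟩
    exact ⟨d, iter_graft_of_iter hd⟩

/-- An orbit from S is at the root after some d < k steps, and from the next step on it is undefined
or outside S. An orbit starting outside never enters S. -/
lemma iter_graft_ne_root {k : ℕ} (ht : IsTreeAt k t r) (y : α) :
    iter (graft t g) k y ≠ some (r : α) := by
  intro h
  by_cases hy : y ∈ S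
  · obtain ⟨d, hdk, hd⟩ := ht.2 ⟨y, hy⟩
    have h1 : iter (graft t g) d y = some (r : α) := iter_graft_of_iter hd
    obtain ⟨e, rfl⟩ := Nat.exists_eq_add_of_lt hdk
    rw [show d + e + 1 = (e + 1) + d by ring, iter_add, h1] at h
    exact notMem_of_iter_graft_root ((ht.1 r).2 rfl) h r.2
  · exact notMem_of_iter_graft hy h r.2

lemma ncard_fiber_graft_mem (s : S) :
    {y | graft t g y = some (s : α)}.ncard = {y | t y = some s}.ncard := by
  rw [← Set.ncard_image_of_injective _ Subtype.val_injective]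
  congr 1
  ext y
  constructor
  · intro h
    by_cases hy : y ∈ S
    · refine ⟨⟨y, hy⟩, ?_, rfl⟩
      cases ht : t ⟨y, hy⟩ with
      | none =>
        have h1 : graft t g y = _ := graft_of_none ht
        rw [Set.mem_ofPred_eq, h1] at h
        obtain ⟨w, -, hw⟩ := Option.map_eq_some_iff.1 h
        exact absurd s.2 (hw ▸ w.2)
      | some c =>
        have h1 : graft t g y = _ := graft_of_some ht
        rw [Set.mem_ofPred_eq, h1, Option.some.injEq] at h
        rw [Set.mem_ofPred_eq, ht, Subtype.ext h]
    · rw [Set.mem_ofPred_eq, graft_of_notMem ⟨y, hy⟩] at h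
      obtain ⟨w, -, hw⟩ := Option.map_eq_some_iff.1 h
      exact absurd s.2 (hw ▸ w.2)
  · rintro ⟨w, hw, rfl⟩
    exact graft_of_some hw

/-- The points outside `S` together with the root of `S`. -/
def rootOr (r : S) (o : Option ↥Sᶜ) : α := o.elim r (↑)

lemma rootOr_injective (r : S) : Function.Injective (rootOr r) := by
  rintro (_ | a) (_ | b) h
  · rfl
  · exact absurd r.2 ((show (r : α) = b from h).symm ▸ b.2)
  · exact absurd r.2 ((show (a : α) = r from h) ▸ a.2)
  · exact congrArg some (Subtype.ext h)

lemma graft_rootOr (hr : t r = none) (o : Option ↥Sᶜ) : graft t g (rootOr r o) = (g o).map (↑) := by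
  cases o with
  | none => exact graft_of_none hr
  | some y => exact graft_of_notMem y

/-- The root is the only point of S not sent into S, and it plays the argument `none` of `g`. As a
value of `g`, `none` means undefined. -/
lemma ncard_fiber_graft_notMem (hr : ∀ s, t s = none ↔ s = r) (o' : Option ↥Sᶜ) :
    {y | graft t g y = o'.map (↑)}.ncard = {o | g o = o'}.ncard := by
  rw [← Set.ncard_image_of_injective _ (rootOr_injective r)]
  congr 1
  have hinj := Option.map_injective (Subtype.val_injective (p := fun a => a ∈ Sᶜ))
  ext y
  constructor
  · intro h
    have hy : ∃ o, rootOr r o = y := by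
      by_cases hy : y ∈ S
      · cases ht : t ⟨y, hy⟩ with
        | none => exact ⟨none, by rw [← (hr _).1 ht]; rfl⟩
        | some c =>
          have h1 : graft t g y = _ := graft_of_some ht
          rw [Set.mem_ofPred_eq, h1] at h
          obtain ⟨w, -, hw⟩ := Option.map_eq_some_iff.1 h.symm
          exact absurd c.2 (hw ▸ w.2)
      · exact ⟨some ⟨y, hy⟩, rfl⟩
    obtain ⟨o, rfl⟩ := hy
    rw [Set.mem_ofPred_eq, graft_rootOr ((hr r).2 rfl)] at h
    exact ⟨o, hinj h, rfl⟩
  · rintro ⟨o, ho, rfl⟩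
    rw [Set.mem_ofPred_eq, graft_rootOr ((hr r).2 rfl), show g o = o' from ho]

end Graft

end

end PreimageConstraint

/-! ### Nodes outside the k-th image. -/

namespace PreimageConstraint

noncomputable section

section Graft

variable {α : Type} {S : Set α} {t t' : S → Option S} {g g' : Option ↥Sᶜ → Option ↥Sᶜ} {r : S}

lemma fiber_graft_iff (hr : ∀ s, t s = none ↔ s = r) (R P : Set ℕ) :
    (∀ o, {y | graft t g y = o}.ncard ∈ optionConstraint R P o) ↔
      (∀ s, {y | t y = some s}.ncard ∈ P) ∧
        ∀ o, {y | g y = o}.ncard ∈ optionConstraint R P o := by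
  constructor
  · refine fun h => ⟨fun s => ?_, fun o => ?_⟩
    · rw [← ncard_fiber_graft_mem (g := g)]
      exact h (some s)
    · rw [← ncard_fiber_graft_notMem hr]
      have := h (o.map (↑))
      cases o <;> exact this
  · rintro ⟨h1, h2⟩ (_ | y)
    · have := h2 none
      rwa [← ncard_fiber_graft_notMem hr] at this
    · by_cases hy : y ∈ S
      · have := h1 ⟨y, hy⟩
        rwa [← ncard_fiber_graft_mem (g := g)] at this
      · have := h2 (some ⟨y, hy⟩)
        rwa [← ncard_fiber_graft_notMem hr] at this

lemma graft_injective (hr : ∀ s, t s = none ↔ s = r) (hr' : ∀ s, t' s = none ↔ s = r)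
    (h : graft t g = graft t' g') : t = t' ∧ g = g' := by
  constructor
  · funext s
    have hs := congrFun h s
    by_cases hsr : s = r
    · rw [(hr s).2 hsr, (hr' s).2 hsr]
    · obtain ⟨c, hc⟩ := Option.ne_none_iff_exists'.1 (mt (hr s).1 hsr)
      obtain ⟨c', hc'⟩ := Option.ne_none_iff_exists'.1 (mt (hr' s).1 hsr)
      rw [graft_of_some hc, graft_of_some hc', Option.some.injEq] at hs
      rw [hc, hc', Subtype.ext hs]
  · funext o
    have ho := congrFun h (rootOr r o)
    rw [graft_rootOr ((hr r).2 rfl), graft_rootOr ((hr' r).2 rfl)] at ho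
    exact Option.map_injective Subtype.val_injective ho

lemma iter_mul_of_iter {f : α → Option α} {x : α} {d : ℕ} (h : iter f d x = some x) (m : ℕ) :
    iter f (m * d) x = some x := by
  induction m with
  | zero => rw [zero_mul, iter_zero]
  | succ m ih => rw [Nat.succ_mul, iter_add, h]; exact ih

/-- A node outside the `k`-th image is the root of a tree of height less than `k`. -/
lemma exists_graft_eq {k : ℕ} {f : α → Option α} {x : α} (hS : descendants f x = S)
    (hx : ∀ y, iter f k y ≠ some x) :
    ∃ (t : S → Option S) (g : Option ↥Sᶜ → Option ↥Sᶜ) (r : S),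
      (r : α) = x ∧ IsTreeAt k t r ∧ graft t g = f := by
  have hmem : ∀ y, y ∈ S ↔ ∃ d, iter f d y = some x := fun y => by rw [← hS]; rfl
  have hxS : x ∈ S := (hmem x).2 ⟨0, rfl⟩
  -- A cyclic node lies in every image: x would return to itself after k (d + 1) = k + k d steps,
  -- and the last k of them put x in the k-th image.
  have hcyc : ∀ d, iter f (d + 1) x ≠ some x := fun d hd => by
    have h1 := iter_mul_of_iter hd k
    rw [show k * (d + 1) = k + k * d by ring, iter_add] at h1
    obtain ⟨y, -, hy⟩ := Option.bind_eq_some_iff.1 h1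
    exact hx y hy
  have hstep : ∀ y : S, (y : α) ≠ x → ∃ c : S, f y = some (c : α) := fun y hy => by
    obtain ⟨d, hd⟩ := (hmem y).1 y.2
    cases d with
    | zero => exact absurd (Option.some.inj hd) hy
    | succ d =>
      rw [iter_succ] at hd
      obtain ⟨c, hc, hcd⟩ := Option.bind_eq_some_iff.1 hd
      exact ⟨⟨c, (hmem c).2 ⟨d, hcd⟩⟩, hc⟩
  have hout : ∀ o : Option ↥Sᶜ, ∃ o' : Option ↥Sᶜ, f (rootOr ⟨x, hxS⟩ o) = o'.map (↑) := by
    intro o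
    cases hf : f (rootOr ⟨x, hxS⟩ o) with
    | none => exact ⟨none, rfl⟩
    | some c =>
      refine ⟨some ⟨c, fun hc => ?_⟩, rfl⟩
      obtain ⟨d, hd⟩ := (hmem c).1 hc
      have h1 : iter f (d + 1) (rootOr ⟨x, hxS⟩ o) = some x := by
        rw [iter_succ, hf]; exact hd
      cases o with
      | none => exact hcyc d h1
      | some y => exact y.2 ((hmem y).2 ⟨d + 1, h1⟩)
  classical
  choose c hc using hstep
  choose g hg using hout
  set t : S → Option S := fun y => if h : (y : α) = x then none else some (c y h) with ht
  have htr : ∀ s, t s = none ↔ s = ⟨x, hxS⟩ := fun s => by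
    by_cases h : (s : α) = x
    · simp [ht, h, Subtype.ext_iff]
    · simp [ht, h, Subtype.ext_iff]
  have hiter : ∀ (d : ℕ) (y : S), iter f d y = some x → ∃ d' ≤ d, iter t d' y = some ⟨x, hxS⟩ := by
    intro d
    induction d with
    | zero =>
      intro y hy
      have hyx : y = ⟨x, hxS⟩ := Subtype.ext (Option.some.inj hy)
      exact ⟨0, le_rfl, by rw [iter_zero, hyx]⟩
    | succ d ih =>
      intro y hy
      by_cases h : (y : α) = x
      · exact ⟨0, Nat.zero_le _, by rw [iter_zero]; exact congrArg some (Subtype.ext h)⟩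
      · rw [iter_succ, hc y h] at hy
        obtain ⟨d', hd', he⟩ := ih (c y h) hy
        refine ⟨d' + 1, Nat.succ_le_succ hd', ?_⟩
        have : t y = some (c y h) := dif_neg h
        rw [iter_succ, this]
        exact he
  refine ⟨t, g, ⟨x, hxS⟩, rfl, ⟨htr, fun y => ?_⟩, ?_⟩
  · obtain ⟨d, hd⟩ := (hmem y).1 y.2
    have hdk : d < k := by
      by_contra hle
      obtain ⟨e, rfl⟩ := Nat.exists_eq_add_of_le (not_lt.1 hle)
      rw [iter_add] at hd
      obtain ⟨w, -, hw⟩ := Option.bind_eq_some_iff.1 hd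
      exact hx w hw
    obtain ⟨d', hd', he⟩ := hiter d y hd
    exact ⟨d', hd'.trans_lt hdk, he⟩
  · funext y
    by_cases hy : y ∈ S
    · by_cases h : y = x
      · have h1 : t ⟨y, hy⟩ = none := dif_pos h
        have h2 : graft t g y = _ := graft_of_none h1
        rw [h2, ← hg none]
        simp [rootOr, h]
      · have h1 : t ⟨y, hy⟩ = some (c ⟨y, hy⟩ h) := dif_neg h
        have h2 : graft t g y = _ := graft_of_some h1
        rw [h2, ← hc ⟨y, hy⟩ h]
    · rw [graft_of_notMem ⟨y, hy⟩, ← hg (some ⟨y, hy⟩)]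
      rfl

end Graft

/-- Pairs of a constrained partial map and a node outside its `k`-th image with given set of
descendants correspond to pairs of a tree and a partial map of the remaining nodes. -/
theorem card_missed_of_descendants {α : Type} [Finite α] (k : ℕ) (R P : Set ℕ) (S : Set α) :
    Nat.card {p : (α → Option α) × α //
      ((∀ o, {y | p.1 y = o}.ncard ∈ optionConstraint R P o) ∧ ∀ y, iter p.1 k y ≠ some p.2) ∧
        descendants p.1 p.2 = S} =
      treeCount k P S * fiberCount (Option ↥Sᶜ) (Option ↥Sᶜ) (optionConstraint R P) := by
  rw [treeCount, fiberCount, ← Nat.card_prod]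
  refine (Nat.card_congr (Equiv.ofBijective (fun q =>
    ⟨(graft q.1.1.1 q.2.1, (q.1.1.2 : α)), ⟨(fiber_graft_iff q.1.2.1.1 R P).2 ⟨q.1.2.2, q.2.2⟩,
      iter_graft_ne_root q.1.2.1⟩, descendants_graft q.1.2.1⟩) ⟨?_, ?_⟩)).symm
  · rintro ⟨⟨⟨t, r⟩, ht, htP⟩, g, hg⟩ ⟨⟨⟨t', r'⟩, ht', htP'⟩, g', hg'⟩ h
    have h1 := congrArg (fun p => p.1.1) h
    have h2 := congrArg (fun p => p.1.2) h
    obtain rfl : r = r' := Subtype.ext h2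
    obtain ⟨rfl, rfl⟩ := graft_injective ht.1 ht'.1 h1
    rfl
  · rintro ⟨⟨f, x⟩, ⟨hf, hx⟩, hS⟩
    obtain ⟨t, g, r, rfl, ht, rfl⟩ := exists_graft_eq hS hx
    obtain ⟨h1, h2⟩ := (fiber_graft_iff ht.1 R P).1 hf
    exact ⟨⟨⟨(t, r), ht, h1⟩, g, h2⟩, rfl⟩

open PowerSeries in
/-- The number of pairs of a constrained partial map and a node outside its `k`-th image. -/
theorem card_missed (k n : ℕ) (R P : Set ℕ) :
    (Nat.card {p : (Fin n → Option (Fin n)) × Fin n //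
      (∀ o, {y | p.1 y = o}.ncard ∈ optionConstraint R P o) ∧ ∀ y, iter p.1 k y ≠ some p.2} : ℂ) =
      n.factorial * ∑ s ∈ Finset.range (n + 1), (treeCount k P (Fin s) : ℂ) / s.factorial *
        (((n - s : ℕ) + 1 : ℂ) *
          coeff (n - s + 1) (expSeries R * expSeries P ^ (n - s))) := by
  classical
  set A := {p : (Fin n → Option (Fin n)) × Fin n //
      (∀ o, {y | p.1 y = o}.ncard ∈ optionConstraint R P o) ∧ ∀ y, iter p.1 k y ≠ some p.2}
  -- Sum over the set S of descendants; only s = |S| matters. The remaining map has n - s + 1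
  -- arguments, so its (n - s + 1)! against the (n - s)! of the binomial coefficient leaves the
  -- factor n - s + 1.
  have h1 : Nat.card A = ∑ S : Finset (Fin n), treeCount k P (Fin S.card) *
      fiberCount (Option (Fin (n - S.card))) (Option (Fin (n - S.card)))
        (optionConstraint R P) := by
    have e : A ≃ Σ S : Finset (Fin n), {p : A // (descendants p.1.1 p.1.2).toFinset = S} :=
      (Equiv.sigmaFiberEquiv fun p : A => (descendants p.1.1 p.1.2).toFinset).symm
    rw [Nat.card_congr e, Nat.card_sigma]
    refine Finset.sum_congr rfl fun S _ => ?_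
    have h2 : Nat.card {p : A // (descendants p.1.1 p.1.2).toFinset = S} =
        Nat.card {p : (Fin n → Option (Fin n)) × Fin n //
          ((∀ o, {y | p.1 y = o}.ncard ∈ optionConstraint R P o) ∧
            ∀ y, iter p.1 k y ≠ some p.2) ∧ descendants p.1 p.2 = (S : Set (Fin n))} := by
      refine Nat.card_congr ((Equiv.subtypeSubtypeEquivSubtypeInter _
        fun p : (Fin n → Option (Fin n)) × Fin n =>
          (descendants p.1 p.2).toFinset = S).trans (Equiv.subtypeEquivRight fun p => ?_))
      rw [← Finset.coe_inj, Set.coe_toFinset]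
    rw [h2, card_missed_of_descendants]
    have eS : ↥(S : Set (Fin n)) ≃ Fin S.card := Fintype.equivFinOfCardEq (by simp)
    have eC : ↥(S : Set (Fin n))ᶜ ≃ Fin (n - S.card) := Fintype.equivFinOfCardEq (by
      rw [Fintype.card_compl_set]; simp)
    rw [treeCount_congr k P eS, fiberCount_congr eC.optionCongr]
    congr 1
    have hcast : ((fiberCount (Option (Fin (n - S.card))) (Option ↥(S : Set (Fin n))ᶜ)
        (optionConstraint R P) : ℕ) : ℂ) = (fiberCount (Option (Fin (n - S.card)))
          (Option (Fin (n - S.card))) (optionConstraint R P) : ℕ) := by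
      rw [fiberCount_option, fiberCount_option, Fintype.card_congr eC]
    exact_mod_cast hcast
  rw [h1, ← Finset.powerset_univ, Finset.sum_powerset_apply_card (fun s => treeCount k P (Fin s) *
    fiberCount (Option (Fin (n - s))) (Option (Fin (n - s))) (optionConstraint R P)),
    Finset.card_univ, Fintype.card_fin]
  push_cast
  rw [Finset.mul_sum]
  refine Finset.sum_congr rfl fun s hs => ?_
  have hsn : s ≤ n := Nat.lt_succ_iff.1 (Finset.mem_range.1 hs)
  rw [smul_eq_mul, Nat.cast_mul, Nat.cast_mul, fiberCount_option, Fintype.card_option, Fintype.card_fin,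
    Nat.cast_choose ℂ hsn, Nat.factorial_succ]
  push_cast
  have h3 : (s.factorial : ℂ) ≠ 0 := Nat.cast_ne_zero.2 s.factorial_ne_zero
  have h4 : ((n - s).factorial : ℂ) ≠ 0 := Nat.cast_ne_zero.2 (n - s).factorial_ne_zero
  field_simp

end

end PreimageConstraint

/-! ### Nodes on cycles. -/

namespace PreimageConstraint

noncomputable section

section Cycle

variable {α : Type} {m : ℕ}

lemma iterate_cycle {f : α → α} {c : Fin (m + 1) ↪ α} (h : ∀ i, f (c i) = c (i + 1)) (j : ℕ) :
    f^[j] (c 0) = c (Fin.ofNat (m + 1) j) := by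
  induction j with
  | zero => rfl
  | succ j ih =>
    rw [Function.iterate_succ_apply', ih, h]
    congr 1
    ext
    simp [Fin.val_add]

lemma minimalPeriod_cycle {f : α → α} {c : Fin (m + 1) ↪ α} (h : ∀ i, f (c i) = c (i + 1)) :
    Function.minimalPeriod f (c 0) = m + 1 := by
  have key : ∀ j, Function.IsPeriodicPt f j (c 0) ↔ m + 1 ∣ j := fun j => by
    rw [Function.IsPeriodicPt, Function.IsFixedPt, iterate_cycle h, c.injective.eq_iff,
      Fin.ext_iff, Fin.val_ofNat, Fin.val_zero, Nat.dvd_iff_mod_eq_zero]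
  exact Nat.dvd_antisymm (Function.isPeriodicPt_iff_minimalPeriod_dvd.1 ((key _).2 dvd_rfl))
    ((key _).1 (Function.isPeriodicPt_minimalPeriod f _))

lemma exists_cycle {f : α → α} {x : α} (h : Function.minimalPeriod f x = m + 1) :
    ∃ c : Fin (m + 1) ↪ α, (∀ i, f (c i) = c (i + 1)) ∧ c 0 = x := by
  refine ⟨⟨fun i => f^[i] x, fun i j hij => ?_⟩, fun i => ?_, rfl⟩
  · exact Fin.ext ((Function.iterate_eq_iterate_iff_of_lt_minimalPeriod (by rw [h]; exact i.2)
      (by rw [h]; exact j.2)).1 hij)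
  · change f (f^[i] x) = f^[(i + 1 : Fin (m + 1))] x
    rw [← Function.iterate_succ_apply' f, ← Function.iterate_mod_minimalPeriod_eq (n := i + 1), h]
    rw [Fin.val_add, Fin.val_one', Nat.add_mod_mod]

/-- A node of period m + 1 is the base point of exactly one parametrized cycle, so there is no
rotational symmetry to divide out. -/
lemma card_periodic_eq (P : Set ℕ) :
    Nat.card {p : (α → α) × α // (∀ x, {y | p.1 y = x}.ncard ∈ P) ∧
        Function.minimalPeriod p.1 p.2 = m + 1} =
      Nat.card (Σ c : Fin (m + 1) ↪ α, {f : α → α // (∀ x, {y | f y = x}.ncard ∈ P) ∧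
        ∀ i, f (c i) = c (i + 1)}) := by
  refine (Nat.card_congr (Equiv.ofBijective
    (fun q => ⟨(q.2.1, q.1 0), q.2.2.1, minimalPeriod_cycle q.2.2.2⟩) ⟨?_, ?_⟩)).symm
  · rintro ⟨c, f, hf, hc⟩ ⟨c', f', hf', hc'⟩ h
    obtain rfl : f = f' := congrArg (fun p => p.1.1) h
    have h2 : c 0 = c' 0 := congrArg (fun p => p.1.2) h
    obtain rfl : c = c' := by
      ext i
      have h3 := iterate_cycle hc i
      have h4 := iterate_cycle hc' i
      rw [Fin.ofNat_val_eq_self] at h3 h4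
      rw [← h3, ← h4, h2]
    rfl
  · rintro ⟨⟨f, x⟩, hf, hx⟩
    obtain ⟨c, hc, rfl⟩ := exists_cycle hx
    exact ⟨⟨c, f, hf, hc⟩, rfl⟩

-- A point of the cycle has exactly one preimage on the cycle, its predecessor; a point off the
-- cycle has none there.
open Classical in
lemma ncard_fiber_of_cycle [Finite α] {f : α → α} {c : Fin (m + 1) ↪ α}
    (h : ∀ i, f (c i) = c (i + 1)) (x : α) :
    {y | f y = x}.ncard = {y : ↥(range c)ᶜ | f y = x}.ncard + if x ∈ range c then 1 else 0 := by
  have hunion : {y | f y = x} =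
      Subtype.val '' {y : ↥(range c)ᶜ | f y = x} ∪ {y | y ∈ range c ∧ f y = x} := by
    ext y
    constructor
    · intro hy
      by_cases hc : y ∈ range c
      · exact Or.inr ⟨hc, hy⟩
      · exact Or.inl ⟨⟨y, hc⟩, hy, rfl⟩
    · rintro (⟨w, hw, rfl⟩ | ⟨-, hy⟩)
      · exact hw
      · exact hy
  have hdisj : Disjoint (Subtype.val '' {y : ↥(range c)ᶜ | f y = x})
      {y | y ∈ range c ∧ f y = x} := by
    rw [Set.disjoint_left]
    rintro _ ⟨w, -, rfl⟩ ⟨hw, -⟩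
    exact w.2 hw
  rw [hunion, Set.ncard_union_eq hdisj, Set.ncard_image_of_injective _ Subtype.val_injective]
  congr 1
  split_ifs with hx
  · obtain ⟨j, rfl⟩ := hx
    rw [Set.ncard_eq_one]
    refine ⟨c (j - 1), ?_⟩
    ext y
    constructor
    · rintro ⟨⟨i, rfl⟩, hi⟩
      rw [h, c.injective.eq_iff] at hi
      rw [← hi, add_sub_cancel_right]
      rfl
    · rintro rfl
      exact ⟨⟨_, rfl⟩, by rw [h, sub_add_cancel]⟩
  · rw [Set.ncard_eq_zero]
    ext y
    simp only [Set.mem_ofPred_eq, Set.mem_empty_iff_false, iff_false, not_and]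
    rintro ⟨i, rfl⟩ hi
    exact hx ⟨i + 1, by rw [← h, hi]⟩

open Classical in
lemma card_of_cycle [Finite α] (P : Set ℕ) (c : Fin (m + 1) ↪ α) :
    Nat.card {f : α → α // (∀ x, {y | f y = x}.ncard ∈ P) ∧ ∀ i, f (c i) = c (i + 1)} =
      fiberCount ↥(range c)ᶜ α (fun x => if x ∈ range c then shift P 1 else P) := by
  have hiff : ∀ f : α → α, (∀ i, f (c i) = c (i + 1)) → ((∀ x, {y | f y = x}.ncard ∈ P) ↔
      ∀ x, {y : ↥(range c)ᶜ | f y = x}.ncard ∈ if x ∈ range c then shift P 1 else P) :=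
    fun f hf => forall_congr' fun x => by
      rw [ncard_fiber_of_cycle hf]
      split_ifs with hx
      · rfl
      · rw [add_zero]
  refine Nat.card_congr (Equiv.ofBijective
    (fun f => ⟨fun y : ↥(range c)ᶜ => f.1 y, (hiff f.1 f.2.2).1 f.2.1⟩) ⟨?_, ?_⟩)
  · rintro ⟨f, hf, hc⟩ ⟨f', hf', hc'⟩ h
    refine Subtype.ext (funext fun y => ?_)
    by_cases hy : y ∈ range c
    · obtain ⟨i, rfl⟩ := hy
      exact (hc i).trans (hc' i).symm
    · exact congrFun (congrArg Subtype.val h) ⟨y, hy⟩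
  · rintro ⟨g, hg⟩
    set f : α → α := fun y => if h : y ∈ range c then c (h.choose + 1) else g ⟨y, h⟩ with hf
    have h1 : ∀ i, f (c i) = c (i + 1) := fun i => by
      have hi : c i ∈ range c := ⟨i, rfl⟩
      simp only [hf, dif_pos hi]
      rw [c.injective hi.choose_spec]
    have h2 : ∀ y : ↥(range c)ᶜ, f y = g y := fun y => dif_neg y.2
    refine ⟨⟨f, (hiff f h1).2 ?_, h1⟩, Subtype.ext (funext h2)⟩
    simpa only [h2] using hg

end Cycle

open PowerSeries in
/-- The number of pairs of a constrained function and one of its cyclic nodes. -/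
theorem card_cyclic (n : ℕ) (P : Set ℕ) :
    (Nat.card {p : (Fin n → Fin n) × Fin n //
      (∀ x, {y | p.1 y = x}.ncard ∈ P) ∧ p.2 ∈ Function.periodicPts p.1} : ℂ) =
      ∑ m ∈ Finset.range n, n.factorial *
        coeff (n - (m + 1)) (expSeries (shift P 1) ^ (m + 1) * expSeries P ^ (n - (m + 1))) := by
  classical
  set A := {p : (Fin n → Fin n) × Fin n //
      (∀ x, {y | p.1 y = x}.ncard ∈ P) ∧ p.2 ∈ Function.periodicPts p.1}
  have hlt : ∀ p : A, Function.minimalPeriod p.1.1 p.1.2 - 1 < n := fun p => by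
    have h1 := Function.minimalPeriod_pos_of_mem_periodicPts p.2.2
    have h2 := Function.minimalPeriod_le_card (f := p.1.1) (x := p.1.2)
    rw [Fintype.card_fin] at h2
    omega
  rw [Nat.card_congr (Equiv.sigmaFiberEquiv fun p : A => (⟨_, hlt p⟩ : Fin n)).symm,
    Nat.card_sigma, Nat.cast_sum, ← Fin.sum_univ_eq_sum_range (fun m => (n.factorial : ℂ) *
      coeff (n - (m + 1)) (expSeries (shift P 1) ^ (m + 1) * expSeries P ^ (n - (m + 1))))]
  refine Finset.sum_congr rfl fun m _ => ?_
  have hm : (m : ℕ) + 1 ≤ n := m.2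
  have h1 : Nat.card {p : A // (⟨_, hlt p⟩ : Fin n) = m} =
      Nat.card {p : (Fin n → Fin n) × Fin n // (∀ x, {y | p.1 y = x}.ncard ∈ P) ∧
        Function.minimalPeriod p.1 p.2 = m + 1} := by
    refine Nat.card_congr (Equiv.ofBijective (fun p => ⟨p.1.1, p.1.2.1, ?_⟩) ⟨?_, ?_⟩)
    · have h2 := Function.minimalPeriod_pos_of_mem_periodicPts p.1.2.2
      have h3 := congrArg Fin.val p.2
      simp only at h3
      omega
    · intro p q hpq
      have h4 := congrArg Subtype.val hpq
      exact Subtype.ext (Subtype.ext h4)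
    · rintro ⟨p, hp, hmin⟩
      exact ⟨⟨⟨p, hp, Function.minimalPeriod_pos_iff_mem_periodicPts.1 (by omega)⟩,
        Fin.ext (by simp [hmin])⟩, rfl⟩
  have h2 : ∀ c : Fin (m + 1) ↪ Fin n,
      (Nat.card {f : Fin n → Fin n // (∀ x, {y | f y = x}.ncard ∈ P) ∧
        ∀ i, f (c i) = c (i + 1)} : ℂ) =
      (n - (m + 1)).factorial * coeff (n - (m + 1))
        (expSeries (shift P 1) ^ ((m : ℕ) + 1) * expSeries P ^ (n - (m + 1))) := fun c => by
    have hr : (range c).toFinset.card = m + 1 := by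
      rw [Set.toFinset_card, Set.card_range_of_injective c.injective, Fintype.card_fin]
    have hc : Fintype.card ↥(range c)ᶜ = n - (m + 1) := by
      rw [Fintype.card_compl_set, Fintype.card_fin, ← Set.toFinset_card, hr]
    rw [card_of_cycle, fiberCount_eq, hc]
    congr 2
    refine (Finset.prod_congr rfl fun x _ => (?_ : _ = if x ∈ (range c).toFinset then
      expSeries (shift P 1) else expSeries P)).trans ?_
    · by_cases hx : x ∈ range c
      · rw [if_pos hx, if_pos (Set.mem_toFinset.2 hx)]
      · rw [if_neg hx, if_neg (mt Set.mem_toFinset.1 hx)]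
    rw [Finset.prod_ite, Finset.prod_const, Finset.prod_const, Finset.filter_mem_eq_inter,
      Finset.univ_inter, hr, Finset.filter_not, Finset.filter_mem_eq_inter, Finset.univ_inter,
      ← Finset.compl_eq_univ_sdiff, Finset.card_compl, hr, Fintype.card_fin]
  -- There are n (n - 1) ⋯ (n - m) parametrized cycles; times (n - m - 1)! this is n!.
  rw [h1, card_periodic_eq, Nat.card_sigma, Nat.cast_sum]
  simp only [h2]
  rw [Finset.sum_const, Finset.card_univ, Fintype.card_embedding_eq, Fintype.card_fin,
    Fintype.card_fin, nsmul_eq_mul, ← Nat.factorial_mul_descFactorial hm]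
  push_cast
  ring

end

end PreimageConstraint

/-! ### Trees of bounded height have an entire generating function. -/

namespace PreimageConstraint

noncomputable section

/-- The number of possible parents of a node at level `i`, if there are `m i` nodes at level `i`. -/
def levelWeight (m : ℕ → ℕ) : ℕ → ℕ
  | 0 => 1
  | i + 1 => m i

/-- Each level uses xᵐ ≤ m! eˣ with x = B k · `levelWeight m k`. The recursion for B turns the power
of B k into a power of K times the exponential handed on to the next level, which is why the
statement carries that extra factor. -/
lemma prod_levelWeight_pow_mul_exp_le {K : ℝ} (hK : 0 < K) {B : ℕ → ℝ} (m : ℕ → ℕ) (k : ℕ)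
    (hB : ∀ i < k, B i = K * Real.exp (B (i + 1))) :
    (∏ i ∈ Finset.range k, (levelWeight m i : ℝ) ^ m i) * Real.exp (B k * levelWeight m k) ≤
      Real.exp (B 0) * ∏ i ∈ Finset.range k, ((m i).factorial / K ^ m i : ℝ) := by
  induction k with
  | zero => simp [levelWeight]
  | succ k ih =>
    have hBk := hB k k.lt_succ_self
    have hBpos : 0 < B k := by rw [hBk]; positivity
    rw [Finset.prod_range_succ, Finset.prod_range_succ]
    have hw := Real.pow_div_factorial_le_exp (B k * levelWeight m k) (by positivity) (m k)
    rw [div_le_iff₀ (by positivity), mul_pow] at hw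
    have hBm : B k ^ m k = K ^ m k * Real.exp (B (k + 1) * m k) := by
      rw [hBk, mul_pow, ← Real.exp_nat_mul, mul_comm (B (k + 1))]
    rw [hBm] at hw
    have hstep : (levelWeight m k : ℝ) ^ m k * Real.exp (B (k + 1) * levelWeight m (k + 1)) ≤
        Real.exp (B k * levelWeight m k) * ((m k).factorial / K ^ m k) := by
      rw [← mul_div_assoc, le_div_iff₀ (by positivity)]
      refine le_trans (le_of_eq ?_) hw
      simp only [levelWeight]
      ring
    have ih' := ih fun i hi => hB i (hi.trans k.lt_succ_self)
    calc _ = (∏ i ∈ Finset.range k, (levelWeight m i : ℝ) ^ m i) *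
          ((levelWeight m k : ℝ) ^ m k * Real.exp (B (k + 1) * levelWeight m (k + 1))) := by ring
      _ ≤ (∏ i ∈ Finset.range k, (levelWeight m i : ℝ) ^ m i) *
          (Real.exp (B k * levelWeight m k) * ((m k).factorial / K ^ m k)) := by gcongr
      _ = ((∏ i ∈ Finset.range k, (levelWeight m i : ℝ) ^ m i) *
          Real.exp (B k * levelWeight m k)) * ((m k).factorial / K ^ m k) := by ring
      _ ≤ _ := by rw [← mul_assoc]; gcongr

/-- The constant is the exponential of a k-fold iterate of x ↦ K eˣ, independent of the level sizes.
As K is arbitrary, the bound beats every geometric rate. -/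
lemma exists_prod_levelWeight_le (k : ℕ) {K : ℝ} (hK : 0 < K) :
    ∃ C : ℝ, 0 < C ∧ ∀ m : ℕ → ℕ, ∏ i ∈ Finset.range k, (levelWeight m i : ℝ) ^ m i ≤
      C * ((∑ i ∈ Finset.range k, m i).factorial / K ^ (∑ i ∈ Finset.range k, m i)) := by
  set b : ℕ → ℝ := fun j => (fun x => K * Real.exp x)^[j] 1 with hb
  have hbpos : ∀ j, 0 < b j := fun j => by
    cases j with
    | zero => exact one_pos
    | succ j => rw [hb]; simp only [Function.iterate_succ_apply']; positivity
  have hB : ∀ i < k, b (k - i) = K * Real.exp (b (k - (i + 1))) := fun i hi => by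
    rw [show k - i = (k - (i + 1)) + 1 by omega]
    exact Function.iterate_succ_apply' _ _ _
  refine ⟨Real.exp (b k), Real.exp_pos _, fun m => ?_⟩
  have h := prod_levelWeight_pow_mul_exp_le hK (B := fun i => b (k - i)) m k hB
  have h1 : (1 : ℝ) ≤ Real.exp (b (k - k) * levelWeight m k) :=
    Real.one_le_exp (mul_nonneg (hbpos _).le (Nat.cast_nonneg _))
  have h2 : (∏ i ∈ Finset.range k, ((m i).factorial : ℝ)) ≤
      (∑ i ∈ Finset.range k, m i).factorial := by
    exact_mod_cast Nat.le_of_dvd (Nat.factorial_pos _) (Nat.prod_factorial_dvd_factorial_sum _ _)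
  refine (le_mul_of_one_le_right (by positivity) h1).trans (h.trans ?_)
  rw [Finset.prod_div_distrib, Finset.prod_pow_eq_pow_sum, Nat.sub_zero]
  gcongr

section Levels

variable {n k : ℕ}

lemma exists_level {t : Fin n → Option (Fin n)} {r : Fin n} (ht : IsTreeAt k t r) :
    ∃ l : Fin n → Fin k, ∀ y, (t y = none ∧ (l y : ℕ) = 0) ∨
      ∃ s, t y = some s ∧ (l y : ℕ) = l s + 1 := by
  classical
  have hex : ∀ y, ∃ d, iter t d y = some r := fun y => (ht.2 y).imp fun d hd => hd.2
  have hlt : ∀ y, Nat.find (hex y) < k := fun y => by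
    obtain ⟨d, hd, he⟩ := ht.2 y
    exact (Nat.find_min' (hex y) he).trans_lt hd
  refine ⟨fun y => ⟨Nat.find (hex y), hlt y⟩, fun y => ?_⟩
  cases hy : t y with
  | none =>
    left
    refine ⟨rfl, (Nat.find_eq_zero _).2 ?_⟩
    rw [iter_zero, (ht.1 y).1 hy]
  | some s =>
    right
    refine ⟨s, rfl, ?_⟩
    have hne : iter t 0 y ≠ some r := fun h => by
      rw [iter_zero, Option.some.injEq] at h
      rw [(ht.1 y).2 h] at hy
      cases hy
    have hiff : ∀ d, iter t (d + 1) y = some r ↔ iter t d s = some r := fun d => by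
      rw [iter_succ, hy]; rfl
    refine (Nat.find_eq_iff _).2 ⟨(hiff _).2 (Nat.find_spec (hex s)), fun d hd => ?_⟩
    cases d with
    | zero => exact hne
    | succ d => exact fun h => Nat.find_min (hex s) (Nat.succ_lt_succ_iff.1 hd) ((hiff d).1 h)

open Classical in
/-- The number of parent maps which are compatible with a level function. -/
lemma card_of_level (l : Fin n → Fin k) :
    Nat.card {t : Fin n → Option (Fin n) // ∀ y, (t y = none ∧ (l y : ℕ) = 0) ∨
      ∃ s, t y = some s ∧ (l y : ℕ) = l s + 1} =
      ∏ i ∈ Finset.range k, levelWeight (fun j => (Finset.univ.filter fun x =>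
        (l x : ℕ) = j).card) i ^ (Finset.univ.filter fun x => (l x : ℕ) = i).card := by
  set m : ℕ → ℕ := fun j => (Finset.univ.filter fun x => (l x : ℕ) = j).card with hm
  set A : Fin n → Finset (Option (Fin n)) := fun y => Finset.univ.filter fun o =>
    (o = none ∧ (l y : ℕ) = 0) ∨ ∃ s, o = some s ∧ (l y : ℕ) = l s + 1 with hA
  have hcard : ∀ y, (A y).card = levelWeight m (l y) := fun y => by
    cases hl : (l y : ℕ) with
    | zero =>
      have : A y = {none} := by
        ext o
        simp [hA, hl]
      rw [this, Finset.card_singleton]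
      rfl
    | succ i =>
      have : A y = (Finset.univ.filter fun x => (l x : ℕ) = i).map Function.Embedding.some := by
        ext o
        simp only [hA, hl, Finset.mem_filter, Finset.mem_univ, true_and, Finset.mem_map]
        constructor
        · rintro (⟨-, h⟩ | ⟨s, rfl, h⟩)
          · exact absurd h (Nat.succ_ne_zero i)
          · exact ⟨s, by omega, rfl⟩
        · rintro ⟨s, hs, rfl⟩
          exact Or.inr ⟨s, rfl, by omega⟩
      rw [this, Finset.card_map]
      rfl
  have h1 : Nat.card {t : Fin n → Option (Fin n) // ∀ y, (t y = none ∧ (l y : ℕ) = 0) ∨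
      ∃ s, t y = some s ∧ (l y : ℕ) = l s + 1} = (Fintype.piFinset A).card := by
    rw [Nat.card_eq_fintype_card, Fintype.card_subtype]
    congr 1
    ext t
    simp [hA, Fintype.mem_piFinset]
  rw [h1, Fintype.card_piFinset]
  simp only [hcard]
  rw [← Finset.prod_fiberwise_of_maps_to (g := fun y => (l y : ℕ)) (t := Finset.range k)
    fun y _ => Finset.mem_range.2 (l y).2]
  refine Finset.prod_congr rfl fun i _ => ?_
  rw [Finset.prod_congr rfl (g := fun _ => levelWeight m i) fun y hy => by
    rw [(Finset.mem_filter.1 hy).2], Finset.prod_const]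

/-- A tree is determined by its level function, one of kⁿ, and a compatible parent map, one of at
most C n! / Kⁿ. -/
lemma exists_treeCount_le (k : ℕ) (P : Set ℕ) {K : ℝ} (hK : 0 < K) :
    ∃ C : ℝ, 0 < C ∧ ∀ n, (treeCount k P (Fin n) : ℝ) ≤ C * n.factorial * (k / K) ^ n := by
  classical
  obtain ⟨C, hC, hle⟩ := exists_prod_levelWeight_le k hK
  refine ⟨C, hC, fun n => ?_⟩
  have h1 : treeCount k P (Fin n) ≤ Nat.card (Σ l : Fin n → Fin k,
      {t : Fin n → Option (Fin n) // ∀ y, (t y = none ∧ (l y : ℕ) = 0) ∨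
        ∃ s, t y = some s ∧ (l y : ℕ) = l s + 1}) := by
    refine Nat.card_le_card_of_injective (fun p => ⟨(exists_level p.2.1).choose, p.1.1,
      (exists_level p.2.1).choose_spec⟩) ?_
    rintro ⟨⟨t, r⟩, ht, hP⟩ ⟨⟨t', r'⟩, ht', hP'⟩ h
    have h3 := congrArg (fun q => q.2.1) h
    obtain rfl : t = t' := h3
    obtain rfl : r = r' := (ht'.1 r).1 ((ht.1 r).2 rfl)
    rfl
  have h2 : ∀ l : Fin n → Fin k, (Nat.card {t : Fin n → Option (Fin n) //
      ∀ y, (t y = none ∧ (l y : ℕ) = 0) ∨ ∃ s, t y = some s ∧ (l y : ℕ) = l s + 1} : ℝ) ≤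
      C * (n.factorial / K ^ n) := fun l => by
    have h3 := hle fun j => (Finset.univ.filter fun x => (l x : ℕ) = j).card
    have h4 : ∑ i ∈ Finset.range k, (Finset.univ.filter fun x => (l x : ℕ) = i).card = n := by
      rw [← Finset.card_eq_sum_card_fiberwise (s := Finset.univ) (t := Finset.range k)
        (f := fun x => (l x : ℕ)) fun y _ => Finset.mem_coe.2 (Finset.mem_range.2 (l y).2),
        Finset.card_univ, Fintype.card_fin]
    rw [h4] at h3
    rw [card_of_level]
    exact_mod_cast h3
  calc (treeCount k P (Fin n) : ℝ) ≤ _ := Nat.cast_le.2 h1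
    _ = ∑ l : Fin n → Fin k, (Nat.card {t : Fin n → Option (Fin n) //
      ∀ y, (t y = none ∧ (l y : ℕ) = 0) ∨ ∃ s, t y = some s ∧ (l y : ℕ) = l s + 1} : ℝ) := by
        rw [Nat.card_sigma, Nat.cast_sum]
    _ ≤ ∑ _l : Fin n → Fin k, C * (n.factorial / K ^ n) := Finset.sum_le_sum fun l _ => h2 l
    _ = C * n.factorial * (k / K) ^ n := by
        rw [Finset.sum_const, Finset.card_univ, Fintype.card_fun, Fintype.card_fin,
          Fintype.card_fin, nsmul_eq_mul, div_pow]
        push_cast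
        ring

end Levels

/-- The generating function of trees of bounded height converges everywhere. -/
theorem summable_treeCount (k : ℕ) (P : Set ℕ) {r : ℝ} (hr : 0 ≤ r) :
    Summable fun n : ℕ => (treeCount k P (Fin n) : ℝ) / n.factorial * r ^ n := by
  set K : ℝ := k * r + 1 with hK
  have hK0 : 0 < K := by positivity
  obtain ⟨C, hC, hle⟩ := exists_treeCount_le k P hK0
  have hq : (k : ℝ) / K * r < 1 := by
    rw [div_mul_eq_mul_div, div_lt_one hK0]; linarith
  refine ((summable_geometric_of_lt_one (by positivity) hq).mul_left C).of_nonneg_of_le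
    (fun n => by positivity) fun n => ?_
  rw [mul_pow, ← mul_assoc]
  gcongr
  rw [div_le_iff₀ (by positivity)]
  exact (hle n).trans_eq (by ring)

end

end PreimageConstraint

/-! ### Coefficients of the five generating functions. -/

namespace PreimageConstraint

noncomputable section

open PowerSeries

section Coefficients

variable {A : ℕ → Type} [∀ n, Finite (A n)]

lemma coeff_atOne_bivariateGF (S : ∀ n, A n → Prop) (χ : ∀ n, A n → ℕ) (n : ℕ) :
    coeff n (atOne (bivariateGF A S χ)) = (n.factorial : ℂ)⁻¹ * Nat.card {a : A n // S n a} := by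
  have := Fintype.ofFinite {a : A n // S n a}
  rw [atOne, bivariateGF, coeff_mk, coeff_mk, finsum_eq_sum_of_fintype, Polynomial.eval_mul,
    Polynomial.eval_C, Polynomial.eval_finsetSum]
  simp

lemma coeff_uDerivAtOne_bivariateGF (S : ∀ n, A n → Prop) (q : ∀ n, A n → Fin n → Prop) (n : ℕ) :
    coeff n (uDerivAtOne (bivariateGF A S fun n a => {x | q n a x}.ncard)) =
      (n.factorial : ℂ)⁻¹ * Nat.card {p : A n × Fin n // S n p.1 ∧ q n p.1 p.2} := by
  have := Fintype.ofFinite {a : A n // S n a}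
  have e : {p : A n × Fin n // S n p.1 ∧ q n p.1 p.2} ≃
      Σ a : {a : A n // S n a}, {x : Fin n | q n a x} :=
    { toFun := fun p => ⟨⟨p.1.1, p.2.1⟩, p.1.2, p.2.2⟩
      invFun := fun p => ⟨(p.1.1, p.2.1), p.1.2, p.2.2⟩
      left_inv := fun _ => rfl
      right_inv := fun _ => rfl }
  rw [Nat.card_congr e, Nat.card_sigma, uDerivAtOne, bivariateGF, coeff_mk, coeff_mk,
    finsum_eq_sum_of_fintype, Polynomial.derivative_C_mul, Polynomial.eval_mul,
    Polynomial.eval_C, Polynomial.derivative_sum, Polynomial.eval_finsetSum]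
  simp [Polynomial.derivative_X_pow, Nat.card_coe_set_eq]

end Coefficients

lemma factorial_inv_mul_cancel (n : ℕ) (a : ℂ) :
    (n.factorial : ℂ)⁻¹ * (n.factorial * a) = a :=
  inv_mul_cancel_left₀ (Nat.cast_ne_zero.2 n.factorial_ne_zero) a

/-- The factor `expSeries {0}` = 1 is kept so that functions become the case R = {0} of partial
maps: no point is without image. -/
lemma coeff_F (P : Set ℕ) (n : ℕ) : coeff n (F P) = coeff n (expSeries {0} * expSeries P ^ n) := by
  have h : Nat.card {f : Fin n → Fin n // FunConstraint P f} =
    fiberCount (Fin n) (Fin n) fun _ => P := rfl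
  rw [F, funGF, coeff_atOne_bivariateGF, h, fiberCount_fin, factorial_inv_mul_cancel,
    expSeries_singleton_zero, one_mul, Finset.prod_const, Finset.card_univ, Fintype.card_fin]

lemma partialConstraint_iff (P : Set ℕ) {n : ℕ} (f : Fin n → Option (Fin n)) :
    PartialConstraint P f ↔ ∀ o, {y | f y = o}.ncard ∈ optionConstraint univ P o :=
  ⟨fun h o => by cases o with
    | none => exact mem_univ _
    | some x => exact h x, fun h x => h (some x)⟩

lemma coeff_Par (P : Set ℕ) (n : ℕ) :
    coeff n (Par P) = coeff n (expSeries univ * expSeries P ^ n) := by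
  have h : Nat.card {f : Fin n → Option (Fin n) // PartialConstraint P f} =
      fiberCount (Fin n) (Option (Fin n)) (optionConstraint univ P) :=
    Nat.card_congr (Equiv.subtypeEquivRight fun f => partialConstraint_iff P f)
  rw [Par, partialGF, coeff_atOne_bivariateGF, h, fiberCount_option, Fintype.card_fin,
    factorial_inv_mul_cancel]

/-- The coefficients of the generating function of pairs of a partial map and a node outside the
`k`-th image. -/
def missedCoeff (k : ℕ) (R P : Set ℕ) (n : ℕ) : ℂ :=
  ∑ s ∈ Finset.range (n + 1), (treeCount k P (Fin s) : ℂ) / s.factorial *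
    (((n - s : ℕ) + 1 : ℂ) * coeff (n - s + 1) (expSeries R * expSeries P ^ (n - s)))

lemma coeff_XiPartial (k : ℕ) (P : Set ℕ) (n : ℕ) :
    coeff n (XiPartial k P) = missedCoeff k univ P n := by
  have h := coeff_uDerivAtOne_bivariateGF (A := fun n => Fin n → Option (Fin n))
    (fun _ f => PartialConstraint P f) (fun _ f x => ∀ y, partialIter f k y ≠ some x) n
  have h1 : Nat.card {p : (Fin n → Option (Fin n)) × Fin n // PartialConstraint P p.1 ∧
      ∀ y, partialIter p.1 k y ≠ some p.2} = Nat.card {p : (Fin n → Option (Fin n)) × Fin n //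
      (∀ o, {y | p.1 y = o}.ncard ∈ optionConstraint univ P o) ∧
        ∀ y, iter p.1 k y ≠ some p.2} :=
    Nat.card_congr (Equiv.subtypeEquivRight fun p =>
      and_congr_left' (partialConstraint_iff P p.1))
  rw [h1, card_missed, factorial_inv_mul_cancel] at h
  exact h

lemma iter_some_comp {α : Type} (f : α → α) (k : ℕ) (x : α) :
    iter (fun y => some (f y)) k x = some (f^[k] x) := by
  induction k generalizing x with
  | zero => rfl
  | succ k ih => rw [iter_succ, Option.bind_some, ih, Function.iterate_succ_apply]

lemma ncard_fiber_some_comp_mem_iff {n : ℕ} (P : Set ℕ) (f : Fin n → Fin n) :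
    (∀ o, {y | some (f y) = o}.ncard ∈ optionConstraint {0} P o) ↔ FunConstraint P f := by
  constructor
  · intro h x
    have := h (some x)
    simp only [Option.some.injEq] at this
    exact this
  · rintro h (_ | x)
    · simp [optionConstraint]
    · show {y | some (f y) = some x}.ncard ∈ P
      simp only [Option.some.injEq]
      exact h x

lemma coeff_Xi (k : ℕ) (P : Set ℕ) (n : ℕ) : coeff n (Xi k P) = missedCoeff k {0} P n := by
  have h := coeff_uDerivAtOne_bivariateGF (A := fun n => Fin n → Fin n)
    (fun _ f => FunConstraint P f) (fun _ f x => x ∉ Set.range f^[k]) n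
  have h1 : Nat.card {p : (Fin n → Fin n) × Fin n // FunConstraint P p.1 ∧
      p.2 ∉ Set.range p.1^[k]} = Nat.card {p : (Fin n → Option (Fin n)) × Fin n //
      (∀ o, {y | p.1 y = o}.ncard ∈ optionConstraint {0} P o) ∧
        ∀ y, iter p.1 k y ≠ some p.2} := by
    refine Nat.card_congr (Equiv.ofBijective (fun p => ⟨(fun y => some (p.1.1 y), p.1.2),
      (ncard_fiber_some_comp_mem_iff P p.1.1).2 p.2.1, fun y hy => p.2.2 ⟨y, ?_⟩⟩) ⟨?_, ?_⟩)
    · rw [iter_some_comp] at hy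
      exact Option.some.inj hy
    · rintro ⟨⟨f, x⟩, hf⟩ ⟨⟨f', x'⟩, hf'⟩ hp
      have h3 := congrArg (fun q => q.1.1) hp
      obtain rfl : x = x' := congrArg (fun q => q.1.2) hp
      obtain rfl : f = f' := funext fun y => Option.some.inj (congrFun h3 y)
      rfl
    · rintro ⟨⟨f, x⟩, hf, hx⟩
      have hsome : ∀ y, ∃ z, f y = some z := fun y => by
        have h3 := hf none
        have h4 : {y | f y = none} = ∅ := (Set.ncard_eq_zero).1 h3
        exact Option.ne_none_iff_exists'.1 fun hy => (h4 ▸ (show y ∈ {y | f y = none} from hy) :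
          y ∈ (∅ : Set (Fin n)))
      choose g hg using hsome
      obtain rfl : f = fun y => some (g y) := funext hg
      refine ⟨⟨(g, x), (ncard_fiber_some_comp_mem_iff P g).1 hf, ?_⟩, rfl⟩
      rintro ⟨y, hy⟩
      exact hx y (by rw [iter_some_comp]; exact congrArg some hy)
  rw [h1, card_missed, factorial_inv_mul_cancel] at h
  exact h

lemma coeff_XiCyc (P : Set ℕ) (n : ℕ) : coeff n (XiCyc P) = ∑ m ∈ Finset.range n,
    coeff (n - (m + 1)) (expSeries (shift P 1) ^ (m + 1) * expSeries P ^ (n - (m + 1))) := by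
  have h := coeff_uDerivAtOne_bivariateGF (A := fun n => Fin n → Fin n)
    (fun _ f => FunConstraint P f) (fun _ f x => x ∈ Function.periodicPts f) n
  have h1 := card_cyclic n P
  rw [← Finset.mul_sum] at h1
  refine h.trans ?_
  rw [← factorial_inv_mul_cancel n (∑ m ∈ Finset.range n, _), ← h1]
  rfl

/-- Termwise differentiation of a power series. -/
lemma hasSum_deriv_of_hasSum {a : ℕ → ℂ} {G : ℂ → ℂ} {ρ : ℝ}
    (h : ∀ z : ℂ, ‖z‖ < ρ → HasSum (fun n => a n * z ^ (n + 1)) (G z)) {z : ℂ} (hz : ‖z‖ < ρ) :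
    Summable (fun n : ℕ => ‖((n : ℂ) + 1) * a n * z ^ n‖) ∧
      ∀ {G' : ℂ}, HasDerivAt G G' z → HasSum (fun n : ℕ => ((n : ℂ) + 1) * a n * z ^ n) G' := by
  have hsum : ∀ r : ℝ, 0 ≤ r → r < ρ → Summable fun n : ℕ => ((n : ℝ) + 1) * ‖a n‖ * r ^ n := by
    intro r hr0 hr
    -- Convergence at the intermediate radius s bounds ‖a n‖ sⁿ⁺¹, so the differentiated terms are
    -- O((n + 1) (r/s)ⁿ).
    obtain ⟨s, hrs, hs⟩ := exists_between hr
    have hs0 : 0 < s := hr0.trans_lt hrs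
    have hlim := (h s (by rwa [Complex.norm_real, Real.norm_of_nonneg hs0.le])).summable.norm
      |>.tendsto_atTop_zero
    obtain ⟨C, hC⟩ := hlim.bddAbove_range
    have hq : ‖r / s‖ < 1 := by
      rw [Real.norm_of_nonneg (by positivity), div_lt_one hs0]; exact hrs
    have h1 := (summable_pow_mul_geometric_of_norm_lt_one 1 hq).add
      (summable_geometric_of_norm_lt_one hq)
    refine (h1.mul_left (C / s)).of_nonneg_of_le (fun n => by positivity) fun n => ?_
    have h3 : ‖a n‖ * s ^ (n + 1) ≤ C := by
      have := hC ⟨n, rfl⟩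
      simpa [abs_of_pos hs0] using this
    have h4 : ‖a n‖ ≤ C / s ^ (n + 1) := (le_div_iff₀ (by positivity)).2 h3
    calc ((n : ℝ) + 1) * ‖a n‖ * r ^ n ≤ ((n : ℝ) + 1) * (C / s ^ (n + 1)) * r ^ n := by gcongr
      _ = C / s * ((n : ℝ) ^ 1 * (r / s) ^ n + (r / s) ^ n) := by
        rw [div_pow, pow_succ]; field_simp
  have hnorm : ∀ (n : ℕ) (w : ℂ), ‖((n : ℂ) + 1) * a n * w ^ n‖ =
      ((n : ℝ) + 1) * ‖a n‖ * ‖w‖ ^ n := fun n w => by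
    rw [norm_mul, norm_mul, norm_pow, ← Nat.cast_succ, Complex.norm_natCast, Nat.cast_succ]
  have hs : Summable (fun n : ℕ => ‖((n : ℂ) + 1) * a n * z ^ n‖) := by
    simpa only [hnorm] using hsum ‖z‖ (norm_nonneg z) hz
  refine ⟨hs, fun {G'} hG' => ?_⟩
  obtain ⟨r, hzr, hr⟩ := exists_between hz
  have hr0 : 0 < r := (norm_nonneg z).trans_lt hzr
  have hd : HasDerivAt (fun w => ∑' n, a n * w ^ (n + 1))
      (∑' n : ℕ, ((n : ℂ) + 1) * a n * z ^ n) z := by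
    refine hasDerivAt_tsum_of_isPreconnected (t := Metric.ball (0 : ℂ) r)
      (g := fun (n : ℕ) (y : ℂ) => a n * y ^ (n + 1))
      (g' := fun (n : ℕ) (y : ℂ) => ((n : ℂ) + 1) * a n * y ^ n)
      (hsum r hr0.le hr) Metric.isOpen_ball (convex_ball _ _).isPreconnected ?_ ?_ (y₀ := 0)
      ?_ ?_ ?_
    · intro n y _
      convert! (hasDerivAt_pow (n + 1) y).const_mul (a n) using 1
      rw [Nat.add_sub_cancel]; push_cast; ring
    · intro n y hy
      rw [hnorm]
      have := (mem_ball_zero_iff.1 hy).le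
      gcongr
    · exact Metric.mem_ball_self hr0
    · exact (h 0 (by rw [norm_zero]; exact hr0.trans hr)).summable
    · exact mem_ball_zero_iff.2 hzr
  have hev : G =ᶠ[𝓝 z] fun w => ∑' n, a n * w ^ (n + 1) := by
    filter_upwards [continuous_norm.continuousAt.eventually_lt_const hz] with w hw
      using (h w hw).tsum_eq.symm
  rw [hG'.unique (hd.congr_of_eventuallyEq hev)]
  exact hs.of_norm.hasSum

/-- The generating function `T_{≤ k-1}` of trees of height less than `k`, as a complex power
series. -/
def treeSeries (k : ℕ) (P : Set ℕ) : PowerSeries ℂ :=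
  mk fun n => (treeCount k P (Fin n) : ℂ) / n.factorial

lemma entireSeries_treeSeries (k : ℕ) (P : Set ℕ) : EntireSeries (treeSeries k P) := fun r hr => by
  refine (summable_treeCount k P hr).congr fun n => ?_
  rw [treeSeries, coeff_mk, norm_div, Complex.norm_natCast, Complex.norm_natCast]

lemma seriesEval_treeSeries_rho (k : ℕ) (P : Set ℕ) :
    seriesEval (treeSeries k P) (rho P) = tauK k P := by
  rw [seriesEval, tauK, Complex.ofReal_tsum]
  refine tsum_congr fun n => ?_
  rw [treeSeries, treeGF, coeff_mk, coeff_mk, treeCount_fin]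
  push_cast
  rfl

lemma treeSeries_zero (P : Set ℕ) : treeSeries 0 P = 0 := by
  ext n
  have : treeCount 0 P (Fin n) = 0 := by
    rw [treeCount, Nat.card_eq_zero]
    left
    refine ⟨fun p => ?_⟩
    obtain ⟨d, hd, -⟩ := p.2.1.2 p.1.2
    exact absurd hd (Nat.not_lt_zero d)
  simp [treeSeries, this]

/-- The one-node tree already contributes. Positivity makes the leading constant of the asymptotics
nonzero. -/
lemma tauK_pos {k : ℕ} (hk : k ≠ 0) {P : Set ℕ} (h0 : 0 ∈ P) (hρ : 0 < rho P) :
    0 < tauK k P := by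
  have hcoeff : ∀ n, coeff n (treeGF k P) = (treeCount k P (Fin n) : ℝ) / n.factorial := fun n => by
    rw [treeGF, coeff_mk, treeCount_fin]
  unfold tauK
  simp only [hcoeff]
  refine (summable_treeCount k P hρ.le).tsum_pos (fun n => by positivity) 1 ?_
  have : 0 < treeCount k P (Fin 1) := by
    rw [treeCount, Nat.card_pos_iff]
    refine ⟨⟨⟨(fun _ => none, 0), ⟨fun x => ?_, fun x => ⟨0, Nat.pos_of_ne_zero hk, ?_⟩⟩,
      fun x => ?_⟩⟩, inferInstance⟩
    · simp [Subsingleton.elim x 0]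
    · rw [iter_zero, Subsingleton.elim x 0]
    · simpa using h0
  positivity

end

end PreimageConstraint

/-! ### Closed forms in terms of the tree function. -/

namespace PreimageConstraint

noncomputable section

open PowerSeries

/-- The denominator `1 - z e_P'(t)` of Lagrange inversion. -/
def treeDen (P : Set ℕ) (z t : ℂ) : ℂ := 1 - z * cexpP (shift P 1) t

/-- The derivative in `z` of `e_R(T) / (e_P(T) (1 - z e_P'(T)))`, where `T = z e_P(T)`. -/
def missedFactor (R P : Set ℕ) (z t : ℂ) : ℂ :=
  cexpP (shift R 1) t / treeDen P z t ^ 2 +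
    z * cexpP R t * cexpP (shift P 2) t / treeDen P z t ^ 3

section Values

variable {P : Set ℕ} (h0 : 0 ∈ P) (h2 : (shift P 2).Nonempty) {z t : ℂ}
include h0 h2

lemma norm_mul_cexpP_shift_lt (hz : ‖z‖ < rho P) (ht : ‖t‖ ≤ tau P) :
    ‖z * cexpP (shift P 1) t‖ < 1 := by
  rw [norm_mul]
  exact (mul_le_mul_of_nonneg_left (norm_cexpP_le _ ht) (norm_nonneg z)).trans_lt
    (norm_mul_truncExp_shift_lt h0 h2 hz)

lemma treeDen_ne_zero (hz : ‖z‖ < rho P) (ht : ‖t‖ ≤ tau P) : treeDen P z t ≠ 0 := fun h => by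
  have h1 := norm_mul_cexpP_shift_lt h0 h2 hz ht
  rw [← sub_eq_zero.1 h, norm_one] at h1
  exact lt_irrefl _ h1

lemma hasSum_coeff_mul_pow {q : PowerSeries ℂ} (hq : EntireSeries q) (hz : ‖z‖ < rho P)
    (ht : ‖t‖ ≤ tau P) (hfix : IsTreeValue P z t) :
    HasSum (fun n => coeff n (q * expSeries P ^ n) * z ^ n) (seriesEval q t / treeDen P z t) := by
  have h := hasSum_lagrange (entireSeries_expSeries P) (tau_pos h0 h2)
    (by rw [seriesNorm_expSeries]; exact norm_mul_truncExp_lt h0 h2 hz)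
    (by rw [derivative_expSeries, seriesNorm_expSeries]
        exact norm_mul_truncExp_shift_lt h0 h2 hz) ht hfix hq
  rwa [derivative_expSeries] at h

lemma hasSum_coeff_succ_mul_pow {q : PowerSeries ℂ} (hq : EntireSeries q) (hz : ‖z‖ < rho P)
    (ht : ‖t‖ ≤ tau P) (hfix : IsTreeValue P z t) :
    HasSum (fun n => coeff (n + 1) (q * expSeries P ^ n) * z ^ (n + 1))
      (seriesEval q t / (cexpP P t * treeDen P z t) - coeff 0 q) := by
  have h := hasSum_lagrange_succ (entireSeries_expSeries P) (tau_pos h0 h2)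
    (by rw [seriesNorm_expSeries]; exact norm_mul_truncExp_lt h0 h2 hz)
    (by rw [derivative_expSeries, seriesNorm_expSeries]
        exact norm_mul_truncExp_shift_lt h0 h2 hz) ht hfix (coeff_zero_expSeries h0) hq
  rwa [derivative_expSeries] at h

lemma hasSum_coeff_XiCyc (hz : ‖z‖ < rho P) (ht : ‖t‖ ≤ tau P) (hfix : IsTreeValue P z t) :
    HasSum (fun n => coeff n (XiCyc P) * z ^ n)
      (z * cexpP (shift P 1) t / treeDen P z t ^ 2) := by
  set D := treeDen P z t with hD
  have hD0 : D ≠ 0 := treeDen_ne_zero h0 h2 hz ht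
  set φ := expSeries P
  set ψ := expSeries (shift P 1)
  have hφ : EntireSeries φ := entireSeries_expSeries P
  have hψ : EntireSeries ψ := entireSeries_expSeries _
  have hτ := tau_pos h0 h2
  set w := z * cexpP (shift P 1) t with hw
  -- Indices: cycle length minus one, and number of nodes off the cycle. Lagrange inversion sums
  -- over the second to wⁱ⁺¹ / D; since 1 - w = D, the geometric series over the first gives w / D².
  set g : ℕ × ℕ → ℂ := fun p => coeff p.2 (ψ ^ (p.1 + 1) * φ ^ p.2) * z ^ (p.1 + 1 + p.2) with hg
  have hs : Summable g := by
    set a : ℝ := ‖z‖ * truncExp (shift P 1) (tau P)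
    set b : ℝ := ‖z‖ * truncExp P (tau P) / tau P
    have hψn : 0 ≤ truncExp (shift P 1) (tau P) := (truncExp_shift_pos h0 h2).le
    have hφn : 0 ≤ truncExp P (tau P) := (truncExp_tau_pos h0 h2).le
    have ha : 0 ≤ a := by positivity
    have hb : 0 ≤ b := by positivity
    have hb1 : b < 1 := (div_lt_one hτ).2 (norm_mul_truncExp_lt h0 h2 hz)
    have hgeo := ((summable_geometric_of_lt_one ha
      (norm_mul_truncExp_shift_lt h0 h2 hz)).mul_left a).mul_of_nonneg
      (summable_geometric_of_lt_one hb hb1) (fun n => by positivity) (fun n => by positivity)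
    refine Summable.of_norm (hgeo.of_nonneg_of_le (fun _ => norm_nonneg _) fun p => ?_)
    rw [hg, norm_mul, norm_pow]
    have h1 := norm_coeff_mul_pow_le hφ (hψ.pow (p.1 + 1)) hτ p.2 p.2
    have h3 := hψ.seriesNorm_pow_le hτ.le (p.1 + 1)
    rw [seriesNorm_expSeries] at h1 h3
    calc _ ≤ truncExp (shift P 1) (tau P) ^ (p.1 + 1) * truncExp P (tau P) ^ p.2 / tau P ^ p.2 *
          ‖z‖ ^ (p.1 + 1 + p.2) := by
          refine mul_le_mul_of_nonneg_right (h1.trans ?_) (by positivity)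
          gcongr
      _ = a * a ^ p.1 * b ^ p.2 := by
          rw [← pow_succ', mul_pow, div_pow, mul_pow, pow_add]; ring
  have hin : ∀ i : ℕ, HasSum (fun m => g (i, m)) (w * w ^ i / D) := fun i => by
    have h := (hasSum_coeff_mul_pow h0 h2 (hψ.pow (i + 1)) hz ht hfix).mul_left (z ^ (i + 1))
    convert! h using 1
    · funext m
      simp only [hg, pow_add]
      ring
    · rw [hψ.eval_pow, hw, ← pow_succ', mul_pow, mul_div_assoc]
      rfl
  have hout : HasSum (fun i : ℕ => w * w ^ i / D) (w / D ^ 2) := by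
    have h := ((hasSum_geometric_of_norm_lt_one
      (norm_mul_cexpP_shift_lt h0 h2 hz ht)).mul_left w).div_const D
    convert! h using 1
    rw [← hw, show 1 - w = D from rfl]
    field_simp
  have htot : HasSum g (w / D ^ 2) := by
    have := hs.hasSum
    rwa [(this.prod_fiberwise hin).unique hout] at this
  have hanti : HasSum (fun n => ∑ p ∈ Finset.HasAntidiagonal.antidiagonal n, g p)
      (w / D ^ 2) := by
    have h := (Finset.HasAntidiagonal.sigmaAntidiagonalEquivProd (A := ℕ)).hasSum_iff.2 htot
    refine h.sigma fun n => ?_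
    rw [← Finset.sum_coe_sort]
    exact hasSum_fintype _
  -- Antidiagonal n collects the maps on n + 1 nodes, and size 0 contributes nothing.
  have h1 : coeff 0 (XiCyc P) * z ^ 0 = 0 := by simp [coeff_XiCyc]
  refine (hasSum_nat_add_iff' 1).1 ?_
  rw [Finset.sum_range_one, h1, sub_zero]
  refine hanti.congr_fun fun n => ?_
  rw [coeff_XiCyc, Finset.sum_mul, Finset.Nat.sum_antidiagonal_eq_sum_range_succ_mk]
  refine Finset.sum_congr rfl fun i hi => ?_
  have hi' : i ≤ n := Nat.lt_succ_iff.1 (Finset.mem_range.1 hi)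
  rw [hg, Nat.add_sub_add_right]
  simp only
  rw [show i + 1 + (n - i) = n + 1 by omega]

end Values

lemma analyticAt_treeDen (P : Set ℕ) {T : ℂ → ℂ} {z : ℂ} (hT : AnalyticAt ℂ T z) :
    AnalyticAt ℂ (fun y => treeDen P y (T y)) z :=
  analyticAt_const.sub (analyticAt_id.mul ((analyticAt_cexpP _ _).comp hT))

section Continuation

variable {P : Set ℕ} (h0 : 0 ∈ P) {T : ℂ → ℂ} {V : Set ℂ} (hV : IsOpen V)
  (hT : AnalyticOnNhd ℂ T V) (hfix : ∀ z ∈ V, IsTreeValue P z (T z))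
include h0 hV hT hfix

/-- Differentiating T = z e_P(T) gives T' D = e_P(T) ≠ 0. So D cannot vanish where T is analytic,
and no estimate outside the disc is needed. -/
lemma treeDen_ne_zero_of_continuation {z : ℂ} (hz : z ∈ V) :
    treeDen P z (T z) ≠ 0 ∧ HasDerivAt T (cexpP P (T z) / treeDen P z (T z)) z := by
  have hd := (hT z hz).differentiableAt.hasDerivAt
  have h1 : HasDerivAt (fun y => y * cexpP P (T y))
      (1 * cexpP P (T z) + z * (cexpP (shift P 1) (T z) * deriv T z)) z :=
    (hasDerivAt_id z).mul ((hasDerivAt_cexpP P (T z)).comp z hd)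
  have h3 : T =ᶠ[𝓝 z] fun y => y * cexpP P (T y) := by
    filter_upwards [hV.mem_nhds hz] with y hy using hfix y hy
  have h4 := hd.unique (h1.congr_of_eventuallyEq h3)
  have h5 : deriv T z * treeDen P z (T z) = cexpP P (T z) := by
    unfold treeDen
    linear_combination h4
  have h6 : treeDen P z (T z) ≠ 0 :=
    right_ne_zero_of_mul (h5.trans_ne ((hfix z hz).cexpP_ne_zero h0))
  refine ⟨h6, ?_⟩
  rwa [← h5, mul_div_cancel_right₀ _ h6]

lemma hasDerivAt_missedFactor (R : Set ℕ) {z : ℂ} (hz : z ∈ V) :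
    HasDerivAt (fun y => cexpP R (T y) / (cexpP P (T y) * treeDen P y (T y)))
      (missedFactor R P z (T z)) z := by
  obtain ⟨hD, hd⟩ := treeDen_ne_zero_of_continuation h0 hV hT hfix hz
  have hφ := (hfix z hz).cexpP_ne_zero h0
  have hR := (hasDerivAt_cexpP R (T z)).comp z hd
  have hφ' := (hasDerivAt_cexpP P (T z)).comp z hd
  have hψ' := (hasDerivAt_cexpP (shift P 1) (T z)).comp z hd
  rw [shift_shift_one] at hψ'
  have hD' : HasDerivAt (fun y => treeDen P y (T y)) _ z :=
    ((hasDerivAt_id z).mul hψ').const_sub 1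
  refine (hR.div (hφ'.mul hD') (mul_ne_zero hφ hD)).congr_deriv ?_
  simp only [Function.comp_apply, id, missedFactor, Pi.mul_apply]
  field_simp
  ring

lemma analyticOnNhd_missedFactor (R : Set ℕ) :
    AnalyticOnNhd ℂ (fun y => missedFactor R P y (T y)) V := fun z hz => by
  have hD := analyticAt_treeDen P (hT z hz)
  have hD0 := (treeDen_ne_zero_of_continuation h0 hV hT hfix hz).1
  have hc : ∀ Q, AnalyticAt ℂ (fun y => cexpP Q (T y)) z := fun Q =>
    (analyticAt_cexpP _ _).comp (hT z hz)
  exact ((hc _).div (hD.pow 2) (pow_ne_zero 2 hD0)).add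
    (((analyticAt_id.mul (hc _)).mul (hc _)).div (hD.pow 3) (pow_ne_zero 3 hD0))

/-- The Cauchy product of the tree series with the derivative of ∑ zⁿ⁺¹ [tⁿ⁺¹] e_R e_Pⁿ;
differentiation produces the factor n - s + 1 in `missedCoeff`. -/
lemma hasSum_missedCoeff (h2 : (shift P 2).Nonempty) (hball : Metric.ball 0 (rho P) ⊆ V)
    (hle : ∀ z, ‖z‖ < rho P → ‖T z‖ ≤ tau P) (k : ℕ) (R : Set ℕ) {z : ℂ} (hz : ‖z‖ < rho P) :
    HasSum (fun n => missedCoeff k R P n * z ^ n)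
      (seriesEval (treeSeries k P) z * missedFactor R P z (T z)) := by
  have hmem : ∀ w : ℂ, ‖w‖ < rho P → w ∈ V := fun w hw => hball (mem_ball_zero_iff.2 hw)
  obtain ⟨hs, hsum⟩ := hasSum_deriv_of_hasSum (fun w hw => hasSum_coeff_succ_mul_pow h0 h2
    (entireSeries_expSeries R) hw (hle w hw) (hfix w (hmem w hw))) hz
  have h1 := hsum ((hasDerivAt_missedFactor h0 hV hT hfix R (hmem z hz)).sub_const _)
  have hT' := entireSeries_treeSeries k P
  have h3 := hasSum_sum_range_mul_of_summable_norm (hT'.summable_norm z) hs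
  rw [(hT'.hasSum z).tsum_eq, h1.tsum_eq] at h3
  refine h3.congr_fun fun n => ?_
  rw [missedCoeff, Finset.sum_mul]
  refine Finset.sum_congr rfl fun s hs => ?_
  have hsn : s ≤ n := Nat.lt_succ_iff.1 (Finset.mem_range.1 hs)
  rw [← Nat.add_sub_of_le hsn, pow_add, treeSeries, coeff_mk, Nat.add_sub_of_le hsn]
  ring

end Continuation

end

end PreimageConstraint

/-! ### Singular asymptotics and Δ-domains. -/

namespace PreimageConstraint

noncomputable section

lemma isEquivalent_div_pow {l : Filter ℂ} {u D s : ℂ → ℂ} {a c : ℂ} (hu : Tendsto u l (𝓝 a))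
    (ha : a ≠ 0) (hD : Tendsto (fun z => D z / s z) l (𝓝 c)) (hc : c ≠ 0)
    (hs : ∀ᶠ z in l, s z ≠ 0) (j : ℕ) :
    (fun z => u z / D z ^ j) ~[l] fun z => a / c ^ j * (s z ^ j)⁻¹ := by
  have h1 : D ~[l] fun z => c * s z := by
    refine (((isEquivalent_const_iff_tendsto hc).2 hD).mul
      (IsEquivalent.refl (u := s))).congr_left ?_
    filter_upwards [hs] with z hz
    exact div_mul_cancel₀ _ hz
  refine (((isEquivalent_const_iff_tendsto ha).2 hu).div (h1.pow j)).congr_right ?_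
  refine Eventually.of_forall fun z => ?_
  simp only [Pi.div_apply, Pi.pow_apply, Function.const_apply, mul_pow]
  rw [div_mul_eq_div_div, div_eq_mul_inv]

lemma one_sub_div_cpow_eq (s : ℝ) (z : ℂ) :
    (1 - z / s) ^ (-(1 / 2) : ℂ) = (sqrtAt s z ^ 1)⁻¹ ∧
      (1 - z / s) ^ (-1 : ℂ) = (sqrtAt s z ^ 2)⁻¹ ∧
        (1 - z / s) ^ (-(3 / 2) : ℂ) = (sqrtAt s z ^ 3)⁻¹ := by
  refine ⟨?_, ?_, ?_⟩
  · rw [Complex.cpow_neg, pow_one, sqrtAt]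
  · rw [Complex.cpow_neg_one, sqrtAt_sq]
  · rw [Complex.cpow_neg, sqrtAt, ← Complex.cpow_nat_mul]
    norm_num

/-- With c² = 2 τ ρ e₂ the left side is t / (2 τ c), and ρ e = τ gives √(e / (8 e₂)) = τ / (2 c). -/
lemma mul_mul_div_pow_three_eq {t τ ρ e e₂ : ℝ} (hτ : 0 < τ) (hρ : 0 < ρ) (h2 : 0 < e₂)
    (h : ρ * e = τ) :
    t * (ρ * e₂) / √(2 * τ * ρ * e₂) ^ 3 = t / τ ^ 2 * √(e / (8 * e₂)) := by
  set c := √(2 * τ * ρ * e₂) with hc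
  have hpos : 0 < 2 * τ * ρ * e₂ := by positivity
  have hc0 : 0 < c := Real.sqrt_pos.2 hpos
  have hc2 : c ^ 2 = 2 * τ * ρ * e₂ := Real.sq_sqrt hpos.le
  have h3 : √(e / (8 * e₂)) = τ / (2 * c) := by
    rw [Real.sqrt_eq_iff_mul_self_eq_of_pos (by positivity), ← sq, div_pow, mul_pow, hc2]
    field_simp
    linear_combination -8 * h
  rw [h3, pow_succ, hc2]
  field_simp

lemma ExtendsPast.of_analyticOnNhd {f : PowerSeries ℂ} {s : ℝ} {G : ℂ → ℂ} {V : Set ℂ}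
    (hG : AnalyticOnNhd ℂ G V) (hball : Metric.ball 0 s ⊆ V)
    (hV : ∃ δ > 0, Metric.ball (s : ℂ) δ ∩ slit s ⊆ V)
    (hsum : ∀ z : ℂ, ‖z‖ < s → HasSum (fun n => PowerSeries.coeff n f * z ^ n) (G z)) :
    ExtendsPast f s G := by
  obtain ⟨δ, hδ, hsub⟩ := hV
  exact ⟨hsum, δ, hδ, hG.mono (union_subset hball hsub)⟩

lemma deltaAnalytic_of_slitDisc {G : ℂ → ℂ} {s r : ℝ} (hs : 0 < s) (hr : s < r)
    (hG : AnalyticOnNhd ℂ G (slitDisc s r)) : DeltaAnalytic fun z => G (s * z) := by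
  -- Any angle in (0, π/2) works: on the ray [1, ∞) the argument of z - 1 is 0, so the Δ-domain
  -- avoids it.
  refine ⟨Real.pi / 4, r / s, (one_lt_div hs).2 hr, by positivity, by linarith [Real.pi_pos],
    fun z hz => ?_⟩
  obtain ⟨hzr, hz1, harg⟩ := hz
  have hmem : (s : ℂ) * z ∈ slitDisc s r := by
    refine ⟨?_, fun h => ?_⟩
    · rw [mem_ball_zero_iff, norm_mul, Complex.norm_real, Real.norm_of_nonneg hs.le, mul_comm]
      exact (lt_div_iff₀ hs).1 hzr
    · rw [Complex.im_ofReal_mul, Complex.re_ofReal_mul] at h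
      have him : z.im = 0 := (mul_eq_zero.1 h.1).resolve_left hs.ne'
      have hre : 1 ≤ z.re := by
        by_contra! hlt
        nlinarith [h.2]
      have h1 : z - 1 = ((z.re - 1 : ℝ) : ℂ) := by
        apply Complex.ext <;> simp [him]
      rw [h1, Complex.arg_ofReal_of_nonneg (by linarith), abs_zero] at harg
      linarith [Real.pi_pos]
  exact AnalyticAt.fun_comp (hG _ hmem) (analyticAt_const.mul analyticAt_id)

end

end PreimageConstraint

/-! ### Assembly of the theorem. -/

open PreimageConstraint

theorem mainTheorem4 (k : ℕ) (P : Set ℕ) (h0 : 0 ∈ P)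
    (h2 : (PreimageConstraint.shift P 2).Nonempty) :
    ∃ f fCyc fXi fPar fXiPar : ℂ → ℂ,
      -- the five generating functions, continued past the disc of radius `ρ`
      PreimageConstraint.ExtendsPast (PreimageConstraint.F P) (PreimageConstraint.rho P) f ∧
      PreimageConstraint.ExtendsPast (PreimageConstraint.XiCyc P) (PreimageConstraint.rho P) fCyc ∧
      PreimageConstraint.ExtendsPast (PreimageConstraint.Xi k P) (PreimageConstraint.rho P) fXi ∧
      PreimageConstraint.ExtendsPast (PreimageConstraint.Par P) (PreimageConstraint.rho P) fPar ∧
      PreimageConstraint.ExtendsPast (PreimageConstraint.XiPartial k P)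
        (PreimageConstraint.rho P) fXiPar ∧
      -- asymptotics as `z → ρ` off the ray `[ρ, ∞)`
      (let τ : ℝ := PreimageConstraint.tau P
       let ρ : ℝ := PreimageConstraint.rho P
       let e : ℝ := PreimageConstraint.truncExp P τ
       let e₂ : ℝ := PreimageConstraint.truncExp (PreimageConstraint.shift P 2) τ
       let l : Filter ℂ := 𝓝[PreimageConstraint.slit ρ] (ρ : ℂ)
       (f ~[l] fun z => ((1 / √(2 * τ * ρ * e₂) : ℝ) : ℂ) * (1 - z / ρ) ^ (-(1 / 2) : ℂ)) ∧
       (fCyc ~[l] fun z => ((1 / (2 * τ * ρ * e₂) : ℝ) : ℂ) * (1 - z / ρ) ^ (-1 : ℂ)) ∧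
       (fXi ~[l] fun z => ((PreimageConstraint.tauK k P / τ ^ 2 * √(e / (8 * e₂)) : ℝ) : ℂ) *
          (1 - z / ρ) ^ (-(3 / 2) : ℂ)) ∧
       (fPar ~[l] fun z => ((Real.exp τ : ℝ) : ℂ) * f z) ∧
       (fXiPar ~[l] fun z => ((Real.exp τ : ℝ) : ℂ) * fXi z)) ∧
      -- the aperiodic case
      (Nat.setGcd P = 1 →
        (∃ r > PreimageConstraint.rho P, ∀ G ∈ ({f, fCyc, fXi, fPar, fXiPar} : Set (ℂ → ℂ)),
          AnalyticOnNhd ℂ G (PreimageConstraint.slitDisc (PreimageConstraint.rho P) r)) ∧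
        ∀ G ∈ ({f, fCyc, fXi, fPar, fXiPar} : Set (ℂ → ℂ)),
          PreimageConstraint.DeltaAnalytic fun z => G (PreimageConstraint.rho P * z)) := by
  obtain ⟨T, V, hVo, hT, hfix, hball, hle, hδ, hlim, hlimD, hgcd⟩ :=
    exists_tree_continuation h0 h2
  have hτ := tau_pos h0 h2
  have hρ := rho_pos h0 h2
  have he₂ := truncExp_shift_two_pos h0 h2
  set τ := tau P with hτdef
  set ρ := rho P with hρdef
  set e₂ := truncExp (shift P 2) τ with he₂def
  set c : ℝ := √(2 * τ * ρ * e₂) with hcdef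
  have hc : c ≠ 0 := (Real.sqrt_pos.2 (by positivity)).ne'
  have hc2 : c ^ 2 = 2 * τ * ρ * e₂ := Real.sq_sqrt (by positivity)
  have hcC : (c : ℂ) ≠ 0 := Complex.ofReal_ne_zero.2 hc
  set l : Filter ℂ := 𝓝[slit ρ] (ρ : ℂ) with hl
  have hmem : ∀ z : ℂ, ‖z‖ < ρ → z ∈ V := fun z hz => hball (mem_ball_zero_iff.2 hz)
  have hD : ∀ z ∈ V, treeDen P z (T z) ≠ 0 := fun z hz =>
    (treeDen_ne_zero_of_continuation h0 hVo hT hfix hz).1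
  have hcT : ∀ (Q : Set ℕ) (z : ℂ), z ∈ V → AnalyticAt ℂ (fun y => cexpP Q (T y)) z :=
    fun Q z hz => (analyticAt_cexpP _ _).comp (hT z hz)
  -- the three families of functions
  set A : Set ℕ → ℂ → ℂ := fun R z => cexpP R (T z) / treeDen P z (T z) with hA
  set B : ℂ → ℂ := fun z => z * cexpP (shift P 1) (T z) / treeDen P z (T z) ^ 2 with hB
  set M : Set ℕ → ℂ → ℂ := fun R z =>
    PreimageConstraint.seriesEval (treeSeries k P) z * missedFactor R P z (T z) with hM
  have hAan : ∀ R, AnalyticOnNhd ℂ (A R) V := fun R z hz =>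
    (hcT R z hz).div (analyticAt_treeDen P (hT z hz)) (hD z hz)
  have hBan : AnalyticOnNhd ℂ B V := fun z hz =>
    (analyticAt_id.mul (hcT _ z hz)).div ((analyticAt_treeDen P (hT z hz)).pow 2)
      (pow_ne_zero 2 (hD z hz))
  have hMan : ∀ R, AnalyticOnNhd ℂ (M R) V := fun R z hz =>
    ((entireSeries_treeSeries k P).analyticAt z).mul
      (analyticOnNhd_missedFactor h0 hVo hT hfix R z hz)
  have hAsum : ∀ (R : Set ℕ) (z : ℂ), ‖z‖ < ρ → HasSum
      (fun n => PowerSeries.coeff n (expSeries R * expSeries P ^ n) * z ^ n) (A R z) :=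
    fun R z hz => hasSum_coeff_mul_pow h0 h2 (entireSeries_expSeries R) hz (hle z hz)
      (hfix z (hmem z hz))
  have hMsum : ∀ (R : Set ℕ) (z : ℂ), ‖z‖ < ρ →
      HasSum (fun n => missedCoeff k R P n * z ^ n) (M R z) := fun R z hz =>
    hasSum_missedCoeff h0 hVo hT hfix h2 hball hle k R hz
  -- limits at the dominant singularity
  have hslit : ∀ᶠ z in l, z ∈ slit ρ := self_mem_nhdsWithin
  have hVl : ∀ᶠ z in l, z ∈ V := by
    obtain ⟨δ, hδ0, hsub⟩ := hδ
    filter_upwards [hslit, mem_nhdsWithin_of_mem_nhds (Metric.ball_mem_nhds (ρ : ℂ) hδ0)]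
      with z hz hz' using hsub ⟨hz', hz⟩
  have hs0 : ∀ᶠ z in l, sqrtAt ρ z ≠ 0 := hslit.mono fun z hz => sqrtAt_ne_zero hρ hz
  have hid : Tendsto (fun z : ℂ => z) l (𝓝 (ρ : ℂ)) := tendsto_id.mono_left nhdsWithin_le_nhds
  have hexp : ∀ Q, Tendsto (fun z => cexpP Q (T z)) l (𝓝 (truncExp Q τ : ℂ)) := fun Q => by
    rw [← cexpP_ofReal]
    exact (analyticAt_cexpP Q τ).continuousAt.tendsto.comp hlim
  have hDlim : Tendsto (fun z => treeDen P z (T z) / sqrtAt ρ z) l (𝓝 (c : ℂ)) := hlimD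
  have hD0 : Tendsto (fun z => treeDen P z (T z)) l (𝓝 0) := by
    have h := (tendsto_const_nhds (x := (1 : ℂ))).sub (hid.mul (hexp (shift P 1)))
    rw [← Complex.ofReal_mul, rho_mul_truncExp_shift h0 h2, Complex.ofReal_one, sub_self] at h
    exact h
  have hposC : ∀ {x : ℝ}, 0 < x → (x : ℂ) ≠ 0 := fun hx => Complex.ofReal_ne_zero.2 hx.ne'
  have hAas : ∀ R : Set ℕ, 0 < truncExp R τ →
      A R ~[l] fun z => ((truncExp R τ / c : ℝ) : ℂ) * (1 - z / ρ) ^ (-(1 / 2) : ℂ) :=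
    fun R hR => by
      have h := isEquivalent_div_pow (hexp R) (hposC hR) hDlim hcC hs0 1
      simp only [pow_one] at h
      simp only [(one_sub_div_cpow_eq ρ _).1, pow_one, Complex.ofReal_div]
      exact h
  have hBas : B ~[l] fun z => ((1 / c ^ 2 : ℝ) : ℂ) * (1 - z / ρ) ^ (-1 : ℂ) := by
    have hlim1 := hid.mul (hexp (shift P 1))
    rw [← Complex.ofReal_mul, rho_mul_truncExp_shift h0 h2, Complex.ofReal_one] at hlim1
    have h := isEquivalent_div_pow hlim1 one_ne_zero hDlim hcC hs0 2
    simp only [(one_sub_div_cpow_eq ρ _).2.1]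
    push_cast
    exact h
  have hMas : k ≠ 0 → ∀ R : Set ℕ, 0 < truncExp R τ →
      M R ~[l] fun z => ((truncExp R τ * (tauK k P * (ρ * e₂) / c ^ 3) : ℝ) : ℂ) *
        (1 - z / ρ) ^ (-(3 / 2) : ℂ) := fun hk R hR => by
    have htk := tauK_pos hk h0 hρ
    have hTk : Tendsto (PreimageConstraint.seriesEval (treeSeries k P)) l (𝓝 (tauK k P : ℂ)) := by
      rw [← seriesEval_treeSeries_rho]
      exact ((entireSeries_treeSeries k P).analyticAt _).continuousAt.tendsto.comp hid
    -- Over the common denominator D³ the first term of `missedFactor` gains a factor D → 0, so only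
    -- the triple pole contributes.
    have hu := hTk.mul (((hexp (shift R 1)).mul hD0).add
      ((hid.mul (hexp R)).mul (hexp (shift P 2))))
    have hne : (tauK k P : ℂ) * (truncExp (shift R 1) τ * 0 +
        ρ * truncExp R τ * truncExp (shift P 2) τ) ≠ 0 := by
      rw [mul_zero, zero_add]
      exact mul_ne_zero (hposC htk) (mul_ne_zero (mul_ne_zero (hposC hρ) (hposC hR)) (hposC he₂))
    have h := isEquivalent_div_pow hu hne hDlim hcC hs0 3
    simp only [(one_sub_div_cpow_eq ρ _).2.2]
    refine (h.congr_left ?_).congr_right (Eventually.of_forall fun z => ?_)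
    · filter_upwards [hVl] with z hz
      have := hD z hz
      simp only [hM, missedFactor]
      field_simp
    · push_cast
      ring
  have hτ0 : truncExp {0} τ = 1 := by
    have h := cexpP_ofReal {0} τ
    rw [cexpP, expSeries_singleton_zero, seriesEval_one] at h
    exact_mod_cast h.symm
  have hτ1 : truncExp univ τ = Real.exp τ := by
    have h := cexpP_ofReal univ τ
    rw [cexpP_univ, ← Complex.ofReal_exp] at h
    exact_mod_cast h.symm
  -- There is no tree of height less than 0. The relations for k = 0 read 0 ~ 0 and are separate,
  -- since `isEquivalent_div_pow` needs a nonzero limit.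
  have hMzero : k = 0 → ∀ R, M R = fun _ => 0 := by
    rintro rfl R
    funext z
    simp [hM, treeSeries_zero, PreimageConstraint.seriesEval]
  have htauK : k = 0 → tauK k P = 0 := by
    rintro rfl
    have h := seriesEval_treeSeries_rho 0 P
    rw [treeSeries_zero] at h
    have h1 : (tauK 0 P : ℂ) = 0 := by rw [← h]; simp [PreimageConstraint.seriesEval]
    exact_mod_cast h1
  have hpos0 : 0 < truncExp {0} τ := hτ0.trans_gt one_pos
  have hpos1 : 0 < truncExp univ τ := hτ1.trans_gt (Real.exp_pos τ)
  have hmem5 : ∀ G ∈ ({A {0}, B, M {0}, A univ, M univ} : Set (ℂ → ℂ)),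
      AnalyticOnNhd ℂ G V := by
    rintro G (rfl | rfl | rfl | rfl | rfl)
    exacts [hAan _, hBan, hMan _, hAan _, hMan _]
  refine ⟨A {0}, B, M {0}, A univ, M univ,
    .of_analyticOnNhd (hAan _) hball hδ fun z hz => ?_,
    .of_analyticOnNhd hBan hball hδ fun z hz =>
      hasSum_coeff_XiCyc h0 h2 hz (hle z hz) (hfix z (hmem z hz)),
    .of_analyticOnNhd (hMan _) hball hδ fun z hz => ?_,
    .of_analyticOnNhd (hAan _) hball hδ fun z hz => ?_,
    .of_analyticOnNhd (hMan _) hball hδ fun z hz => ?_,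
    ⟨?_, ?_, ?_, ?_, ?_⟩, fun hg => ?_⟩
  · simpa only [coeff_F] using hAsum {0} z hz
  · simpa only [coeff_Xi] using hMsum {0} z hz
  · simpa only [coeff_Par] using hAsum univ z hz
  · simpa only [coeff_XiPartial] using hMsum univ z hz
  · have h := hAas {0} hpos0
    rwa [hτ0] at h
  · rwa [hc2] at hBas
  · rcases eq_or_ne k 0 with hk | hk
    · rw [hMzero hk, htauK hk]
      simp only [zero_div, zero_mul, Complex.ofReal_zero]
      exact IsEquivalent.refl
    · have h := hMas hk {0} hpos0
      rwa [hτ0, one_mul, hcdef, mul_mul_div_pow_three_eq hτ hρ he₂ (rho_mul_truncExp h0 h2)] at h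
  · refine (hAas univ hpos1).trans (((IsEquivalent.refl (u := fun _ : ℂ =>
      ((Real.exp τ : ℝ) : ℂ))).mul (hAas {0} hpos0)).symm.congr_left (Eventually.of_forall ?_))
    intro z
    rw [hτ0, hτ1]
    push_cast
    simp only [Pi.mul_apply]
    ring
  · rcases eq_or_ne k 0 with hk | hk
    · rw [hMzero hk, hMzero hk]
      simp only [mul_zero]
      exact IsEquivalent.refl
    · refine (hMas hk univ hpos1).trans (((IsEquivalent.refl (u := fun _ : ℂ =>
        ((Real.exp τ : ℝ) : ℂ))).mul (hMas hk {0} hpos0)).symm.congr_left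
          (Eventually.of_forall ?_))
      intro z
      rw [hτ0, hτ1]
      push_cast
      simp only [Pi.mul_apply]
      ring
  · obtain ⟨r, hr, hsub⟩ := hgcd hg
    exact ⟨⟨r, hr, fun G hG => (hmem5 G hG).mono hsub⟩,
      fun G hG => deltaAnalytic_of_slitDisc hρ hr ((hmem5 G hG).mono hsub)⟩
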